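/- For $n\ge 2$ let $D=\bigcup_{v}D_v$ be a set of $n(n-1)$ darts, with $|D_v|=n-1$ darts at each vertex $v$ of the complete graph $K_n$. Let $\mathcal M(K_n)$ be the set of triples $m=(D,R,E)$, where $R$ is a permutation of $D$ that is a product of one full cycle on each $D_v$, and $E$ is a fixed point free involution of $D$ such that for each two vertices $v\ne w$ exactly one 2-cycle of $E$ consists of a dart of $D_v$ and a dart of $D_w$. The cycles of the face permutation $R\cdot E$ are the faces of $m$. For $Y\subseteq D$, the permutation of $Y$ induced by $R\cdot E$ is obtained by deleting from the cycles of $R\cdot E$ all symbols outside $Y$. Probabilities and expectations refer to a uniformly random $m\in\mathcal M(K_n)$. For $0\le p\le 1$ let $P_{n,p}$ be the distribution on $\{1,\dots,n\}$ with $$P_{n,p}(k)=\begin{cases}p\,\dfrac{2c(n,k)}{n!}, & n+k\text{ odd},\\[2mm](1-p)\,\dfrac{2c(n,k)}{n!}, & n+k\text{ even},\end{cases}$$ where $c(n,k)$ is the number of permutations of $n$ symbols with $k$ cycles, and let $\|P-Q\|=\frac12\sum_k|P(k)-Q(k)|$. For each $n$ choose a vertex $v=v_n$ of $K_n$. Let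 $F_v(m)\subseteq D$ be the set of all darts in faces that contain at least one dart of $D_v$, and let $\omega_v(m)$ be the permutation of $D_v$ induced by $R\cdot E$. (1) $\mathbb E|F_v(m)|=(1-o(1))|D|$ as $n\to\infty$. The number of cycles of the permutation induced by $R\cdot E$ on $F_v(m)$ lies in $\{1,\dots,n-1\}$, and its distribution $Q_{n-1}$ satisfies $\|Q_{n-1}-P_{n-1,p}\|\to0$, where $p=p(n)=\Pr[\omega_v(m)\text{ is odd}]$. (2) There are sets $D'=D'(m)$ with $D_v\subseteq D'(m)\subseteq F_v(m)$ and $|F_v(m)\setminus D'(m)|\le1$, such that the permutation $\alpha(m)$ induced by $R\cdot E$ on $D'(m)$ is odd if and only if $\omega_v(m)$ is odd, and such that $\mathbb E|D'(m)|=(1-o(1))|D|$, the number of cycles of $\alpha(m)$ lies in $\{1,\dots,n-1\}$, and its distribution $Q_{n-1}$ satisfies $\|Q_{n-1}-P_{n-1,p}\|\to0$ with $p=p(n)=\Pr[\alpha(m)\text{ is odd}]$. -/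

import Mathlib

open Filter Topology
open scoped Classical

noncomputable section

/-! ### Induced permutations and cycle counts -/

section Induced

variable {X : Type*} [Fintype X]

theorem exists_return (a : Equiv.Perm X) (Y : Finset X) (x : {x // x ∈ Y}) :
    ∃ k : ℕ, 0 < k ∧ (a ^ k) x.1 ∈ Y :=
  ⟨orderOf a, orderOf_pos a, by rw [pow_orderOf_eq_one]; exact x.2⟩

/-- The least `k > 0` such that `a ^ k` maps `x ∈ Y` back into `Y`. -/
def returnTime (a : Equiv.Perm X) (Y : Finset X) (x : {x // x ∈ Y}) : ℕ :=
  Nat.find (exists_return a Y x)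

/-- The element of `Y` that follows `x` on its cycle of `a`
once all symbols outside `Y` have been deleted. -/
def returnMap (a : Equiv.Perm X) (Y : Finset X) (x : {x // x ∈ Y}) : {x // x ∈ Y} :=
  ⟨(a ^ returnTime a Y x) x.1, (Nat.find_spec (exists_return a Y x)).2⟩

theorem returnTime_le_of_eq (a : Equiv.Perm X) (Y : Finset X) (x y : {x // x ∈ Y})
    (h : returnMap a Y x = returnMap a Y y) : returnTime a Y y ≤ returnTime a Y x := by
  by_contra! hlt
  have h1 : (a ^ returnTime a Y x) x.1 = (a ^ returnTime a Y y) y.1 := congrArg Subtype.val h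
  have h2 : returnTime a Y y = returnTime a Y x + (returnTime a Y y - returnTime a Y x) := by
    omega
  rw [h2, pow_add, Equiv.Perm.mul_apply] at h1
  have h3 : x.1 = (a ^ (returnTime a Y y - returnTime a Y x)) y.1 :=
    (a ^ returnTime a Y x).injective h1
  have hx : 0 < returnTime a Y x := (Nat.find_spec (exists_return a Y x)).1
  have h4 : returnTime a Y y ≤ returnTime a Y y - returnTime a Y x :=
    Nat.find_min' (exists_return a Y y) ⟨by omega, h3 ▸ x.2⟩
  omega

theorem returnMap_injective (a : Equiv.Perm X) (Y : Finset X) :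
    Function.Injective (returnMap a Y) := by
  intro x y h
  have ht : returnTime a Y x = returnTime a Y y :=
    le_antisymm (returnTime_le_of_eq a Y y x h.symm) (returnTime_le_of_eq a Y x y h)
  have h1 : (a ^ returnTime a Y x) x.1 = (a ^ returnTime a Y y) y.1 := congrArg Subtype.val h
  rw [ht] at h1
  exact Subtype.ext ((a ^ returnTime a Y y).injective h1)

/-- The induced permutation of `a` on `Y`: delete all symbols outside `Y` from the disjoint
cycle notation of `a`. -/
def inducedPerm (a : Equiv.Perm X) (Y : Finset X) : Equiv.Perm {x // x ∈ Y} :=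
  Equiv.ofBijective (returnMap a Y) (Finite.injective_iff_bijective.1 (returnMap_injective a Y))

/-- The number of cycles of a permutation, fixed points included. -/
def numCycles (a : Equiv.Perm X) : ℕ := Multiset.card a.partition.parts

/-- A permutation is odd. -/
def IsOddPerm (a : Equiv.Perm X) : Prop := Equiv.Perm.sign a = -1

end Induced

/-! ### Random embeddings of graphs -/

section Maps

variable {V : Type*} [Fintype V] (G : SimpleGraph V)

/-- The darts (half-edges): `deg v` darts at each vertex `v`. -/
abbrev DartSet : Type _ := Σ v : V, Fin (G.degree v)

/-- The set `D_v` of darts at the vertex `v`. -/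
def dartsAt (v : V) : Finset (DartSet G) := Finset.univ.filter fun d => d.1 = v

/-- Local rotations: `R` is a product of one full cycle on each `D_v`. -/
def IsLocalRotation (R : Equiv.Perm (DartSet G)) : Prop :=
  ∀ v, R.IsCycleOn (dartsAt G v : Set (DartSet G))

/-- Edge schemes: fixed point free involutions such that for each edge `vw` exactly one 2-cycle
consists of a dart at `v` and a dart at `w`; this 2-cycle is recorded by its dart at `v`. -/
def IsEdgeScheme (E : Equiv.Perm (DartSet G)) : Prop :=
  (∀ d, E d ≠ d) ∧ (∀ d, E (E d) = d) ∧ ∀ v w, G.Adj v w → ∃! d, d.1 = v ∧ (E d).1 = w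

/-- The set of maps `m = (R, E)` with `R` a local rotation and `E` an edge scheme. -/
def embeddings : Finset (Equiv.Perm (DartSet G) × Equiv.Perm (DartSet G)) :=
  Finset.univ.filter fun m => IsLocalRotation G m.1 ∧ IsEdgeScheme G m.2

/-- The probability of an event for a uniformly random embedding. -/
def embProb (A : Equiv.Perm (DartSet G) × Equiv.Perm (DartSet G) → Prop) : ℝ :=
  ((embeddings G).filter A).card / (embeddings G).card

/-- The expectation of a random variable on a uniformly random embedding. -/
def embExp (f : Equiv.Perm (DartSet G) × Equiv.Perm (DartSet G) → ℝ) : ℝ :=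
  (∑ m ∈ embeddings G, f m) / (embeddings G).card

variable {G}

/-- The face permutation `R · E`. Permutations are multiplied from left to right here, so `R` is
applied first. -/
def facePerm (m : Equiv.Perm (DartSet G) × Equiv.Perm (DartSet G)) : Equiv.Perm (DartSet G) :=
  m.2 * m.1

/-- The set of all darts contained in faces that have at least one dart at `v`. -/
def dartsOfFacesAt (v : V) (m : Equiv.Perm (DartSet G) × Equiv.Perm (DartSet G)) :
    Finset (DartSet G) :=
  Finset.univ.filter fun d => ∃ e ∈ dartsAt G v, (facePerm m).SameCycle e d

/-- The permutation `ω_v(m)` of `D_v` induced by the face permutation. -/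
def localFacePerm (v : V) (m : Equiv.Perm (DartSet G) × Equiv.Perm (DartSet G)) :
    Equiv.Perm {d // d ∈ dartsAt G v} :=
  inducedPerm (facePerm m) (dartsAt G v)

end Maps

/-! ### Distributions on cycle counts -/

/-- The distribution `P_{n,p}` on `{1, …, n}`. -/
def stirlingDist (n : ℕ) (p : ℝ) (k : ℕ) : ℝ :=
  if Odd (n + k) then p * (2 * (Nat.stirlingFirst n k : ℝ) / (n.factorial : ℝ))
  else (1 - p) * (2 * (Nat.stirlingFirst n k : ℝ) / (n.factorial : ℝ))

/-- Total variation difference of two distributions on `{1, …, n}`. -/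
def tvDist (n : ℕ) (P Q : ℕ → ℝ) : ℝ :=
  (1 / 2) * ∑ k ∈ Finset.Icc 1 n, |P k - Q k|

/-- The complete graph on `n` vertices. -/
abbrev K (n : ℕ) : SimpleGraph (Fin n) := ⊤

/-- Pairs of permutations of the darts of `K_n`; the embeddings of `K_n` are among them. -/
abbrev KMap (n : ℕ) : Type := Equiv.Perm (DartSet (K n)) × Equiv.Perm (DartSet (K n))

/-- The distribution of the number of cycles of the permutation that the face permutation of a
uniformly random embedding `m` of `K_n` induces on the set of darts `D' m`. -/
def cycleDist (n : ℕ) (D' : KMap n → Finset (DartSet (K n))) (k : ℕ) : ℝ :=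
  embProb (K n) fun m => numCycles (inducedPerm (facePerm m) (D' m)) = k

end

/-! ### Cycles of permutations -/

section Cycles

variable {X Y : Type*}

/-! The number of cycles of an induced permutation depends only on which cycles the set meets
(`numCycles_inducedPerm_eq`). Every set between D_v and F_v therefore gives as many cycles as ω_v,
and two claims remain: ω_v has nearly the right distribution of cycles, and few darts lie outside
F_v. A prescribed parity is reached by dropping at most one dart, which flips the sign but keeps the
number of cycles.

Fix the edge scheme E. The rotations are independent uniform full cycles, and up to relabelling ω_v
is `outerPerm E ρ v * ρ v`, whose first factor β depends only on the rotations at the other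
vertices. So ω_v is the product of a uniform full cycle with an independent permutation. For a fixed
permutation b of n points, the sum over q of t^q ∑_a q^(number of cycles of ab), with a running over
the full cycles, equals (number of full cycles) · t · ∏(1 - t^ℓ) / (1 - t)^(n+2), where ℓ runs over
the cycle lengths of b (`cycleSeries_eq`). Expanding ∏(1 - t^ℓ)/(1 - t) turns this into a
combination of content polynomials of hooks (`cyclePoly_eq`). The two extreme hooks give exactly the
cycle distribution of random permutations of the parity forced by b; if b has no fixed points, the
other hooks contribute O(1/n). A fixed point of b does not change the cycle distribution of ab at
all, and comparing the limiting laws for n and n + 1 points costs O(1/n). The total error is O((1 +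
number of fixed points of b)/n) (`sum_abs_cycleFreq_sub_le_div`).

It remains to show that β has o(n) fixed points and that F_v misses o(|D|) darts, both in
expectation. Delete v. A random map is recovered from a random map of the rest by inserting at each
other vertex w the dart towards v after a uniformly random dart x_w. Darts outside F_v lie on faces
of the smaller map without any x_w, and fixed points of β come from x_u that are alone among the x_w
on their face. Both are unlikely on faces much longer than the common degree, so everything rests on
`sum_rotations_min_le`: most darts lie on such faces. Indeed, the cycle through a given point in the
product of a fixed permutation and a random full cycle is rarely short (`shortCount_le`), so a face
usually returns often to the vertex of a given dart. As different darts at a vertex lead to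
different neighbours, the face then visits many vertices, most of them many times. -/

theorem Finset.card_image_eq_card_image_of_kernel {Z : Type*} [DecidableEq Y] [DecidableEq Z]
    (s : Finset X) (f : X → Y) (g : X → Z)
    (h : ∀ x ∈ s, ∀ y ∈ s, f x = f y ↔ g x = g y) : (s.image f).card = (s.image g).card := by
  refine Finset.card_bij (fun z hz => g (Finset.mem_image.1 hz).choose) ?_ ?_ ?_
  · intro z hz
    exact Finset.mem_image_of_mem _ (Finset.mem_image.1 hz).choose_spec.1
  · intro z hz z' hz' he
    have h1 := (Finset.mem_image.1 hz).choose_spec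
    have h2 := (Finset.mem_image.1 hz').choose_spec
    rw [← h1.2, ← h2.2]
    exact (h _ h1.1 _ h2.1).2 he
  · intro w hw
    obtain ⟨x, hx, rfl⟩ := Finset.mem_image.1 hw
    refine ⟨f x, Finset.mem_image_of_mem _ hx, ?_⟩
    have h1 := (Finset.mem_image.1 (Finset.mem_image_of_mem f hx)).choose_spec
    exact (h _ h1.1 _ hx).1 h1.2

variable [Fintype X]

theorem numCycles_eq_card_cycleFactors (a : Equiv.Perm X) :
    numCycles a = a.cycleFactorsFinset.card + (Fintype.card X - a.support.card) := by
  rw [numCycles, Equiv.Perm.parts_partition, Multiset.card_add, Multiset.card_replicate,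
    Equiv.Perm.cycleType_def, Multiset.card_map]
  rfl

/-- The number of cycles is the number of values of a function whose level sets are the cycles. -/
theorem numCycles_eq_card_image (a : Equiv.Perm X) (f : X → Y)
    (h : ∀ x y, f x = f y ↔ a.SameCycle x y) : numCycles a = (Finset.univ.image f).card := by
  have hu : (Finset.univ : Finset X) = a.support ∪ a.supportᶜ := by simp
  have hd : Disjoint (a.support.image f) (a.supportᶜ.image f) := by
    rw [Finset.disjoint_left]
    intro z hz hz'
    obtain ⟨x, hx, rfl⟩ := Finset.mem_image.1 hz
    obtain ⟨y, hy, hxy⟩ := Finset.mem_image.1 hz'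
    rw [Finset.mem_compl, Equiv.Perm.mem_support, not_not] at hy
    rw [Equiv.Perm.mem_support] at hx
    exact hx ((((h _ _).1 hxy).apply_eq_self_iff).1 hy)
  have h1 : (a.supportᶜ.image f).card = Fintype.card X - a.support.card := by
    rw [Finset.card_image_of_injOn, Finset.card_compl]
    intro x hx y hy hxy
    rw [Finset.mem_coe, Finset.mem_compl, Equiv.Perm.mem_support, not_not] at hx
    exact Equiv.Perm.SameCycle.eq_of_left ((h _ _).1 hxy) hx
  have h2 : (a.support.image f).card = a.cycleFactorsFinset.card := by
    rw [Finset.card_image_eq_card_image_of_kernel a.support f a.cycleOf]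
    · congr 1
      ext c
      constructor
      · intro hc
        obtain ⟨x, hx, rfl⟩ := Finset.mem_image.1 hc
        exact Equiv.Perm.cycleOf_mem_cycleFactorsFinset_iff.2 hx
      · intro hc
        obtain ⟨x, hx⟩ := (Equiv.Perm.mem_cycleFactorsFinset_iff.1 hc).1.nonempty_support
        refine Finset.mem_image.2 ⟨x, Equiv.Perm.mem_cycleFactorsFinset_support_le hc hx, ?_⟩
        exact (Equiv.Perm.cycle_is_cycleOf hx hc).symm
    · intro x hx y hy
      rw [h, Equiv.Perm.sameCycle_iff_cycleOf_eq_of_mem_support hx hy]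
  rw [numCycles_eq_card_cycleFactors, hu, Finset.image_union, Finset.card_union_of_disjoint hd, h1, h2]

theorem numCycles_eq_card_of_surjective [Fintype Y] (a : Equiv.Perm X) (f : X → Y)
    (hf : Function.Surjective f)
    (h : ∀ x y, f x = f y ↔ a.SameCycle x y) : numCycles a = Fintype.card Y := by
  rw [numCycles_eq_card_image a f h, Finset.image_univ_of_surjective hf, Finset.card_univ]

theorem numCycles_eq_card_quotient (a : Equiv.Perm X) :
    numCycles a = Fintype.card (Quotient (Equiv.Perm.SameCycle.setoid a)) :=
  numCycles_eq_card_of_surjective a (Quotient.mk _) Quotient.mk_surjective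
    fun _ _ => Quotient.eq

/-- The usual exponent is the number of points minus the number of cycles; the sum has the same
parity and avoids truncated subtraction. -/
theorem sign_eq_neg_one_pow_numCycles (a : Equiv.Perm X) :
    Equiv.Perm.sign a = (-1) ^ (Fintype.card X + numCycles a) := by
  have h := a.support.card_le_univ
  rw [Equiv.Perm.sign_of_cycleType, Equiv.Perm.sum_cycleType, numCycles_eq_card_cycleFactors,
    Equiv.Perm.cycleType_def, Multiset.card_map, ← Nat.sub_add_cancel h]
  have : a.cycleFactorsFinset.val.card = a.cycleFactorsFinset.card := rfl
  rw [this, Nat.add_sub_cancel]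
  generalize Fintype.card X - a.support.card = u
  rw [show u + a.support.card + (a.cycleFactorsFinset.card + u)
    = (a.support.card + a.cycleFactorsFinset.card) + 2 * u by ring, pow_add _ _ (2 * u), pow_mul]
  simp

theorem numCycles_le_card (a : Equiv.Perm X) : numCycles a ≤ Fintype.card X := by
  rw [numCycles_eq_card_quotient]
  exact Fintype.card_le_of_surjective _ Quotient.mk_surjective

theorem numCycles_pos [Nonempty X] (a : Equiv.Perm X) : 0 < numCycles a := by
  rw [numCycles_eq_card_quotient]
  have : Nonempty (Quotient (Equiv.Perm.SameCycle.setoid a)) := Nonempty.map (Quotient.mk _) ‹_›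
  exact Fintype.card_pos

theorem Equiv.Perm.SameCycle.apply_eq_of_invariant {a : Equiv.Perm X} {x y : X}
    (h : a.SameCycle x y) (f : X → Y) (hf : ∀ x, f (a x) = f x) : f x = f y := by
  obtain ⟨k, rfl⟩ := h.exists_nat_pow_eq
  induction k with
  | zero => rfl
  | succ k ih =>
    rw [pow_succ', Equiv.Perm.mul_apply, hf]
    exact ih (Equiv.Perm.sameCycle_pow_right.2 (Equiv.Perm.SameCycle.refl _ _))

theorem Equiv.Perm.SameCycle.map_of_step {b : Equiv.Perm Y} {a : Equiv.Perm X} {x y : X}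
    (h : a.SameCycle x y) (g : X → Y) (hg : ∀ x, b.SameCycle (g x) (g (a x))) :
    b.SameCycle (g x) (g y) := by
  obtain ⟨k, rfl⟩ := h.exists_nat_pow_eq
  induction k with
  | zero => exact Equiv.Perm.SameCycle.refl _ _
  | succ k ih =>
    rw [pow_succ', Equiv.Perm.mul_apply]
    exact (ih (Equiv.Perm.sameCycle_pow_right.2 (Equiv.Perm.SameCycle.refl _ _))).trans (hg _)

omit [Fintype X] in
theorem sameCycle_permCongr (e : X ≃ Y) (a : Equiv.Perm X) (x y : Y) :
    (e.permCongr a).SameCycle x y ↔ a.SameCycle (e.symm x) (e.symm y) := by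
  constructor
  · rintro ⟨k, hk⟩
    refine ⟨k, ?_⟩
    rw [← hk, ← Equiv.permCongrHom_coe, ← map_zpow]
    simp
  · rintro ⟨k, hk⟩
    refine ⟨k, ?_⟩
    rw [← Equiv.permCongrHom_coe, ← map_zpow]
    simp [hk]

theorem numCycles_permCongr [Fintype Y] (e : X ≃ Y) (a : Equiv.Perm X) :
    numCycles (e.permCongr a) = numCycles a := by
  rw [numCycles_eq_card_quotient a]
  refine numCycles_eq_card_of_surjective _ (fun y => Quotient.mk _ (e.symm y))
    (Quotient.mk_surjective.comp e.symm.surjective) fun x y => ?_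
  rw [sameCycle_permCongr]
  exact Quotient.eq

theorem numCycles_mul_comm (a b : Equiv.Perm X) : numCycles (a * b) = numCycles (b * a) := by
  rw [← numCycles_permCongr b (a * b)]
  congr 1
  ext x
  simp

end Cycles

/-! ### Adding a point to a permutation, inside a cycle or as a fixed point -/

section OptionPerm

variable {X : Type*}

/-- The permutation of `Option X` obtained from `a` by inserting `none` after `x` into its cycle. -/
noncomputable abbrev insertAfter (a : Equiv.Perm X) (x : X) : Equiv.Perm (Option X) :=
  Equiv.optionCongr a * Equiv.swap none (some x)

theorem insertAfter_none (a : Equiv.Perm X) (x : X) : insertAfter a x none = some (a x) := by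
  simp [insertAfter]

theorem insertAfter_some_self (a : Equiv.Perm X) (x : X) : insertAfter a x (some x) = none := by
  simp [insertAfter]

theorem insertAfter_some_of_ne (a : Equiv.Perm X) {x y : X} (h : y ≠ x) :
    insertAfter a x (some y) = some (a y) := by
  simp [insertAfter, Equiv.swap_apply_of_ne_of_ne, h]

variable [Fintype X]

/-- The new point `none` stands directly after `x`, so collapsing it onto `x` by `getD x` turns the
cycles of the enlarged permutation into those of `a`. -/
theorem sameCycle_insertAfter (a : Equiv.Perm X) (x : X) (u v : Option X) :
    (insertAfter a x).SameCycle u v ↔ a.SameCycle (u.getD x) (v.getD x) := by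
  constructor
  · intro h
    have := h.apply_eq_of_invariant
      (fun u => (Quotient.mk (Equiv.Perm.SameCycle.setoid a) (u.getD x))) ?_
    · exact Quotient.eq.1 this
    · rintro (_ | y)
      · rw [insertAfter_none]
        refine Quotient.sound ?_
        exact (Equiv.Perm.sameCycle_apply_left.2 (Equiv.Perm.SameCycle.refl _ _))
      · by_cases hy : y = x
        · subst hy; rw [insertAfter_some_self]; rfl
        · rw [insertAfter_some_of_ne a hy]
          refine Quotient.sound ?_
          exact (Equiv.Perm.sameCycle_apply_left.2 (Equiv.Perm.SameCycle.refl _ _))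
  · intro h
    have h1 : ∀ u : Option X, (insertAfter a x).SameCycle u (some (u.getD x)) := by
      rintro (_ | y)
      · have : (insertAfter a x) (some x) = none := insertAfter_some_self a x
        refine Equiv.Perm.SameCycle.symm ⟨1, ?_⟩
        simp
      · exact Equiv.Perm.SameCycle.refl _ _
    refine (h1 u).trans ((h.map_of_step some fun y => ?_).trans (h1 v).symm)
    by_cases hy : y = x
    · subst hy
      exact ⟨2, by rw [zpow_two, Equiv.Perm.mul_apply, insertAfter_some_self, insertAfter_none]⟩
    · exact ⟨1, by rw [zpow_one, insertAfter_some_of_ne a hy]⟩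

theorem numCycles_insertAfter (a : Equiv.Perm X) (x : X) :
    numCycles (insertAfter a x) = numCycles a := by
  rw [numCycles_eq_card_quotient a]
  refine numCycles_eq_card_of_surjective _ (fun u => Quotient.mk _ (u.getD x)) ?_ fun u v => ?_
  · intro q
    obtain ⟨y, rfl⟩ := Quotient.mk_surjective q
    exact ⟨some y, rfl⟩
  · rw [sameCycle_insertAfter]
    exact Quotient.eq

theorem sameCycle_optionCongr_some (a : Equiv.Perm X) (x y : X) :
    Equiv.Perm.SameCycle (Equiv.optionCongr a) (some x) (some y) ↔ a.SameCycle x y := by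
  constructor
  · intro h
    have := h.apply_eq_of_invariant
      (fun u => u.map (Quotient.mk (Equiv.Perm.SameCycle.setoid a))) ?_
    · exact Quotient.eq.1 (Option.some_injective _ this)
    · rintro (_ | y)
      · rfl
      · simp only [Equiv.optionCongr_apply, Option.map_some, Option.some.injEq]
        refine Quotient.sound ?_
        exact (Equiv.Perm.sameCycle_apply_left.2 (Equiv.Perm.SameCycle.refl _ _))
  · intro h
    refine h.map_of_step (b := Equiv.optionCongr a) some fun y => ⟨1, by simp⟩

omit [Fintype X] in
theorem sameCycle_optionCongr_none (a : Equiv.Perm X) (u : Option X) :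
    Equiv.Perm.SameCycle (Equiv.optionCongr a) none u ↔ u = none := by
  constructor
  · intro h
    exact (h.eq_of_left (by simp [Function.IsFixedPt])).symm
  · rintro rfl; exact Equiv.Perm.SameCycle.refl _ _

theorem numCycles_optionCongr (a : Equiv.Perm X) :
    numCycles (Equiv.optionCongr a) = numCycles a + 1 := by
  rw [numCycles_eq_card_quotient a, ← Fintype.card_option]
  refine numCycles_eq_card_of_surjective _ (fun u => u.map (Quotient.mk _)) ?_ fun u v => ?_
  · rintro (_ | q)
    · exact ⟨none, rfl⟩
    · obtain ⟨y, rfl⟩ := Quotient.mk_surjective q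
      exact ⟨some y, rfl⟩
  · rcases u with _ | u
    · rw [sameCycle_optionCongr_none]
      cases v <;> simp
    · rcases v with _ | v
      · rw [Equiv.Perm.sameCycle_comm, sameCycle_optionCongr_none]; simp
      · rw [sameCycle_optionCongr_some, Option.map_some, Option.map_some, Option.some_inj]
        exact Quotient.eq

end OptionPerm

/-! ### Induced permutations -/

section Induced

variable {X : Type*} [Fintype X]

theorem inducedPerm_coe (a : Equiv.Perm X) (Y : Finset X) (x : {x // x ∈ Y}) :
    (inducedPerm a Y x : X) = (a ^ returnTime a Y x) x.1 := rfl

theorem returnTime_pos (a : Equiv.Perm X) (Y : Finset X) (x : {x // x ∈ Y}) :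
    0 < returnTime a Y x := (Nat.find_spec (exists_return a Y x)).1

theorem returnTime_le (a : Equiv.Perm X) (Y : Finset X) (x : {x // x ∈ Y}) {k : ℕ} (hk : 0 < k)
    (h : (a ^ k) x.1 ∈ Y) : returnTime a Y x ≤ k := Nat.find_min' (exists_return a Y x) ⟨hk, h⟩

theorem inducedPerm_coe_eq (a : Equiv.Perm X) (Y : Finset X) (x : {x // x ∈ Y}) {k : ℕ}
    (hk : 0 < k) (h : (a ^ k) x.1 ∈ Y) (hlt : ∀ j, 0 < j → j < k → (a ^ j) x.1 ∉ Y) :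
    (inducedPerm a Y x : X) = (a ^ k) x.1 := by
  have h1 : returnTime a Y x = k := by
    refine le_antisymm (returnTime_le a Y x hk h) ?_
    by_contra! hc
    exact hlt _ (returnTime_pos a Y x) hc (Nat.find_spec (exists_return a Y x)).2
  rw [inducedPerm_coe, h1]

theorem sameCycle_inducedPerm (a : Equiv.Perm X) (Y : Finset X) (x y : {x // x ∈ Y}) :
    (inducedPerm a Y).SameCycle x y ↔ a.SameCycle x.1 y.1 := by
  constructor
  · intro h
    exact h.map_of_step Subtype.val fun z => ⟨returnTime a Y z, by rw [inducedPerm_coe]; simp⟩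
  · intro h
    obtain ⟨k, hk⟩ := h.exists_nat_pow_eq
    -- One step of the induced permutation uses up `returnTime` steps of `a`, so the remaining
    -- exponent decreases.
    induction k using Nat.strong_induction_on generalizing x with
    | _ k ih =>
      rcases Nat.eq_zero_or_pos k with rfl | hpos
      · have : x = y := Subtype.ext (by simpa using hk)
        rw [this]
      · have hle := returnTime_le a Y x hpos (hk ▸ y.2)
        have hrp := returnTime_pos a Y x
        rw [← Equiv.Perm.sameCycle_apply_left]
        have hk' : (a ^ (k - returnTime a Y x)) (inducedPerm a Y x : X) = y.1 := by
          rw [inducedPerm_coe, ← Equiv.Perm.mul_apply, ← pow_add, Nat.sub_add_cancel hle, hk]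
        exact ih (k - returnTime a Y x) (by omega) _ ⟨_, by rw [zpow_natCast]; exact hk'⟩ hk'

/-- Two sets that meet the same cycles have induced permutations with equally many cycles. -/
theorem numCycles_inducedPerm_eq (a : Equiv.Perm X) (Y Z : Finset X) (hYZ : Y ⊆ Z)
    (hZ : ∀ z ∈ Z, ∃ y ∈ Y, a.SameCycle y z) :
    numCycles (inducedPerm a Z) = numCycles (inducedPerm a Y) := by
  let f : X → Quotient (Equiv.Perm.SameCycle.setoid a) := Quotient.mk _
  -- The cycles of the induced permutation on `W` correspond to the cycles of `a` that meet `W`.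
  have key : ∀ W : Finset X, numCycles (inducedPerm a W) = (W.image f).card := by
    intro W
    rw [numCycles_eq_card_image (inducedPerm a W) (fun x => f x.1)
      fun x y => by rw [sameCycle_inducedPerm]; exact Quotient.eq]
    congr 1
    ext q
    simp
  rw [key, key]
  congr 1
  refine Finset.Subset.antisymm ?_ (Finset.image_subset_image hYZ)
  intro q hq
  obtain ⟨z, hz, rfl⟩ := Finset.mem_image.1 hq
  obtain ⟨y, hy, hyz⟩ := hZ z hz
  exact Finset.mem_image.2 ⟨y, hy, Quotient.sound hyz⟩

/-- The factor from `z` acts first and moves only points of `Y`. After this one move the orbit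
follows `a` until it is back in `Y`, so both return at the same time. -/
theorem inducedPerm_mul_ofSubtype (a : Equiv.Perm X) (Y : Finset X) [DecidablePred (· ∈ Y)]
    (z : Equiv.Perm {x // x ∈ Y}) :
    inducedPerm (a * Equiv.Perm.ofSubtype z) Y = inducedPerm a Y * z := by
  ext x
  have hstep : ∀ j, 0 < j → j ≤ returnTime a Y (z x) →
      ((a * Equiv.Perm.ofSubtype z) ^ j) x.1 = (a ^ j) (z x).1 := by
    intro j hj
    induction j, hj using Nat.le_induction with
    | base => intro _; simp
    | succ j hj ih =>
      intro hle
      have hnot : (a ^ j) (z x).1 ∉ Y := fun hmem =>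
        absurd (returnTime_le a Y (z x) hj hmem) (by omega)
      rw [pow_succ', Equiv.Perm.mul_apply, ih (by omega), Equiv.Perm.mul_apply,
        Equiv.Perm.ofSubtype_apply_of_not_mem z hnot, pow_succ', Equiv.Perm.mul_apply]
  have hpos := returnTime_pos a Y (z x)
  rw [inducedPerm_coe_eq _ Y x hpos]
  · rw [hstep _ hpos le_rfl, Equiv.Perm.mul_apply, inducedPerm_coe]
  · rw [hstep _ hpos le_rfl, ← inducedPerm_coe]; exact (inducedPerm a Y (z x)).2
  · intro j hj hlt
    rw [hstep j hj hlt.le]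
    exact fun hmem => absurd (returnTime_le a Y (z x) hj hmem) (by omega)

end Induced

/-! ### Full cycles -/

section FullCycles

variable {X Y : Type*} [Fintype X] [Fintype Y]

/-- The set of permutations of `X` that consist of one cycle. -/
noncomputable def fullCycles (X : Type*) [Fintype X] : Finset (Equiv.Perm X) :=
  Finset.univ.filter fun a => ∀ x y, a.SameCycle x y

theorem mem_fullCycles {a : Equiv.Perm X} : a ∈ fullCycles X ↔ ∀ x y, a.SameCycle x y := by
  simp [fullCycles]

theorem permCongr_mem_fullCycles (e : X ≃ Y) {a : Equiv.Perm X} :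
    e.permCongr a ∈ fullCycles Y ↔ a ∈ fullCycles X := by
  simp only [mem_fullCycles, sameCycle_permCongr]
  constructor
  · intro h x y
    simpa using h (e x) (e y)
  · exact fun h x y => h _ _

theorem sum_fullCycles_permCongr {M : Type*} [AddCommMonoid M] (e : X ≃ Y)
    (F : Equiv.Perm Y → M) :
    ∑ a ∈ fullCycles Y, F a = ∑ a ∈ fullCycles X, F (e.permCongr a) := by
  symm
  refine Finset.sum_nbij' (fun a => e.permCongr a) (fun a => e.symm.permCongr a) ?_ ?_ ?_ ?_ ?_
  · exact fun a ha => (permCongr_mem_fullCycles e).2 ha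
  · exact fun a ha => (permCongr_mem_fullCycles e.symm).2 ha
  · intro a _; ext; simp
  · intro a _; ext; simp
  · intros; rfl

theorem card_fullCycles_congr (e : X ≃ Y) : (fullCycles Y).card = (fullCycles X).card := by
  simpa using sum_fullCycles_permCongr e (fun _ => (1 : ℕ))

theorem insertAfter_mem_fullCycles {a : Equiv.Perm X} {x : X} :
    insertAfter a x ∈ fullCycles (Option X) ↔ a ∈ fullCycles X := by
  simp only [mem_fullCycles, sameCycle_insertAfter]
  exact ⟨fun h x y => h (some x) (some y), fun h x y => h _ _⟩

omit [Fintype X] in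
theorem insertAfter_injective {a b : Equiv.Perm X} {x y : X}
    (h : insertAfter a x = insertAfter b y) : a = b ∧ x = y := by
  have h1 : some x = some y := by
    apply (insertAfter b y).injective
    rw [← h, insertAfter_some_self, h, insertAfter_some_self]
  obtain rfl := Option.some_injective _ h1
  refine ⟨?_, rfl⟩
  have h2 := mul_right_cancel h
  ext z
  have := Equiv.ext_iff.1 h2 (some z)
  simpa using this

/-- In the presence of another point a full cycle moves `none`, so `none` has a predecessor `some x`
and can be cut out after it. -/
theorem exists_insertAfter_eq [Nonempty X] {a : Equiv.Perm (Option X)}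
    (ha : a ∈ fullCycles (Option X)) : ∃ b x, insertAfter b x = a := by
  rw [mem_fullCycles] at ha
  obtain ⟨x, hx⟩ : ∃ x, a.symm none = some x := by
    rcases h : a.symm none with _ | x
    · exfalso
      have hfix : a none = none := by rw [← h, Equiv.apply_symm_apply, h]
      obtain ⟨y⟩ := ‹Nonempty X›
      exact Option.some_ne_none y ((ha none (some y)).eq_of_left hfix).symm
    · exact ⟨x, rfl⟩
  have hx' : a (some x) = none := by rw [← hx, Equiv.apply_symm_apply]
  refine ⟨Equiv.removeNone (a * Equiv.swap none (some x)), x, ?_⟩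
  rw [insertAfter, map_equiv_removeNone]
  have : (a * Equiv.swap none (some x)) none = none := by simp [hx']
  rw [this, Equiv.swap_self]
  ext1 u
  simp

theorem sum_fullCycles_option [Nonempty X] {M : Type*} [AddCommMonoid M]
    (F : Equiv.Perm (Option X) → M) :
    ∑ a ∈ fullCycles (Option X), F a = ∑ a ∈ fullCycles X, ∑ x : X, F (insertAfter a x) := by
  rw [← Finset.sum_product']
  symm
  refine Finset.sum_nbij (fun p => insertAfter p.1 p.2) ?_ ?_ ?_ ?_
  · intro p hp
    exact insertAfter_mem_fullCycles.2 (Finset.mem_product.1 hp).1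
  · intro p _ q _ h
    exact Prod.ext_iff.2 (insertAfter_injective h)
  · intro a ha
    obtain ⟨b, x, rfl⟩ := exists_insertAfter_eq ha
    refine ⟨(b, x), ?_, rfl⟩
    simpa using insertAfter_mem_fullCycles.1 ha
  · intros; rfl

theorem card_fullCycles_option [Nonempty X] :
    (fullCycles (Option X)).card = (fullCycles X).card * Fintype.card X := by
  have := sum_fullCycles_option (X := X) (fun _ => (1 : ℕ))
  simpa using this

theorem fullCycles_nonempty (X : Type*) [Fintype X] : (fullCycles X).Nonempty := by
  refine Fintype.induction_empty_option (P := fun X _ => (fullCycles X).Nonempty) ?_ ?_ ?_ X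
  · intro α β _ e ih
    let _ := Fintype.ofEquiv β e.symm
    obtain ⟨a, ha⟩ := ih
    refine ⟨e.permCongr a, ?_⟩
    rw [mem_fullCycles] at ha ⊢
    intro x y
    rw [sameCycle_permCongr]
    exact ha _ _
  · exact ⟨1, mem_fullCycles.2 fun x => x.elim⟩
  · intro α _ ih
    obtain ⟨a, ha⟩ := ih
    rcases isEmpty_or_nonempty α with h | ⟨⟨x⟩⟩
    · exact ⟨1, mem_fullCycles.2 fun x y => by rw [Subsingleton.elim x y]⟩
    · exact ⟨insertAfter a x, insertAfter_mem_fullCycles.2 ha⟩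

theorem card_fullCycles_pos (X : Type*) [Fintype X] : 0 < (fullCycles X).card :=
  (fullCycles_nonempty X).card_pos

omit [Fintype X]

theorem optionCongr_mul (a b : Equiv.Perm X) :
    (Equiv.optionCongr (a * b) : Equiv.Perm (Option X))
      = Equiv.optionCongr a * Equiv.optionCongr b := by
  ext1 u
  cases u <;> simp

/-- This identity and the next two drive the inductions on the number of points. If a full cycle
arises by inserting `none` after `x`, its product with a fixed permutation is again a product on the
smaller set, enlarged by `none`. The point `none` lands inside a cycle, except for the single choice
`x = c`, where it becomes a fixed point. -/
theorem insertAfter_mul_optionCongr (a b : Equiv.Perm X) (x : X) :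
    insertAfter a x * Equiv.optionCongr b = insertAfter (a * b) (b⁻¹ x) := by
  have h := Equiv.mul_swap_eq_swap_mul (Equiv.optionCongr b) none (some (b⁻¹ x))
  have hx : (Equiv.optionCongr b) (some (b⁻¹ x)) = some x := by simp
  have hn : (Equiv.optionCongr b) none = none := by simp
  rw [hx, hn] at h
  rw [insertAfter, insertAfter, optionCongr_mul, mul_assoc, mul_assoc, h]

theorem insertAfter_mul_swap_mul_self (a b : Equiv.Perm X) (c : X) :
    insertAfter a c * (Equiv.swap none (some c) * Equiv.optionCongr b)
      = Equiv.optionCongr (a * b) := by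
  rw [insertAfter, optionCongr_mul, mul_assoc, ← mul_assoc (Equiv.swap none (some c)),
    Equiv.swap_mul_self, one_mul]

theorem insertAfter_mul_swap_mul (a b : Equiv.Perm X) {c x : X} (h : x ≠ c) :
    insertAfter a x * (Equiv.swap none (some c) * Equiv.optionCongr b)
      = insertAfter (a * (Equiv.swap c x * b)) (b⁻¹ x) := by
  have h1 : Equiv.swap none (some x) * Equiv.swap none (some c)
      = Equiv.optionCongr (Equiv.swap c x) * Equiv.swap none (some x) := by
    rw [Equiv.optionCongr_swap]
    ext1 u
    rcases u with _ | u
    · simp [Equiv.swap_apply_of_ne_of_ne, h.symm]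
    · by_cases hc : u = c
      · subst hc; simp [Equiv.swap_apply_of_ne_of_ne, h.symm]
      · by_cases hx : u = x
        · subst hx; simp [Equiv.swap_apply_of_ne_of_ne, hc]
        · simp [Equiv.swap_apply_of_ne_of_ne, hc, hx]
  rw [← mul_assoc a, ← insertAfter_mul_optionCongr, ← mul_assoc, insertAfter, insertAfter,
    mul_assoc (Equiv.optionCongr a), h1, optionCongr_mul]
  simp only [mul_assoc]

theorem perm_option_cases (b : Equiv.Perm (Option X)) :
    (∃ b', b = Equiv.optionCongr b') ∨
      ∃ c b', b = Equiv.swap none (some c) * Equiv.optionCongr b' := by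
  have h := map_equiv_removeNone b
  rcases hb : b none with _ | c
  · left
    refine ⟨Equiv.removeNone b, ?_⟩
    rw [h, hb, Equiv.swap_self]
    ext1 u
    simp
  · right
    refine ⟨c, Equiv.removeNone b, ?_⟩
    rw [h, hb, ← mul_assoc, Equiv.swap_mul_self, one_mul]

end FullCycles

/-! ### Short cycles through a given point in the product with a random full cycle -/

section ShortCycles

variable {X Y : Type*} [Fintype X] [Fintype Y]

/-- The length of the cycle of `a` that contains `x`. -/
noncomputable def cycleLength (a : Equiv.Perm X) (x : X) : ℕ :=
  (Finset.univ.filter fun y => a.SameCycle x y).card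

theorem cycleLength_pos (a : Equiv.Perm X) (x : X) : 0 < cycleLength a x :=
  Finset.card_pos.2 ⟨x, Finset.mem_filter.2 ⟨Finset.mem_univ x, Equiv.Perm.SameCycle.refl a x⟩⟩

theorem cycleLength_permCongr (e : X ≃ Y) (a : Equiv.Perm X) (y : Y) :
    cycleLength (e.permCongr a) y = cycleLength a (e.symm y) := by
  refine Finset.card_nbij' e.symm e ?_ ?_ ?_ ?_
  · intro z hz
    simpa [sameCycle_permCongr] using hz
  · intro z hz
    simpa [sameCycle_permCongr] using hz
  · intro z _; simp
  · intro z _; simp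

theorem cycleLength_insertAfter_none (a : Equiv.Perm X) (x : X) :
    cycleLength (insertAfter a x) none = cycleLength a x + 1 := by
  rw [cycleLength, cycleLength, Finset.card_filter, Finset.card_filter, Fintype.sum_option,
    add_comm]
  simp only [sameCycle_insertAfter]
  simp only [Option.getD_none, Option.getD_some, Equiv.Perm.SameCycle.refl a x, if_true]

/-- The number of full cycles `a` such that the cycle of `a * b` through `x` has length
at most `k`. -/
noncomputable def shortCount (b : Equiv.Perm X) (x : X) (k : ℕ) : ℕ :=
  ∑ a ∈ fullCycles X, if cycleLength (a * b) x ≤ k then 1 else 0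

theorem shortCount_zero (b : Equiv.Perm X) (x : X) : shortCount b x 0 = 0 := by
  refine Finset.sum_eq_zero fun a _ => if_neg ?_
  have := cycleLength_pos (a * b) x
  omega

theorem shortCount_permCongr (e : X ≃ Y) (b : Equiv.Perm X) (y : Y) (k : ℕ) :
    shortCount (e.permCongr b) y k = shortCount b (e.symm y) k := by
  rw [shortCount, sum_fullCycles_permCongr e]
  refine Finset.sum_congr rfl fun a _ => ?_
  have : e.permCongr a * e.permCongr b = e.permCongr (a * b) := by ext; simp
  rw [this, cycleLength_permCongr]

/-- The bound says that the cycle through a given point has length at most `k` with probability at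
most k/(n - k); it is void for `k ≥ n` by truncated subtraction. Removing `none` shortens its cycle
by one and leaves a random product on n points. If `b` moves `none`, one of the n insertion
positions may close the cycle at once; it accounts for the extra `f` full cycles. -/
theorem shortCount_option_le (h : ∀ (b : Equiv.Perm X) x k,
    shortCount b x k * (Fintype.card X - k) ≤ k * (fullCycles X).card) [Nonempty X]
    (b : Equiv.Perm (Option X)) (k : ℕ) :
    shortCount b none k * (Fintype.card (Option X) - k) ≤ k * (fullCycles (Option X)).card := by
  rcases k with _ | k
  · simp [shortCount_zero]
  rw [card_fullCycles_option, Fintype.card_option, Nat.add_sub_add_right]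
  set f := (fullCycles X).card
  set n := Fintype.card X
  rcases perm_option_cases b with ⟨b', rfl⟩ | ⟨c, b', rfl⟩
  · have h1 : shortCount (Equiv.optionCongr b') none (k + 1)
        = ∑ x : X, shortCount b' (b'⁻¹ x) k := by
      rw [shortCount, sum_fullCycles_option, Finset.sum_comm]
      refine Finset.sum_congr rfl fun x _ => Finset.sum_congr rfl fun a _ => ?_
      rw [insertAfter_mul_optionCongr, cycleLength_insertAfter_none]
      simp
    rw [h1, Finset.sum_mul]
    calc _ ≤ ∑ x : X, k * f := Finset.sum_le_sum fun x _ => h _ _ _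
      _ = k * (f * n) := by simp [n]; ring
      _ ≤ _ := Nat.mul_le_mul_right _ (by omega)
  · have h1 : shortCount (Equiv.swap none (some c) * Equiv.optionCongr b') none (k + 1)
        ≤ f + ∑ x ∈ Finset.univ.erase c, shortCount (Equiv.swap c x * b') (b'⁻¹ x) k := by
      rw [shortCount, sum_fullCycles_option, Finset.sum_comm,
        ← Finset.add_sum_erase _ _ (Finset.mem_univ c)]
      gcongr with x hx
      · rw [show f = ∑ a ∈ fullCycles X, 1 by simp [f]]
        exact Finset.sum_le_sum fun a _ => by split_ifs <;> simp
      · refine Finset.sum_le_sum fun a _ => ?_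
        rw [insertAfter_mul_swap_mul _ _ (Finset.ne_of_mem_erase hx), cycleLength_insertAfter_none]
        simp
    rcases le_or_gt n k with hk | hk
    · rw [Nat.sub_eq_zero_of_le hk]; simp
    calc _ ≤ (f + ∑ x ∈ Finset.univ.erase c, shortCount (Equiv.swap c x * b') (b'⁻¹ x) k)
          * (n - k) := Nat.mul_le_mul_right _ h1
      _ = f * (n - k) + ∑ x ∈ Finset.univ.erase c,
          shortCount (Equiv.swap c x * b') (b'⁻¹ x) k * (n - k) := by
          rw [add_mul, Finset.sum_mul]
      _ ≤ f * n + ∑ x ∈ Finset.univ.erase c, k * f := by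
          refine Nat.add_le_add (Nat.mul_le_mul_left _ (Nat.sub_le _ _))
            (Finset.sum_le_sum fun x _ => h _ _ _)
      _ ≤ f * n + n * (k * f) := by
          gcongr
          rw [Finset.sum_const, smul_eq_mul]
          exact Nat.mul_le_mul_right _ (Finset.card_le_univ _)
      _ = _ := by ring

theorem shortCount_le (n : ℕ) : ∀ (X : Type*) [Fintype X], Fintype.card X = n →
    ∀ (b : Equiv.Perm X) (x : X) (k : ℕ),
      shortCount b x k * (Fintype.card X - k) ≤ k * (fullCycles X).card := by
  induction n with
  | zero =>
    intro X _ hX b x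
    exact ((Fintype.card_eq_zero_iff.1 hX).false x).elim
  | succ n ih =>
    intro X _ hX b x k
    let e : Option {y // y ≠ x} ≃ X := Equiv.optionSubtypeNe x
    have hc : Fintype.card (Option {y // y ≠ x}) = Fintype.card X := Fintype.card_congr e
    have hb : b = e.permCongr (e.symm.permCongr b) := by ext; simp
    rw [hb, shortCount_permCongr, card_fullCycles_congr e, ← hc]
    have hx : e.symm x = none := Equiv.optionSubtypeNe_symm_self x
    rw [hx]
    have hcard : Fintype.card {y // y ≠ x} = n := by
      rw [Fintype.card_option] at hc; omega
    rcases isEmpty_or_nonempty {y // y ≠ x} with hem | hne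
    · rcases k with _ | k
      · simp [shortCount_zero]
      · have h0 : Fintype.card {y // y ≠ x} = 0 := Fintype.card_eq_zero
        rw [Fintype.card_option, h0, Nat.sub_eq_zero_of_le (Nat.succ_le_succ (Nat.zero_le k))]
        simp
    · exact shortCount_option_le (ih _ hcard) _ _

end ShortCycles

/-! ### Generating function for the number of cycles -/

section CycleSum

variable {X Y : Type*} [Fintype X] [Fintype Y]

/-- The sum of `F (numCycles (a * b))` over all full cycles `a`. -/
noncomputable def cycleSum {M : Type*} [AddCommMonoid M] (b : Equiv.Perm X) (F : ℕ → M) : M :=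
  ∑ a ∈ fullCycles X, F (numCycles (a * b))

theorem cycleSum_permCongr {M : Type*} [AddCommMonoid M] (e : X ≃ Y) (b : Equiv.Perm X)
    (F : ℕ → M) : cycleSum (e.permCongr b) F = cycleSum b F := by
  rw [cycleSum, sum_fullCycles_permCongr e]
  refine Finset.sum_congr rfl fun a _ => ?_
  have : e.permCongr a * e.permCongr b = e.permCongr (a * b) := by ext; simp
  rw [this, numCycles_permCongr]

theorem cycleSum_optionCongr [Nonempty X] {M : Type*} [AddCommMonoid M] (b : Equiv.Perm X)
    (F : ℕ → M) : cycleSum (Equiv.optionCongr b) F = Fintype.card X • cycleSum b F := by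
  rw [cycleSum, sum_fullCycles_option, cycleSum, Finset.smul_sum]
  refine Finset.sum_congr rfl fun a _ => ?_
  simp_rw [insertAfter_mul_optionCongr, numCycles_insertAfter]
  simp

theorem cycleSum_swap_mul_optionCongr [Nonempty X] {M : Type*} [AddCommMonoid M]
    (b : Equiv.Perm X) (c : X) (F : ℕ → M) :
    cycleSum (Equiv.swap none (some c) * Equiv.optionCongr b) F
      = cycleSum b (fun k => F (k + 1))
        + ∑ x ∈ Finset.univ.erase c, cycleSum (Equiv.swap c x * b) F := by
  rw [cycleSum, sum_fullCycles_option, Finset.sum_comm,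
    ← Finset.add_sum_erase _ _ (Finset.mem_univ c)]
  congr 1
  · refine Finset.sum_congr rfl fun a _ => ?_
    rw [insertAfter_mul_swap_mul_self, numCycles_optionCongr]
  · refine Finset.sum_congr rfl fun x hx => Finset.sum_congr rfl fun a _ => ?_
    rw [insertAfter_mul_swap_mul _ _ (Finset.ne_of_mem_erase hx), numCycles_insertAfter]

end CycleSum

/-! ### The derivative of a determinant -/

section DetDerivation

theorem Derivation.leibniz_finset_prod {R A ι : Type*} [CommRing R] [CommRing A] [Algebra R A]
    [DecidableEq ι]
    (D : Derivation R A A) (s : Finset ι) (f : ι → A) :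
    D (∏ i ∈ s, f i) = ∑ i ∈ s, (∏ j ∈ s.erase i, f j) * D (f i) := by
  induction s using Finset.induction_on with
  | empty => simp
  | insert a s ha ih =>
    rw [Finset.prod_insert ha, D.leibniz, ih, Finset.sum_insert ha, Finset.erase_insert ha,
      add_comm]
    simp only [smul_eq_mul, Finset.mul_sum]
    congr 1
    refine Finset.sum_congr rfl fun i hi => ?_
    have hia : a ≠ i := fun h => ha (h ▸ hi)
    rw [Finset.erase_insert_of_ne hia, Finset.prod_insert (fun h => ha (Finset.mem_of_mem_erase h)),
      mul_assoc]

/-- Jacobi's formula. -/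
theorem Derivation.det_eq {R A n : Type*} [CommRing R] [CommRing A] [Algebra R A]
    [Fintype n] [DecidableEq n] (D : Derivation R A A) (M : Matrix n n A) :
    D M.det = (M.adjugate * M.map D).trace := by
  have h1 : ∀ i, (M.updateCol i fun j => D (M j i)).det = (M.adjugate * M.map D) i i := by
    intro i
    rw [← Matrix.cramer_apply, Matrix.cramer_eq_adjugate_mulVec]
    rfl
  rw [Matrix.trace]
  simp only [Matrix.diag_apply, ← h1]
  simp only [Matrix.det_apply, map_sum]
  rw [Finset.sum_comm]
  refine Finset.sum_congr rfl fun σ _ => ?_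
  rw [Units.smul_def, map_zsmul, D.leibniz_finset_prod, Finset.smul_sum]
  refine Finset.sum_congr rfl fun i _ => ?_
  rw [Units.smul_def, ← Finset.prod_erase_mul _ _ (Finset.mem_univ i)]
  congr 1
  congr 1
  · refine Finset.prod_congr rfl fun j hj => ?_
    rw [Matrix.updateCol_ne (Finset.ne_of_mem_erase hj)]
  · rw [Matrix.updateCol_self]

end DetDerivation

/-! ### The determinant of 1 - tP and the generating function identity -/

section CycleDet

open PowerSeries

variable {X Y : Type*} [Fintype X] [Fintype Y]

/-- The matrix `1 - t P` of a permutation. -/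
noncomputable def oneSubMatrix (b : Equiv.Perm X) : Matrix X X ℝ⟦X⟧ :=
  Matrix.of fun i j => (if i = j then 1 else 0) - if b j = i then PowerSeries.X else 0

/-- The product of `1 - t ^ ℓ` over the lengths `ℓ` of the cycles of a permutation, written as the
determinant of `1 - t P`. -/
noncomputable def cycleDet (b : Equiv.Perm X) : ℝ⟦X⟧ := (oneSubMatrix b).det

/-- The entry of the inverse of `1 - t P`. -/
noncomputable def orbitSeries (b : Equiv.Perm X) (i j : X) : ℝ⟦X⟧ :=
  PowerSeries.mk fun k => if (b ^ k) j = i then 1 else 0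

/-- The generating function of the positive times at which the orbit of `j` is at `i`. -/
noncomputable def returnSeries (b : Equiv.Perm X) (i j : X) : ℝ⟦X⟧ :=
  PowerSeries.X * orbitSeries b (b.symm i) j

omit [Fintype X] in
theorem orbitSeries_eq (b : Equiv.Perm X) (i j : X) :
    orbitSeries b i j = (if i = j then 1 else 0) + returnSeries b i j := by
  ext k
  rcases k with _ | k
  · rw [returnSeries, map_add, PowerSeries.coeff_zero_X_mul, add_zero, orbitSeries,
      PowerSeries.coeff_mk]
    split_ifs <;> simp_all
  · rw [returnSeries, map_add, PowerSeries.coeff_succ_X_mul, orbitSeries, orbitSeries,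
      PowerSeries.coeff_mk, PowerSeries.coeff_mk, pow_succ', Equiv.Perm.mul_apply,
      Equiv.eq_symm_apply]
    have : (PowerSeries.coeff (k + 1)) (if i = j then (1 : ℝ⟦X⟧) else 0) = 0 := by
      split_ifs <;> simp [PowerSeries.coeff_one]
    rw [this, zero_add]

theorem sum_ite_apply_eq (b : Equiv.Perm X) (i : X) (f : X → ℝ⟦X⟧) (a : ℝ⟦X⟧) :
    ∑ j, (if b j = i then a else 0) * f j = a * f (b.symm i) := by
  rw [Finset.sum_eq_single (b.symm i)]
  · simp
  · intro j _ hj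
    rw [if_neg (fun h => hj (by rw [← h, Equiv.symm_apply_apply])), zero_mul]
  · simp

/-- This is the geometric series ∑ t^k P^k as the inverse of 1 - tP. -/
theorem oneSubMatrix_mul_orbitSeries (b : Equiv.Perm X) :
    oneSubMatrix b * Matrix.of (orbitSeries b) = 1 := by
  ext1 i j
  rw [Matrix.mul_apply]
  simp only [oneSubMatrix, Matrix.of_apply, sub_mul, Finset.sum_sub_distrib]
  rw [sum_ite_apply_eq]
  simp only [ite_mul, one_mul, zero_mul, Finset.sum_ite_eq, Finset.mem_univ, if_true]
  rw [orbitSeries_eq, returnSeries, Matrix.one_apply]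
  ring

/-- At each time k ≥ 1 the orbit of `j` is at exactly one point, so the sum is t + t² + ... = t/(1 -
t). -/
theorem sum_returnSeries_left (b : Equiv.Perm X) (j : X) :
    (1 - PowerSeries.X) * ∑ i, returnSeries b i j = PowerSeries.X := by
  have h : ∑ i, returnSeries b i j = PowerSeries.X * PowerSeries.mk 1 := by
    simp only [returnSeries, ← Finset.mul_sum]
    congr 1
    rw [Equiv.sum_comp b.symm (fun i => orbitSeries b i j)]
    ext k
    simp [orbitSeries]
  rw [h, ← mul_assoc, mul_comm _ PowerSeries.X, mul_assoc, mul_comm (1 - PowerSeries.X),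
    PowerSeries.mk_one_mul_one_sub_eq_one, mul_one]

theorem sum_returnSeries_right (b : Equiv.Perm X) (i : X) :
    (1 - PowerSeries.X) * ∑ j, returnSeries b i j = PowerSeries.X := by
  have h : ∑ j, returnSeries b i j = PowerSeries.X * PowerSeries.mk 1 := by
    simp only [returnSeries, ← Finset.mul_sum]
    congr 1
    ext k
    rw [map_sum]
    simp only [orbitSeries, PowerSeries.coeff_mk]
    rw [Finset.sum_eq_single ((b ^ k).symm (b.symm i))]
    · simp
    · intro j _ hj
      rw [if_neg (fun h => hj (by rw [← h, Equiv.symm_apply_apply]))]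
    · simp
  rw [h, ← mul_assoc, mul_comm _ PowerSeries.X, mul_assoc, mul_comm (1 - PowerSeries.X),
    PowerSeries.mk_one_mul_one_sub_eq_one, mul_one]

/-- Multiplying by a transposition adds to 1 - tP the rank one matrix t·u·vᵀ, where `u` is the
difference of the two unit vectors and `v` marks the columns sent to `c` and `x`. With `w` = (1 -
tP)⁻¹ t·u, the matrix determinant lemma gives the factor 1 + v·w. -/
theorem cycleDet_swap_mul [inst : DecidableEq X] (b : Equiv.Perm X) {c x : X} (h : c ≠ x) :
    cycleDet (Equiv.swap c x * b) = cycleDet b * (1 + returnSeries b c c + returnSeries b x x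
      - returnSeries b c x - returnSeries b x c) := by
  obtain rfl : inst = fun a b => Classical.propDecidable (a = b) := Subsingleton.elim _ _
  let u : X → ℝ⟦X⟧ := fun i => (if i = c then 1 else 0) - if i = x then 1 else 0
  let v : X → ℝ⟦X⟧ := fun j => (if b j = c then 1 else 0) - if b j = x then 1 else 0
  let w : X → ℝ⟦X⟧ := fun j => PowerSeries.X * (orbitSeries b j c - orbitSeries b j x)
  have hw : (oneSubMatrix b).mulVec w = fun i => PowerSeries.X * u i := by
    have h1 : w = (Matrix.of (orbitSeries b)).mulVec (fun i => PowerSeries.X * u i) := by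
      ext1 j
      simp only [Matrix.mulVec, dotProduct, Matrix.of_apply, w, u, mul_sub, Finset.sum_sub_distrib]
      simp [mul_comm]
    rw [h1, Matrix.mulVec_mulVec, oneSubMatrix_mul_orbitSeries, Matrix.one_mulVec]
  have hM : oneSubMatrix (Equiv.swap c x * b)
      = oneSubMatrix b * (1 + Matrix.replicateCol Unit w * Matrix.replicateRow Unit v) := by
    rw [Matrix.mul_add, Matrix.mul_one, ← Matrix.mul_assoc]
    have h2 : oneSubMatrix b * Matrix.replicateCol Unit w
        = Matrix.replicateCol Unit (fun i => PowerSeries.X * u i) := by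
      ext1 i k
      rw [← hw]; rfl
    rw [h2]
    ext1 i j
    rw [Matrix.add_apply, Matrix.mul_apply]
    simp only [oneSubMatrix, Matrix.of_apply, Matrix.replicateCol_apply, Matrix.replicateRow_apply,
      Finset.univ_unique, Finset.sum_singleton, Equiv.Perm.mul_apply, u, v]
    have hsw : (Equiv.swap c x (b j) = i) ↔ (b j = c ∧ i = x) ∨ (b j = x ∧ i = c) ∨
        (b j ≠ c ∧ b j ≠ x ∧ b j = i) := by
      rw [Equiv.swap_apply_def]
      split_ifs <;> grind
    simp only [hsw]
    by_cases h1 : b j = c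
    · by_cases h2 : i = x
      · subst h2; simp [h1, h.symm, h]; ring
      · by_cases h3 : i = c
        · subst h3; simp [h1, h]
        · simp [h1, h2, h3, h, Ne.symm h3]
    · by_cases h4 : b j = x
      · by_cases h2 : i = x
        · subst h2; simp [h4, h.symm]
        · by_cases h3 : i = c
          · subst h3; simp [h4, h, h.symm]; ring
          · simp [h4, h2, h3, h.symm, Ne.symm h2]
      · simp [h1, h4]
  rw [cycleDet, hM, Matrix.det_mul, Matrix.det_one_add_replicateCol_mul_replicateRow, ← cycleDet]
  congr 1
  simp only [dotProduct, v, sub_mul, Finset.sum_sub_distrib]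
  rw [sum_ite_apply_eq, sum_ite_apply_eq]
  simp only [w, returnSeries]
  ring

/-- Jacobi's formula, with the adjugate written as determinant times inverse: the logarithmic
derivative is -tr(tP(1 - tP)⁻¹). -/
theorem X_mul_derivative_cycleDet (b : Equiv.Perm X) :
    PowerSeries.X * (PowerSeries.derivative ℝ (cycleDet b))
      = -(cycleDet b * ∑ i, returnSeries b i i) := by
  have hadj : (oneSubMatrix b).adjugate = cycleDet b • Matrix.of (orbitSeries b) := by
    have := congrArg ((oneSubMatrix b).adjugate * ·) (oneSubMatrix_mul_orbitSeries b)
    simp only [mul_one] at this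
    rw [← this, ← Matrix.mul_assoc, Matrix.adjugate_mul, Matrix.smul_mul, Matrix.one_mul]
    rfl
  have hmap : (oneSubMatrix b).map (PowerSeries.derivative ℝ)
      = Matrix.of fun i j => -(if b j = i then (1 : ℝ⟦X⟧) else 0) := by
    ext1 i j
    simp only [oneSubMatrix, Matrix.map_apply, Matrix.of_apply, map_sub]
    split_ifs <;> simp
  rw [cycleDet, Derivation.det_eq, hadj, hmap, Matrix.smul_mul, Matrix.trace_smul, smul_eq_mul,
    ← cycleDet, mul_left_comm, ← mul_neg]
  congr 1
  rw [Matrix.trace_mul_comm, Matrix.trace, Finset.mul_sum, ← Finset.sum_neg_distrib]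
  refine Finset.sum_congr rfl fun i _ => ?_
  rw [Matrix.diag_apply, Matrix.mul_apply]
  simp only [Matrix.of_apply, neg_mul, Finset.sum_neg_distrib]
  rw [sum_ite_apply_eq, returnSeries]
  ring

theorem cycleDet_permCongr (e : X ≃ Y) (b : Equiv.Perm X) :
    cycleDet (e.permCongr b) = cycleDet b := by
  rw [cycleDet, cycleDet, ← Matrix.det_submatrix_equiv_self e]
  congr 1
  ext1 i j
  simp [oneSubMatrix]

theorem cycleDet_eq_det_submatrix [DecidableEq Y] (e : Y ≃ X) (b : Equiv.Perm X) :
    cycleDet b = ((oneSubMatrix b).submatrix e e).det := by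
  rw [Matrix.det_submatrix_equiv_self, cycleDet]

theorem cycleDet_optionCongr (b : Equiv.Perm X) :
    cycleDet (Equiv.optionCongr b) = (1 - PowerSeries.X) * cycleDet b := by
  rw [cycleDet_eq_det_submatrix (Equiv.optionEquivSumPUnit.{0} X).symm]
  have : (oneSubMatrix (Equiv.optionCongr b)).submatrix (Equiv.optionEquivSumPUnit.{0} X).symm
      (Equiv.optionEquivSumPUnit.{0} X).symm
      = Matrix.fromBlocks (oneSubMatrix b) 0 0 (Matrix.of fun _ _ => 1 - PowerSeries.X) := by
    ext1 i j
    rcases i with i | i <;> rcases j with j | j <;> simp [oneSubMatrix]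
  rw [this, Matrix.det_fromBlocks_zero₂₁, ← cycleDet, mul_comm]
  simp

omit [Fintype X] in
theorem returnSeries_optionCongr_some (b : Equiv.Perm X) (c : X) :
    returnSeries (Equiv.optionCongr b) (some c) (some c) = returnSeries b c c := by
  have hpow : ∀ k : ℕ, ((Equiv.optionCongr b : Equiv.Perm (Option X)) ^ k) (some c)
      = some ((b ^ k) c) := by
    intro k
    induction k with
    | zero => rfl
    | succ k ih => rw [pow_succ', Equiv.Perm.mul_apply, ih, pow_succ']; simp
  rw [returnSeries, returnSeries]
  congr 1
  ext k
  simp [orbitSeries, hpow, ← Equiv.optionCongr_symm]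

theorem returnSeries_optionCongr_none (b : Equiv.Perm X) :
    (1 - PowerSeries.X) * returnSeries (Equiv.optionCongr b) none none = PowerSeries.X := by
  have hs := sum_returnSeries_left (Equiv.optionCongr b) none
  rw [Fintype.sum_option] at hs
  have : ∀ c, returnSeries (Equiv.optionCongr b) (some c) none = 0 := by
    intro c
    have hpow : ∀ k : ℕ, ((Equiv.optionCongr b : Equiv.Perm (Option X)) ^ k) none = none := by
      intro k
      induction k with
      | zero => rfl
      | succ k ih => rw [pow_succ', Equiv.Perm.mul_apply, ih]; simp
    rw [returnSeries]
    ext k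
    rcases k with _ | k
    · simp
    · simp [PowerSeries.coeff_succ_X_mul, orbitSeries, hpow, ← Equiv.optionCongr_symm]
  rwa [Finset.sum_eq_zero fun c _ => this c, add_zero] at hs

/-- The isolated point `none` has return series t/(1 - t) and no orbit in common with the rest. Its
contribution to the rank one factor cancels against the factor 1 - t of its own cycle. -/
theorem cycleDet_swap_mul_optionCongr (b : Equiv.Perm X) (c : X) :
    cycleDet (Equiv.swap none (some c) * Equiv.optionCongr b)
      = cycleDet b * (1 + (1 - PowerSeries.X) * returnSeries b c c) := by
  have hzero : ∀ i j : Option X, (i = none ↔ j ≠ none) →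
      returnSeries (Equiv.optionCongr b) i j = 0 := by
    intro i j hij
    have hinv : ∀ k : ℕ, (((Equiv.optionCongr b : Equiv.Perm (Option X)) ^ k) j = none ↔
        j = none) := by
      intro k
      induction k with
      | zero => rfl
      | succ k ih => rw [pow_succ', Equiv.Perm.mul_apply, ← ih]; simp
    have hi : (Equiv.optionCongr b).symm i = none ↔ i = none := by
      rw [Equiv.symm_apply_eq]; simp
    rw [returnSeries]
    ext k
    rcases k with _ | k
    · simp
    · rw [PowerSeries.coeff_succ_X_mul, orbitSeries, PowerSeries.coeff_mk, if_neg, map_zero]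
      intro h
      have h1 := hinv k
      rw [h, hi] at h1
      tauto
  have h0 := cycleDet_swap_mul (Equiv.optionCongr b) (c := none) (x := some c) (by simp)
  have hn := returnSeries_optionCongr_none b
  rw [hzero none (some c) (by simp), hzero (some c) none (by simp),
    returnSeries_optionCongr_some, cycleDet_optionCongr] at h0
  rw [h0]
  linear_combination cycleDet b * hn

/-- The generating function of `q ↦ ∑ q ^ numCycles (a * b)`, the sum over all full cycles `a`. -/
noncomputable def cycleSeries (b : Equiv.Perm X) : ℝ⟦X⟧ :=
  PowerSeries.mk fun q => cycleSum b fun k => (q : ℝ) ^ k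

theorem cycleSeries_permCongr (e : X ≃ Y) (b : Equiv.Perm X) :
    cycleSeries (e.permCongr b) = cycleSeries b := by
  simp [cycleSeries, cycleSum_permCongr]

theorem cycleSeries_optionCongr [Nonempty X] (b : Equiv.Perm X) :
    cycleSeries (Equiv.optionCongr b) = (Fintype.card X : ℝ⟦X⟧) * cycleSeries b := by
  ext q
  rw [← nsmul_eq_mul, map_nsmul]
  simp [cycleSeries, cycleSum_optionCongr]

/-- The insertion position `c` creates an additional cycle and so multiplies q^k by q; on generating
functions this is the operator t·d/dt. -/
theorem cycleSeries_swap_mul_optionCongr [Nonempty X] (b : Equiv.Perm X) (c : X) :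
    cycleSeries (Equiv.swap none (some c) * Equiv.optionCongr b)
      = PowerSeries.X * PowerSeries.derivative ℝ (cycleSeries b)
        + ∑ x ∈ Finset.univ.erase c, cycleSeries (Equiv.swap c x * b) := by
  ext q
  rw [map_add, map_sum]
  simp only [cycleSeries, PowerSeries.coeff_mk]
  rw [cycleSum_swap_mul_optionCongr]
  congr 1
  rcases q with _ | q
  · simp [cycleSum]
  · rw [PowerSeries.coeff_succ_X_mul, PowerSeries.coeff_derivative, PowerSeries.coeff_mk,
      cycleSum, cycleSum, Finset.sum_mul]
    refine Finset.sum_congr rfl fun a _ => ?_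
    push_cast
    ring

theorem cycleSeries_eq_of_unique [Unique X] (b : Equiv.Perm X) :
    (1 - PowerSeries.X) ^ (Fintype.card X + 2) * cycleSeries b
      = ((fullCycles X).card : ℝ⟦X⟧) * PowerSeries.X * cycleDet b := by
  have hf : fullCycles X = {1} := by
    ext a
    rw [mem_fullCycles, Finset.mem_singleton]
    exact ⟨fun _ => Subsingleton.elim _ _,
      fun _ x y => by rw [Subsingleton.elim x y]⟩
  have hn : ∀ a : Equiv.Perm X, numCycles a = 1 := fun a =>
    le_antisymm (by simpa using numCycles_le_card a) (numCycles_pos a)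
  have hd : cycleDet b = 1 - PowerSeries.X := by
    rw [cycleDet, Matrix.det_unique]
    simp [oneSubMatrix, Subsingleton.elim (b default) default]
  -- There is one product, with one cycle, and ∑ q t^q = t/(1 - t)².
  have hs : cycleSeries b = PowerSeries.X * (PowerSeries.mk 1) ^ 2 := by
    rw [show 2 = 1 + 1 from rfl, PowerSeries.mk_one_pow_eq_mk_choose_add]
    ext q
    rcases q with _ | q
    · simp [cycleSeries, cycleSum, hf, hn]
    · rw [PowerSeries.coeff_succ_X_mul]
      simp [cycleSeries, cycleSum, hf, hn]
      ring
  have h1 := PowerSeries.mk_one_mul_one_sub_eq_one ℝ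
  rw [hs, hd, hf]
  simp only [Fintype.card_unique, Finset.card_singleton, Nat.cast_one]
  linear_combination PowerSeries.X * (1 - PowerSeries.X)
    * (PowerSeries.mk 1 * (1 - PowerSeries.X) + 1) * h1

/-- If `b` moves the new point, the term t·d/dt is handled by differentiating the hypothesis `h`.
Jacobi's formula then produces the diagonal sum of the return series with a minus sign, and the
transposition factors produce it with a plus sign, so it cancels. The remaining row and column sums
are t/(1 - t). -/
theorem cycleSeries_option_eq [Nonempty X]
    (h : ∀ b : Equiv.Perm X, (1 - PowerSeries.X) ^ (Fintype.card X + 2) * cycleSeries b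
      = ((fullCycles X).card : ℝ⟦X⟧) * PowerSeries.X * cycleDet b) (b : Equiv.Perm (Option X)) :
    (1 - PowerSeries.X) ^ (Fintype.card (Option X) + 2) * cycleSeries b
      = ((fullCycles (Option X)).card : ℝ⟦X⟧) * PowerSeries.X * cycleDet b := by
  rw [card_fullCycles_option, Fintype.card_option]
  set n := Fintype.card X with hn
  set f := (fullCycles X).card
  push_cast
  rcases perm_option_cases b with ⟨b, rfl⟩ | ⟨c, b, rfl⟩
  · rw [cycleSeries_optionCongr, cycleDet_optionCongr, ← hn]
    linear_combination (n : ℝ⟦X⟧) * (1 - PowerSeries.X) * h b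
  · rw [cycleSeries_swap_mul_optionCongr, cycleDet_swap_mul_optionCongr]
    have hD := congrArg (PowerSeries.derivative ℝ) (h b)
    simp only [Derivation.leibniz, Derivation.leibniz_pow, map_sub, Derivation.map_one_eq_zero,
      PowerSeries.derivative_X, Derivation.map_natCast, smul_eq_mul] at hD
    have hJ := X_mul_derivative_cycleDet b
    have hL := sum_returnSeries_left b c
    have hR := sum_returnSeries_right b c
    have hS : (1 - PowerSeries.X) ^ (n + 2) * ∑ x ∈ Finset.univ.erase c,
          cycleSeries (Equiv.swap c x * b)
        = (f : ℝ⟦X⟧) * PowerSeries.X * cycleDet b * ((n : ℝ⟦X⟧) - 1 + (n : ℝ⟦X⟧) * returnSeries b c c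
          + ∑ x, returnSeries b x x - ∑ x, returnSeries b c x - ∑ x, returnSeries b x c) := by
      have h1 : ∑ x ∈ Finset.univ.erase c, (1 - PowerSeries.X) ^ (n + 2) *
          cycleSeries (Equiv.swap c x * b)
          = ∑ x ∈ Finset.univ.erase c, (f : ℝ⟦X⟧) * PowerSeries.X * cycleDet b *
            (1 + returnSeries b c c + returnSeries b x x
              - returnSeries b c x - returnSeries b x c) := by
        refine Finset.sum_congr rfl fun x hx => ?_
        rw [h, cycleDet_swap_mul b (Finset.ne_of_mem_erase hx).symm]
        ring
      have h2 := Finset.add_sum_erase Finset.univ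
        (fun x => 1 + returnSeries b c c + returnSeries b x x
              - returnSeries b c x - returnSeries b x c) (Finset.mem_univ c)
      simp only [Finset.sum_sub_distrib, Finset.sum_add_distrib, Finset.sum_const,
        Finset.card_univ, ← hn, nsmul_eq_mul, mul_one] at h2
      rw [Finset.mul_sum, h1, ← Finset.mul_sum]
      congr 1
      simp only [Finset.sum_sub_distrib, Finset.sum_add_distrib, Finset.sum_const, nsmul_eq_mul,
        mul_one] at h2 ⊢
      linear_combination h2
    have hP : (1 - PowerSeries.X : ℝ⟦X⟧) ^ (n + 2) = (1 - PowerSeries.X) ^ (n + 1)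
        * (1 - PowerSeries.X) := pow_succ _ _
    have hb := h b
    simp only [nsmul_eq_mul, Nat.cast_add, Nat.cast_ofNat] at hD
    rw [show n + 2 - 1 = n + 1 by omega] at hD
    rw [show n + 1 + 2 = (n + 2) + 1 by omega, pow_succ]
    linear_combination (1 - PowerSeries.X) * hS + (1 - PowerSeries.X) * PowerSeries.X * hD
      + (n + 2 : ℝ⟦X⟧) * PowerSeries.X * hb
      + (1 - PowerSeries.X) * f * PowerSeries.X * hJ
      - f * PowerSeries.X * cycleDet b * (hL + hR)
      - (n + 2 : ℝ⟦X⟧) * PowerSeries.X * cycleSeries b * hP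

/-- The generating function for the number of cycles of the product of a fixed permutation with
a uniformly random full cycle. -/
theorem cycleSeries_eq [Nonempty X] (b : Equiv.Perm X) :
    (1 - PowerSeries.X) ^ (Fintype.card X + 2) * cycleSeries b
      = ((fullCycles X).card : ℝ⟦X⟧) * PowerSeries.X * cycleDet b := by
  revert b
  refine Fintype.induction_empty_option (P := fun X _ => Nonempty X → ∀ b : Equiv.Perm X,
    (1 - PowerSeries.X) ^ (Fintype.card X + 2) * cycleSeries b
      = ((fullCycles X).card : ℝ⟦X⟧) * PowerSeries.X * cycleDet b) ?_ ?_ ?_ X ‹_›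
  · intro α β _ e ih hne b
    let _ := Fintype.ofEquiv β e.symm
    have hb : b = e.permCongr (e.symm.permCongr b) := by ext; simp
    rw [hb, cycleSeries_permCongr, cycleDet_permCongr, card_fullCycles_congr e,
      ← Fintype.card_congr e]
    exact ih e.nonempty _
  · intro h; exact (h.elim (fun x => x.elim))
  · intro α _ ih _ b
    rcases isEmpty_or_nonempty α with hem | hne
    · let _ : Unique (Option α) := ⟨⟨none⟩, fun u => by
        rcases u with _ | u
        · rfl
        · exact hem.elim u⟩
      exact cycleSeries_eq_of_unique b
    · exact cycleSeries_option_eq (ih hne) b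

end CycleDet

/-! ### Coefficients of the cycle determinant -/

section Admissible

variable {X : Type*} [Fintype X]

/-- The permutations that agree with `b` on a `b`-invariant set and fix all other points. -/
noncomputable def partialPerms (b : Equiv.Perm X) : Finset (Equiv.Perm X) :=
  Finset.univ.filter fun σ => ∀ i, σ i = i ∨ σ i = b i

theorem mem_partialPerms {b σ : Equiv.Perm X} :
    σ ∈ partialPerms b ↔ ∀ i, σ i = i ∨ σ i = b i := by simp [partialPerms]

/-- In the Leibniz expansion only those `σ` survive that send each `i` to `i` or `b i`. As `b` has
no fixed point, the two cases exclude each other and contribute 1 and -t. -/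
theorem det_one_sub_perm {A : Type*} [CommRing A] (b : Equiv.Perm X) (hb : ∀ i, b i ≠ i) (t : A) :
    (Matrix.of fun i j : X => (if i = j then (1 : A) else 0) - if b j = i then t else 0).det
      = ∑ σ ∈ partialPerms b, ((Equiv.Perm.sign σ : ℤ) : A) * (-t) ^ σ.support.card := by
  rw [Matrix.det_apply', partialPerms, Finset.sum_filter]
  refine Finset.sum_congr rfl fun σ _ => ?_
  simp only [Matrix.of_apply]
  split_ifs with h
  · congr 1
    have h1 : ∀ i, ((if σ i = i then (1 : A) else 0) - if b i = σ i then t else 0)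
        = if i ∈ σ.support then -t else 1 := by
      intro i
      simp only [Equiv.Perm.mem_support]
      rcases h i with hi | hi
      · simp [hi, hb i]
      · simp [hi, hb i]
    rw [Finset.prod_congr rfl fun i _ => h1 i, Finset.prod_ite_mem, Finset.univ_inter,
      Finset.prod_const]
  · push Not at h
    obtain ⟨i, h1, h2⟩ := h
    rw [Finset.prod_eq_zero (Finset.mem_univ i), mul_zero]
    rw [if_neg h1, if_neg (Ne.symm h2), sub_zero]

theorem coeff_cycleDet (b : Equiv.Perm X) (hb : ∀ i, b i ≠ i) (j : ℕ) :
    PowerSeries.coeff j (cycleDet b)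
      = ∑ σ ∈ partialPerms b with σ.support.card = j,
          ((Equiv.Perm.sign σ : ℤ) : ℝ) * (-1) ^ j := by
  rw [cycleDet, oneSubMatrix, det_one_sub_perm b hb, map_sum, Finset.sum_filter]
  refine Finset.sum_congr rfl fun σ _ => ?_
  have h1 : ((Equiv.Perm.sign σ : ℤ) : PowerSeries ℝ) * (-PowerSeries.X) ^ σ.support.card
      = PowerSeries.C (((Equiv.Perm.sign σ : ℤ) : ℝ) * (-1) ^ σ.support.card)
        * PowerSeries.X ^ σ.support.card := by
    rw [neg_pow, map_mul, map_pow, map_neg, map_one, map_intCast]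
    ring
  rw [h1, PowerSeries.coeff_C_mul, PowerSeries.coeff_X_pow]
  by_cases hj : σ.support.card = j
  · simp [hj]
  · simp [hj, Ne.symm hj]

/-- This is the determinant at t = 1, where each column of 1 - P sums to zero and the all-ones row
vector is annihilated. -/
theorem sum_partialPerms_eq_zero [Nonempty X] (b : Equiv.Perm X) (hb : ∀ i, b i ≠ i) :
    ∑ σ ∈ partialPerms b, ((Equiv.Perm.sign σ : ℤ) : ℝ) * (-1) ^ σ.support.card = 0 := by
  rw [← det_one_sub_perm b hb (1 : ℝ)]
  refine Matrix.exists_vecMul_eq_zero_iff.1 ⟨fun _ => 1, ?_, ?_⟩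
  · intro h
    exact one_ne_zero (congrFun h (Classical.arbitrary X))
  · ext j
    simp [Matrix.vecMul, dotProduct, Finset.sum_sub_distrib]

theorem sum_coeff_cycleDet [Nonempty X] (b : Equiv.Perm X) (hb : ∀ i, b i ≠ i) :
    ∑ j ∈ Finset.range (Fintype.card X + 1), PowerSeries.coeff j (cycleDet b) = 0 := by
  rw [← sum_partialPerms_eq_zero b hb, ← Finset.sum_fiberwise_of_maps_to
    (t := Finset.range (Fintype.card X + 1)) (g := fun σ : Equiv.Perm X => σ.support.card)]
  · refine Finset.sum_congr rfl fun j _ => ?_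
    rw [coeff_cycleDet b hb]
    refine Finset.sum_congr rfl fun σ hσ => ?_
    rw [(Finset.mem_filter.1 hσ).2]
  · intro σ _
    exact Finset.mem_range.2 (Nat.lt_succ_of_le (Finset.card_le_univ _))

theorem coeff_cycleDet_of_lt (b : Equiv.Perm X) (hb : ∀ i, b i ≠ i) {j : ℕ}
    (hj : Fintype.card X < j) : PowerSeries.coeff j (cycleDet b) = 0 := by
  rw [coeff_cycleDet b hb]
  refine Finset.sum_eq_zero fun σ hσ => ?_
  have := (Finset.mem_filter.1 hσ).2
  have := σ.support.card_le_univ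
  omega

theorem apply_mem_support_iff_of_mem_partialPerms {b σ : Equiv.Perm X} (h : σ ∈ partialPerms b)
    (i : X) : b i ∈ σ.support ↔ i ∈ σ.support := by
  rw [mem_partialPerms] at h
  have key : ∀ i, i ∈ σ.support → b i ∈ σ.support := by
    intro i hi
    have h1 : σ i = b i := (h i).resolve_left (Equiv.Perm.mem_support.1 hi)
    rw [← h1]
    exact Equiv.Perm.apply_mem_support.2 hi
  refine ⟨fun hi => ?_, key i⟩
  have hinj : ((σ.support).image b) = σ.support := by
    refine Finset.eq_of_subset_of_card_le ?_ ?_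
    · intro x hx
      obtain ⟨y, hy, rfl⟩ := Finset.mem_image.1 hx
      exact key y hy
    · rw [Finset.card_image_of_injective _ b.injective]
  rw [← hinj] at hi
  obtain ⟨y, hy, hyi⟩ := Finset.mem_image.1 hi
  rwa [← b.injective hyi]

/-- The product of the 1 - t^ℓ is self-reciprocal up to sign: `σ ↦ b * σ⁻¹` replaces a selection of
cycles of `b` by the complementary selection. -/
theorem coeff_cycleDet_symm (b : Equiv.Perm X) (hb : ∀ i, b i ≠ i) {j : ℕ}
    (hj : j ≤ Fintype.card X) :
    PowerSeries.coeff (Fintype.card X - j) (cycleDet b)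
      = ((Equiv.Perm.sign b : ℤ) : ℝ) * (-1) ^ Fintype.card X
        * PowerSeries.coeff j (cycleDet b) := by
  rw [coeff_cycleDet b hb, coeff_cycleDet b hb, Finset.mul_sum]
  symm
  refine Finset.sum_nbij' (fun σ => b * σ⁻¹) (fun τ => τ⁻¹ * b) ?_ ?_ ?_ ?_ ?_
  · intro σ hσ
    rw [Finset.mem_filter] at hσ ⊢
    have hs := mem_partialPerms.1 hσ.1
    have key : ∀ k, (b * σ⁻¹) (σ k) = b k := by intro k; simp
    have hsupp : (b * σ⁻¹).support = σ.supportᶜ := by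
      ext i
      obtain ⟨k, rfl⟩ := σ.surjective i
      rw [Equiv.Perm.mem_support, key, Finset.mem_compl, Equiv.Perm.apply_mem_support,
        Equiv.Perm.mem_support, not_not]
      rcases hs k with h | h
      · simp [h, hb k]
      · simp [h, hb k]
    refine ⟨mem_partialPerms.2 fun i => ?_, ?_⟩
    · obtain ⟨k, rfl⟩ := σ.surjective i
      rw [key]
      rcases hs k with h | h
      · right; rw [h]
      · left; rw [h]
    · rw [hsupp, Finset.card_compl, hσ.2]
  · intro τ hτ
    rw [Finset.mem_filter] at hτ ⊢
    have hs := mem_partialPerms.1 hτ.1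
    have hinv := apply_mem_support_iff_of_mem_partialPerms hτ.1
    have hcase : ∀ i, (i ∈ τ.support ∧ (τ⁻¹ * b) i = i) ∨ (i ∉ τ.support ∧ (τ⁻¹ * b) i = b i) := by
      intro i
      by_cases hi : i ∈ τ.support
      · left
        refine ⟨hi, ?_⟩
        have : τ i = b i := (hs i).resolve_left (Equiv.Perm.mem_support.1 hi)
        rw [Equiv.Perm.mul_apply, ← this]
        simp
      · right
        refine ⟨hi, ?_⟩
        rw [← hinv] at hi
        rw [Equiv.Perm.mul_apply, Equiv.Perm.inv_eq_iff_eq]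
        exact (Equiv.Perm.notMem_support.1 hi).symm
    have hsupp : (τ⁻¹ * b).support = τ.supportᶜ := by
      ext i
      rw [Equiv.Perm.mem_support, Finset.mem_compl]
      rcases hcase i with ⟨h1, h2⟩ | ⟨h1, h2⟩
      · simp [h1, h2]
      · simp [h1, h2, hb i]
    refine ⟨mem_partialPerms.2 fun i => ?_, ?_⟩
    · rcases hcase i with ⟨h1, h2⟩ | ⟨h1, h2⟩
      · exact Or.inl h2
      · exact Or.inr h2
    · rw [hsupp, Finset.card_compl, hτ.2]; omega
  · intro σ _; group
  · intro τ _; group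
  · intro σ _
    rw [Equiv.Perm.sign_mul, Equiv.Perm.sign_inv]
    have : (-1 : ℝ) ^ (Fintype.card X - j) = (-1) ^ Fintype.card X * (-1) ^ j := by
      rw [← pow_add, show Fintype.card X + j = (Fintype.card X - j) + 2 * j by omega, pow_add,
        pow_mul]
      simp
    rw [this]
    push_cast
    ring

/-- Such a `σ` is determined by its support, a union of cycles of `b`. All cycles have length at
least 2, so at most `j / 2` points suffice to mark those in the support. -/
theorem card_partialPerms_le (b : Equiv.Perm X) (hb : ∀ i, b i ≠ i) (j : ℕ) :
    ((partialPerms b).filter fun σ => σ.support.card = j).card ≤ (Fintype.card X).choose (j / 2) := by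
  let hull : Finset X → Finset X := fun T => Finset.univ.filter fun x => ∃ t ∈ T, b.SameCycle t x
  have hex : ∀ σ ∈ (partialPerms b).filter fun σ => σ.support.card = j,
      ∃ T : Finset X, T.card = j / 2 ∧ hull T = σ.support := by
    intro σ hσ
    obtain ⟨hσ, hcard⟩ := Finset.mem_filter.1 hσ
    have hinv := apply_mem_support_iff_of_mem_partialPerms hσ
    have hinv' : ∀ x y, b.SameCycle x y → (x ∈ σ.support ↔ y ∈ σ.support) := fun x y hxy =>
      iff_of_eq (hxy.apply_eq_of_invariant (fun x => x ∈ σ.support) fun x => propext (hinv x))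
    let rep : X → X := fun x => (Quotient.mk (Equiv.Perm.SameCycle.setoid b) x).out
    have hrep : ∀ x, b.SameCycle (rep x) x := fun x =>
      Quotient.exact (s := Equiv.Perm.SameCycle.setoid b) (Quotient.out_eq _)
    have hrepb : ∀ x, rep (b x) = rep x := fun x => by
      have : (Quotient.mk (Equiv.Perm.SameCycle.setoid b) (b x)) = Quotient.mk _ x :=
        Quotient.sound (Equiv.Perm.sameCycle_apply_left.2 (Equiv.Perm.SameCycle.refl _ _))
      simp only [rep, this]
    have hreprep : ∀ x, rep (rep x) = rep x := fun x => by
      simp only [rep, Quotient.out_eq]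
    let A := σ.support.filter fun x => rep x = x
    have hdisj : Disjoint A (A.image b) := by
      rw [Finset.disjoint_left]
      intro x hx hx'
      obtain ⟨y, hy, rfl⟩ := Finset.mem_image.1 hx'
      have h1 := (Finset.mem_filter.1 hx).2
      have h2 := (Finset.mem_filter.1 hy).2
      rw [hrepb, h2] at h1
      exact hb y h1.symm
    have hsub : A ∪ A.image b ⊆ σ.support := by
      refine Finset.union_subset (Finset.filter_subset _ _) ?_
      intro x hx
      obtain ⟨y, hy, rfl⟩ := Finset.mem_image.1 hx
      exact (hinv y).2 (Finset.mem_filter.1 hy).1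
    have hA : A.card ≤ j / 2 := by
      have := Finset.card_le_card hsub
      rw [Finset.card_union_of_disjoint hdisj, Finset.card_image_of_injective _ b.injective,
        hcard] at this
      omega
    -- The representatives are padded by points of the support to exactly `j / 2` elements; the set
    -- of cycles they meet stays the same.
    obtain ⟨T, hAT, hTS, hT⟩ := Finset.exists_subsuperset_card_eq (Finset.filter_subset _ _ :
      A ⊆ σ.support) hA (by rw [hcard]; omega)
    refine ⟨T, hT, ?_⟩
    ext x
    simp only [hull, Finset.mem_filter, Finset.mem_univ, true_and]
    constructor
    · rintro ⟨t, ht, htx⟩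
      exact (hinv' _ _ htx).1 (hTS ht)
    · intro hx
      exact ⟨rep x, hAT (Finset.mem_filter.2 ⟨(hinv' _ _ (hrep x)).2 hx, hreprep x⟩), hrep x⟩
  choose! T hT using hex
  rw [← Finset.card_univ, ← Finset.card_powersetCard]
  refine Finset.card_le_card_of_injOn T ?_ ?_
  · intro σ hσ
    exact Finset.mem_coe.2 (Finset.mem_powersetCard.2 ⟨Finset.subset_univ _, (hT σ hσ).1⟩)
  · intro σ hσ τ hτ hst
    have h1 : σ.support = τ.support := by rw [← (hT σ hσ).2, ← (hT τ hτ).2, hst]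
    have hs := mem_partialPerms.1 (Finset.mem_filter.1 hσ).1
    have ht := mem_partialPerms.1 (Finset.mem_filter.1 hτ).1
    ext i
    by_cases hi : i ∈ σ.support
    · rw [(hs i).resolve_left (Equiv.Perm.mem_support.1 hi),
        (ht i).resolve_left (Equiv.Perm.mem_support.1 (h1 ▸ hi))]
    · rw [Equiv.Perm.notMem_support.1 hi, Equiv.Perm.notMem_support.1 (h1 ▸ hi)]

theorem abs_coeff_cycleDet_le (b : Equiv.Perm X) (hb : ∀ i, b i ≠ i) (j : ℕ) :
    |PowerSeries.coeff j (cycleDet b)| ≤ (Fintype.card X).choose (j / 2) := by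
  rw [coeff_cycleDet b hb]
  refine (Finset.abs_sum_le_sum_abs _ _).trans ?_
  have h1 : ∀ σ : Equiv.Perm X, |((Equiv.Perm.sign σ : ℤ) : ℝ) * (-1) ^ j| = 1 := by
    intro σ
    rw [abs_mul, abs_pow, abs_neg, abs_one, one_pow, mul_one]
    rcases Int.units_eq_one_or (Equiv.Perm.sign σ) with h | h <;> simp [h]
  simp only [h1, Finset.sum_const, nsmul_eq_mul, mul_one]
  exact_mod_cast card_partialPerms_le b hb j

/-- The coefficients of `cycleDet b / (1 - t)`. -/
noncomputable def hookCoeff (b : Equiv.Perm X) (i : ℕ) : ℝ :=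
  ∑ j ∈ Finset.range (i + 1), PowerSeries.coeff j (cycleDet b)

theorem one_sub_X_mul_mk_hookCoeff (b : Equiv.Perm X) :
    (1 - PowerSeries.X) * PowerSeries.mk (hookCoeff b) = cycleDet b := by
  ext k
  rcases k with _ | k
  · rw [sub_mul, map_sub, one_mul, PowerSeries.coeff_zero_X_mul, PowerSeries.coeff_mk, hookCoeff]
    simp
  · rw [sub_mul, map_sub, one_mul, PowerSeries.coeff_succ_X_mul, PowerSeries.coeff_mk,
      PowerSeries.coeff_mk, hookCoeff, hookCoeff, Finset.sum_range_succ _ (k + 1)]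
    ring

/-- `cycleDet b` has degree at most n and vanishes at 1, so dividing by 1 - t leaves a polynomial of
degree less than n. -/
theorem hookCoeff_eq_zero [Nonempty X] (b : Equiv.Perm X) (hb : ∀ i, b i ≠ i) {i : ℕ}
    (hi : Fintype.card X ≤ i) : hookCoeff b i = 0 := by
  rw [hookCoeff, ← sum_coeff_cycleDet b hb]
  symm
  refine Finset.sum_subset (Finset.range_subset_range.2 (by omega)) ?_
  intro j _ hj
  exact coeff_cycleDet_of_lt b hb (by simpa using hj)

theorem hookCoeff_zero (b : Equiv.Perm X) (hb : ∀ i, b i ≠ i) : hookCoeff b 0 = 1 := by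
  rw [hookCoeff, Finset.sum_range_one, coeff_cycleDet b hb]
  have : ((partialPerms b).filter fun σ => σ.support.card = 0) = {1} := by
    ext σ
    simp only [Finset.mem_filter, Finset.card_eq_zero, Equiv.Perm.support_eq_empty_iff,
      Finset.mem_singleton, mem_partialPerms]
    constructor
    · exact fun h => h.2
    · rintro rfl; simp
  rw [this]
  simp

/-- All coefficients of `cycleDet b` sum to zero, so an initial partial sum is minus the
complementary final one, which the symmetry of the coefficients reflects to an initial one. -/
theorem hookCoeff_symm [Nonempty X] (b : Equiv.Perm X) (hb : ∀ i, b i ≠ i) {i : ℕ}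
    (hi : i < Fintype.card X) :
    hookCoeff b (Fintype.card X - 1 - i)
      = -(((Equiv.Perm.sign b : ℤ) : ℝ) * (-1) ^ Fintype.card X) * hookCoeff b i := by
  have h0 := sum_coeff_cycleDet b hb
  have h1 : Fintype.card X + 1 = (Fintype.card X - 1 - i + 1) + (i + 1) := by omega
  rw [h1, Finset.sum_range_add, ← hookCoeff,
    ← Finset.sum_range_reflect] at h0
  rw [eq_neg_of_add_eq_zero_left h0, neg_mul, hookCoeff, Finset.mul_sum]
  congr 1
  refine Finset.sum_congr rfl fun j hj => ?_
  have hj' := Finset.mem_range.1 hj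
  rw [← coeff_cycleDet_symm b hb (by omega)]
  congr 2
  omega

theorem abs_hookCoeff_symm [Nonempty X] (b : Equiv.Perm X) (hb : ∀ i, b i ≠ i) {i : ℕ}
    (hi : i < Fintype.card X) :
    |hookCoeff b (Fintype.card X - 1 - i)| = |hookCoeff b i| := by
  rw [hookCoeff_symm b hb hi, abs_mul, abs_neg, abs_mul, abs_pow, abs_neg, abs_one, one_pow]
  rcases Int.units_eq_one_or (Equiv.Perm.sign b) with h | h <;> simp [h]

theorem hookCoeff_card_sub_one [Nonempty X] (b : Equiv.Perm X) (hb : ∀ i, b i ≠ i) :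
    hookCoeff b (Fintype.card X - 1)
      = -(((Equiv.Perm.sign b : ℤ) : ℝ) * (-1) ^ Fintype.card X) := by
  have := hookCoeff_symm b hb (i := 0) Fintype.card_pos
  rwa [hookCoeff_zero b hb, mul_one, Nat.sub_zero] at this

theorem Nat.choose_le_choose_of_le_half {n a c : ℕ} (hac : a ≤ c) (hc : c ≤ n / 2) :
    n.choose a ≤ n.choose c := by
  induction c, hac using Nat.le_induction with
  | base => exact le_rfl
  | succ c _ ih =>
    exact (ih (by omega)).trans (Nat.choose_le_succ_of_lt_half_left (by omega))

theorem abs_hookCoeff_le (b : Equiv.Perm X) (hb : ∀ i, b i ≠ i) {i : ℕ}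
    (hi : i ≤ Fintype.card X) :
    |hookCoeff b i| ≤ (i + 1) * (Fintype.card X).choose (i / 2) := by
  refine (Finset.abs_sum_le_sum_abs _ _).trans ?_
  have h : ∀ j ∈ Finset.range (i + 1), |PowerSeries.coeff j (cycleDet b)|
      ≤ (Fintype.card X).choose (i / 2) := by
    intro j hj
    refine (abs_coeff_cycleDet_le b hb j).trans ?_
    have hj' := Finset.mem_range.1 hj
    exact_mod_cast Nat.choose_le_choose_of_le_half (by omega) (by omega)
  refine (Finset.sum_le_sum h).trans ?_
  simp

end Admissible

/-! ### The polynomial identity for the number of cycles -/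

section HookPoly

open Polynomial

/-- The content polynomial of a hook with `n` cells, of which `i` lie below the corner. -/
noncomputable def hookPoly (n i : ℕ) : ℝ[X] :=
  (∏ k ∈ Finset.range (n - i), (X + C (k : ℝ))) *
    ∏ k ∈ Finset.range i, (X + C (-((k : ℝ) + 1)))

/-- At q + 1 the first product is (q+1)⋯(q+n-i) and the second is q(q-1)⋯(q-i+1); together they are
one descending factorial with n factors. -/
theorem eval_hookPoly {n i : ℕ} (hi : i < n) (q : ℕ) :
    (hookPoly n i).eval ((q : ℝ) + 1) = (n.factorial : ℝ) * ((q + (n - i)).choose n : ℝ) := by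
  rw [hookPoly, eval_mul, eval_prod, eval_prod]
  have h1 : ∏ k ∈ Finset.range (n - i), (X + C (k : ℝ)).eval ((q : ℝ) + 1)
      = ((q + (n - i)).descFactorial (n - i) : ℝ) := by
    rw [Nat.add_descFactorial_eq_ascFactorial, Nat.ascFactorial_eq_prod_range]
    push_cast
    simp
  have h2 : ∀ i : ℕ, ∏ k ∈ Finset.range i, (X + C (-((k : ℝ) + 1))).eval ((q : ℝ) + 1)
      = (q.descFactorial i : ℝ) := by
    intro i
    induction i with
    | zero => simp
    | succ i ih =>
      rw [Finset.prod_range_succ, ih, Nat.descFactorial_succ]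
      rcases le_or_gt i q with h | h
      · push_cast [h]
        simp
        ring
      · rw [Nat.descFactorial_of_lt h]; simp
  have h3 : ∀ m i : ℕ, (q + m).descFactorial (m + i)
      = (q + m).descFactorial m * q.descFactorial i := by
    intro m i
    induction i with
    | zero => simp
    | succ i ih =>
      rw [← add_assoc, Nat.descFactorial_succ, ih, Nat.descFactorial_succ,
        show q + m - (m + i) = q - i by omega]
      ring
  rw [h1, h2, ← Nat.cast_mul, ← h3, Nat.sub_add_cancel hi.le, Nat.descFactorial_eq_factorial_mul_choose]
  push_cast
  ring

/-- Coefficientwise domination of polynomials. -/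
def CoeffDominated (p P : ℝ[X]) : Prop := ∀ k, |p.coeff k| ≤ P.coeff k

theorem CoeffDominated.mul {p q P Q : ℝ[X]} (hp : CoeffDominated p P) (hq : CoeffDominated q Q) :
    CoeffDominated (p * q) (P * Q) := by
  intro k
  rw [coeff_mul, coeff_mul]
  refine (Finset.abs_sum_le_sum_abs _ _).trans (Finset.sum_le_sum fun x _ => ?_)
  rw [abs_mul]
  exact mul_le_mul (hp _) (hq _) (abs_nonneg _) ((abs_nonneg _).trans (hp _))

theorem CoeffDominated.prod {ι : Type*} (s : Finset ι) {p P : ι → ℝ[X]}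
    (h : ∀ i ∈ s, CoeffDominated (p i) (P i)) :
    CoeffDominated (∏ i ∈ s, p i) (∏ i ∈ s, P i) := by
  induction s using Finset.induction_on with
  | empty => intro k; simp only [Finset.prod_empty, coeff_one]; split_ifs <;> simp
  | insert a s ha ih =>
    rw [Finset.prod_insert ha, Finset.prod_insert ha]
    exact (h _ (Finset.mem_insert_self _ _)).mul
      (ih fun i hi => h _ (Finset.mem_insert_of_mem hi))

theorem coeffDominated_X_add_C (a : ℝ) : CoeffDominated (X + C a) (X + C |a|) := by
  intro k
  rcases k with _ | k
  · simp
  · rw [coeff_add, coeff_add, coeff_C_succ, coeff_C_succ, add_zero, coeff_X]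
    split_ifs <;> simp

theorem sum_range_coeff_le_eval_one {P : ℝ[X]} (hP : ∀ k, 0 ≤ P.coeff k) (N : ℕ) :
    ∑ k ∈ Finset.range N, P.coeff k ≤ P.eval 1 := by
  rw [eval_eq_sum_range' (n := max N (P.natDegree + 1)) (by omega)]
  simp only [one_pow, mul_one]
  exact Finset.sum_le_sum_of_subset_of_nonneg (Finset.range_subset_range.2 (le_max_left _ _))
    fun k _ _ => hP k

/-- Replacing every root by its negative absolute value gives a polynomial that dominates
coefficientwise, and its value at 1 is the right-hand side. -/
theorem sum_abs_coeff_hookPoly_le (n i N : ℕ) :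
    ∑ k ∈ Finset.range N, |(hookPoly n i).coeff k|
      ≤ ((n - i).factorial : ℝ) * ((i + 1).factorial : ℝ) := by
  have hdom : CoeffDominated (hookPoly n i)
      ((∏ k ∈ Finset.range (n - i), (X + C |(k : ℝ)|)) *
        ∏ k ∈ Finset.range i, (X + C |(-((k : ℝ) + 1))|)) :=
    (CoeffDominated.prod _ fun k _ => coeffDominated_X_add_C _).mul
      (CoeffDominated.prod _ fun k _ => coeffDominated_X_add_C _)
  refine (Finset.sum_le_sum fun k _ => hdom k).trans
    ((sum_range_coeff_le_eval_one (fun k => (abs_nonneg _).trans (hdom k)) N).trans_eq ?_)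
  rw [eval_mul, eval_prod, eval_prod]
  have h1 : ∀ m : ℕ, ∏ k ∈ Finset.range m, (X + C |(k : ℝ)|).eval 1 = (m.factorial : ℝ) := by
    intro m
    induction m with
    | zero => simp
    | succ m ih =>
      rw [Finset.prod_range_succ, ih, Nat.factorial_succ]
      simp
      ring
  have h2 : ∀ m : ℕ, ∏ k ∈ Finset.range m, (X + C |(-((k : ℝ) + 1))|).eval 1
      = ((m + 1).factorial : ℝ) := by
    intro m
    induction m with
    | zero => simp
    | succ m ih =>
      rw [Finset.prod_range_succ, ih, Nat.factorial_succ (m + 1), abs_neg,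
        abs_of_nonneg (by positivity)]
      simp
      ring
  rw [h1, h2]

theorem coeff_prod_X_add_C (n k : ℕ) :
    (∏ j ∈ Finset.range n, (X + C (j : ℝ))).coeff k = (Nat.stirlingFirst n k : ℝ) := by
  induction n generalizing k with
  | zero => rcases k with _ | k <;> simp [coeff_one]
  | succ n ih =>
    rw [Finset.prod_range_succ]
    rcases k with _ | k
    · rw [mul_add, coeff_add, coeff_mul_X_zero, coeff_mul_C, ih]
      rcases n with _ | n <;> simp
    · rw [mul_add, coeff_add, coeff_mul_X, coeff_mul_C, ih, ih, Nat.stirlingFirst_succ_succ]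
      push_cast
      ring

theorem coeff_prod_X_sub_C (n k : ℕ) :
    (∏ j ∈ Finset.range n, (X + C (-(j : ℝ)))).coeff k
      = (-1) ^ (n + k) * (Nat.stirlingFirst n k : ℝ) := by
  induction n generalizing k with
  | zero => rcases k with _ | k <;> simp [coeff_one]
  | succ n ih =>
    rw [Finset.prod_range_succ]
    rcases k with _ | k
    · rw [mul_add, coeff_add, coeff_mul_X_zero, coeff_mul_C, ih]
      rcases n with _ | n <;> simp
    · rw [mul_add, coeff_add, coeff_mul_X, coeff_mul_C, ih, ih, Nat.stirlingFirst_succ_succ]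
      push_cast
      ring

theorem coeff_hookPoly_zero (n k : ℕ) :
    (hookPoly n 0).coeff k = (Nat.stirlingFirst n k : ℝ) := by
  rw [hookPoly, Finset.prod_range_zero, mul_one, Nat.sub_zero, coeff_prod_X_add_C]

theorem coeff_hookPoly_last {n : ℕ} (hn : 0 < n) (k : ℕ) :
    (hookPoly n (n - 1)).coeff k = (-1) ^ (n + k) * (Nat.stirlingFirst n k : ℝ) := by
  rw [← coeff_prod_X_sub_C, hookPoly]
  obtain ⟨m, rfl⟩ : ∃ m, n = m + 1 := ⟨n - 1, by omega⟩
  rw [Finset.prod_range_succ', show m + 1 - (m + 1 - 1) = 1 by omega, Finset.prod_range_one,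
    Nat.add_sub_cancel, mul_comm]
  simp

end HookPoly

/-! ### From the generating function to the distribution of the number of cycles -/

section CycleFreq

open Polynomial

variable {X Y : Type*} [Fintype X] [Fintype Y]

/-- The polynomial whose coefficients count the full cycles `a` by the number of cycles of
`a * b`. -/
noncomputable def cyclePoly (b : Equiv.Perm X) : ℝ[X] := cycleSum b fun k => (Polynomial.X ^ k : ℝ[X])

theorem cycleSeries_mul_eq [Nonempty X] (b : Equiv.Perm X) :
    cycleSeries b = ((fullCycles X).card : PowerSeries ℝ) * PowerSeries.X *
      (PowerSeries.mk (hookCoeff b) *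
        PowerSeries.mk fun k => ((Fintype.card X + k).choose (Fintype.card X) : ℝ)) := by
  have h1 := cycleSeries_eq b
  have h2 := one_sub_X_mul_mk_hookCoeff b
  have h3 := PowerSeries.mk_add_choose_mul_one_sub_pow_eq_one (S := ℝ) (Fintype.card X)
  have h4 := PowerSeries.mk_one_mul_one_sub_eq_one ℝ
  set n := Fintype.card X
  set B : PowerSeries ℝ := PowerSeries.mk fun k => ((n + k).choose n : ℝ)
  rw [← h2] at h1
  have h5 : (1 - PowerSeries.X : PowerSeries ℝ) ^ (n + 2) = (1 - PowerSeries.X) ^ (n + 1)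
      * (1 - PowerSeries.X) := pow_succ _ _
  have h6 : (B * PowerSeries.mk 1) * (1 - PowerSeries.X) ^ (n + 2) = 1 := by
    rw [h5]
    linear_combination h3 * (PowerSeries.mk 1 * (1 - PowerSeries.X)) + h4
  linear_combination (B * PowerSeries.mk 1) * h1 - cycleSeries b * h6
    + ((fullCycles X).card : PowerSeries ℝ) * PowerSeries.X * PowerSeries.mk (hookCoeff b) * B * h4

/-- Both sides are polynomials that agree at every q + 1: there the left side is a coefficient of
`cycleSeries b`, and the right side is the convolution of `hookCoeff b` with binomial coefficients.
-/
theorem cyclePoly_eq [Nonempty X] (b : Equiv.Perm X) (hb : ∀ i, b i ≠ i) :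
    cyclePoly b = C ((fullCycles X).card : ℝ) * ∑ i ∈ Finset.range (Fintype.card X),
      C (hookCoeff b i / ((Fintype.card X).factorial : ℝ)) * hookPoly (Fintype.card X) i := by
  set n := Fintype.card X with hn
  refine Polynomial.eq_of_infinite_eval_eq _ _ (Set.Infinite.mono (s := Set.range fun q : ℕ =>
    ((q : ℝ) + 1)) ?_ (Set.infinite_range_of_injective fun a b h => by simpa using h))
  rintro _ ⟨q, rfl⟩
  rw [Set.mem_ofPred_eq]
  have h1 : (cyclePoly b).eval ((q : ℝ) + 1) = PowerSeries.coeff (q + 1) (cycleSeries b) := by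
    rw [cycleSeries, PowerSeries.coeff_mk, cyclePoly, cycleSum, cycleSum, eval_finsetSum]
    simp
  rw [h1, cycleSeries_mul_eq, mul_assoc, ← hn]
  have h2 : ((fullCycles X).card : PowerSeries ℝ) = PowerSeries.C ((fullCycles X).card : ℝ) := by
    simp
  rw [h2, PowerSeries.coeff_C_mul, PowerSeries.coeff_succ_X_mul, eval_mul, eval_C, eval_finsetSum,
    PowerSeries.coeff_mul, Finset.Nat.sum_antidiagonal_eq_sum_range_succ_mk]
  congr 1
  have hfac : (n.factorial : ℝ) ≠ 0 := by positivity
  have h3 : ∀ i ∈ Finset.range n, (C (hookCoeff b i / (n.factorial : ℝ)) * hookPoly n i).eval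
      ((q : ℝ) + 1) = hookCoeff b i * ((q + (n - i)).choose n : ℝ) := by
    intro i hi
    rw [eval_mul, eval_C, eval_hookPoly (Finset.mem_range.1 hi)]
    field_simp
  rw [Finset.sum_congr rfl h3]
  simp only [PowerSeries.coeff_mk]
  -- Terms with `i > q` vanish through the binomial coefficient, and terms with `i ≥ n` through
  -- `hookCoeff`.
  rw [← Finset.sum_subset (s₁ := Finset.range (q + 1) ∩ Finset.range n)
      (s₂ := Finset.range q.succ) Finset.inter_subset_left,
    ← Finset.sum_subset (s₁ := Finset.range (q + 1) ∩ Finset.range n)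
      (s₂ := Finset.range n) Finset.inter_subset_right]
  · refine Finset.sum_congr rfl fun i hi => ?_
    simp only [Finset.mem_inter, Finset.mem_range] at hi
    rw [show n + (q - i) = q + (n - i) by omega]
  · intro i hi hi'
    simp only [Finset.mem_inter, Finset.mem_range] at hi hi'
    rw [Nat.choose_eq_zero_of_lt (by omega), Nat.cast_zero, mul_zero]
  · intro i hi hi'
    simp only [Finset.mem_inter, Finset.mem_range] at hi hi'
    rw [hookCoeff_eq_zero b hb (by omega), zero_mul]

/-- The proportion of full cycles `a` such that `a * b` has `k` cycles. -/
noncomputable def cycleFreq (b : Equiv.Perm X) (k : ℕ) : ℝ :=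
  cycleSum b (fun j => if j = k then (1 : ℝ) else 0) / (fullCycles X).card

theorem coeff_cyclePoly (b : Equiv.Perm X) (k : ℕ) :
    (cyclePoly b).coeff k = (fullCycles X).card * cycleFreq b k := by
  have : ((fullCycles X).card : ℝ) ≠ 0 := by exact_mod_cast (card_fullCycles_pos X).ne'
  rw [cycleFreq, mul_div_cancel₀ _ this, cyclePoly, cycleSum, cycleSum, finsetSum_coeff]
  refine Finset.sum_congr rfl fun a _ => ?_
  rw [coeff_X_pow]
  simp [eq_comm]

/-- The distribution of the number of cycles of a random permutation of `n` points whose product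
with an `n`-cycle has sign `s`. -/
noncomputable def parityDist (n : ℕ) (s : ℝ) (k : ℕ) : ℝ :=
  (Nat.stirlingFirst n k : ℝ) / (n.factorial : ℝ) * (1 - s * (-1) ^ k)

/-- The hooks `i = 0` and `i = n - 1` have the coefficients c(n,k) and ±c(n,k), and together they
give exactly `parityDist`. All other hooks are error terms. -/
theorem sum_abs_cycleFreq_sub_le [Nonempty X] (b : Equiv.Perm X) (hb : ∀ i, b i ≠ i) (N : ℕ) :
    ∑ k ∈ Finset.range N, |cycleFreq b k
        - parityDist (Fintype.card X) ((Equiv.Perm.sign b : ℤ) : ℝ) k|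
      ≤ ∑ i ∈ Finset.Ico 1 (Fintype.card X - 1), |hookCoeff b i| *
        (((Fintype.card X - i).factorial : ℝ) * ((i + 1).factorial : ℝ)
          / ((Fintype.card X).factorial : ℝ)) := by
  have hn2 : 2 ≤ Fintype.card X := by
    obtain ⟨x⟩ := ‹Nonempty X›
    exact Fintype.one_lt_card_iff.2 ⟨b x, x, hb x⟩
  set n := Fintype.card X with hn
  have hfac : (n.factorial : ℝ) ≠ 0 := by positivity
  have hf : ((fullCycles X).card : ℝ) ≠ 0 := by exact_mod_cast (card_fullCycles_pos X).ne'
  have hfreq : ∀ k, cycleFreq b k = ∑ i ∈ Finset.range n,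
      hookCoeff b i / (n.factorial : ℝ) * (hookPoly n i).coeff k := by
    intro k
    have h1 := coeff_cyclePoly b k
    rw [cyclePoly_eq b hb, coeff_C_mul, finsetSum_coeff] at h1
    rw [← mul_left_cancel₀ hf h1]
    refine Finset.sum_congr rfl fun i _ => ?_
    rw [coeff_C_mul]
  have hsplit : ∀ k, cycleFreq b k - parityDist n ((Equiv.Perm.sign b : ℤ) : ℝ) k
      = ∑ i ∈ Finset.Ico 1 (n - 1),
        hookCoeff b i / (n.factorial : ℝ) * (hookPoly n i).coeff k := by
    intro k
    have hlast := hookCoeff_card_sub_one b hb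
    rw [← hn] at hlast
    have hrange : Finset.range n = Finset.Ico 0 (n - 1 + 1) := by
      rw [Finset.range_eq_Ico, Nat.sub_add_cancel (by omega)]
    have hs : (-1 : ℝ) ^ n * (-1) ^ (n + k) = (-1) ^ k := by
      rw [← pow_add, ← add_assoc, pow_add, ← two_mul, pow_mul]; simp
    rw [hfreq, hrange, Finset.sum_Ico_succ_top (by omega), Finset.sum_eq_sum_Ico_succ_bot (by omega),
      hookCoeff_zero b hb, hlast, coeff_hookPoly_zero, coeff_hookPoly_last (by omega), parityDist]
    linear_combination (-((Equiv.Perm.sign b : ℤ) : ℝ) * (Nat.stirlingFirst n k : ℝ)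
      / (n.factorial : ℝ)) * hs
  calc _ = ∑ k ∈ Finset.range N, |∑ i ∈ Finset.Ico 1 (n - 1),
        hookCoeff b i / (n.factorial : ℝ) * (hookPoly n i).coeff k| := by simp only [hsplit]
    _ ≤ ∑ k ∈ Finset.range N, ∑ i ∈ Finset.Ico 1 (n - 1),
        |hookCoeff b i| / (n.factorial : ℝ) * |(hookPoly n i).coeff k| := by
        refine Finset.sum_le_sum fun k _ => (Finset.abs_sum_le_sum_abs _ _).trans_eq ?_
        refine Finset.sum_congr rfl fun i _ => ?_
        rw [abs_mul, abs_div, Nat.abs_cast]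
    _ = ∑ i ∈ Finset.Ico 1 (n - 1), |hookCoeff b i| / (n.factorial : ℝ) *
        ∑ k ∈ Finset.range N, |(hookPoly n i).coeff k| := by
        rw [Finset.sum_comm]
        simp only [Finset.mul_sum]
    _ ≤ _ := by
        refine Finset.sum_le_sum fun i _ => ?_
        rw [div_mul_eq_mul_div, mul_div_assoc]
        gcongr
        exact sum_abs_coeff_hookPoly_le n i N

end CycleFreq

/-! ### Estimates -/

section Estimates

/-- Factor by factor, (a - j)/(c - j) ≤ a/c for `a ≤ c`. -/
theorem Nat.choose_mul_pow_le_choose_mul_pow {a c : ℕ} (h : a ≤ c) (k : ℕ) :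
    a.choose k * c ^ k ≤ c.choose k * a ^ k := by
  have key : a.descFactorial k * c ^ k ≤ c.descFactorial k * a ^ k := by
    induction k with
    | zero => simp
    | succ k ih =>
      have h1 : (a - k) * c ≤ (c - k) * a := by
        rcases le_or_gt a k with hk | hk
        · simp [Nat.sub_eq_zero_of_le hk]
        · zify [hk.le, hk.le.trans h]
          nlinarith
      calc a.descFactorial (k + 1) * c ^ (k + 1)
          = (a.descFactorial k * c ^ k) * ((a - k) * c) := by
            rw [Nat.descFactorial_succ]; ring
        _ ≤ (c.descFactorial k * a ^ k) * ((c - k) * a) := Nat.mul_le_mul ih h1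
        _ = _ := by rw [Nat.descFactorial_succ]; ring
  rw [Nat.descFactorial_eq_factorial_mul_choose, Nat.descFactorial_eq_factorial_mul_choose,
    mul_assoc, mul_assoc] at key
  exact Nat.le_of_mul_le_mul_left key k.factorial_pos

/-- With h = ⌊i/2⌋ and m = i - h, the ratio equals C(i,m)/C(n-h,m), hence is at most (i/(n-h))^m.
Since h ≤ n/4, the base is at most 4i/(3n) ≤ 2/3. One factor keeps the saving 1/n, and the others
decay geometrically because 2/3 ≤ (5/6)². -/
theorem choose_half_div_choose_le {n i : ℕ} (hi : 1 ≤ i) (hin : 2 * i ≤ n) :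
    (n.choose (i / 2) : ℝ) / (n.choose i : ℝ) ≤ 2 * i / n * (5 / 6) ^ i := by
  set h := i / 2 with hh
  set m := i - h with hm
  have hn : (0 : ℝ) < n := by exact_mod_cast (by omega : 0 < n)
  have hi0 : (0 : ℝ) < i := by exact_mod_cast hi
  have hc1 : (0 : ℝ) < n.choose i := by exact_mod_cast Nat.choose_pos (by omega)
  have hc2 : (0 : ℝ) < (n - h).choose m := by exact_mod_cast Nat.choose_pos (by omega)
  have hnh : (0 : ℝ) < ((n - h : ℕ) : ℝ) := by exact_mod_cast (by omega : 0 < n - h)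
  have e1 : (n.choose i : ℝ) * i.choose h = n.choose h * (n - h).choose m := by
    exact_mod_cast Nat.choose_mul (n := n) (by omega : h ≤ i)
  have e2 : (i.choose m : ℝ) = i.choose h := by
    exact_mod_cast Nat.choose_symm (by omega : h ≤ i)
  have e3 : (i.choose m : ℝ) * ((n - h : ℕ) : ℝ) ^ m ≤ (n - h).choose m * (i : ℝ) ^ m := by
    exact_mod_cast Nat.choose_mul_pow_le_choose_mul_pow (by omega) m
  have e4 : (n.choose h : ℝ) / n.choose i ≤ ((i : ℝ) / (n - h : ℕ)) ^ m := by
    have : (n.choose h : ℝ) / n.choose i = i.choose m / (n - h).choose m := by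
      rw [e2]; field_simp; linarith
    rw [this, div_pow, div_le_div_iff₀ hc2 (by positivity)]
    linarith
  have hhr : 2 * (h : ℝ) ≤ i := by exact_mod_cast (by omega : 2 * h ≤ i)
  have hinr : 2 * (i : ℝ) ≤ n := by exact_mod_cast hin
  have hsub : ((n - h : ℕ) : ℝ) = n - h := by push_cast [show h ≤ n by omega]; ring
  have e5 : (i : ℝ) / (n - h : ℕ) ≤ 4 * i / (3 * n) := by
    rw [div_le_div_iff₀ hnh (by positivity), hsub]
    nlinarith
  have e6 : (i : ℝ) / (n - h : ℕ) ≤ 2 / 3 := by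
    refine e5.trans ?_
    rw [div_le_div_iff₀ (by positivity) (by norm_num)]
    linarith
  obtain ⟨m', hm'⟩ : ∃ m', m = m' + 1 := ⟨m - 1, by omega⟩
  calc (n.choose h : ℝ) / n.choose i ≤ ((i : ℝ) / (n - h : ℕ)) ^ m := e4
    _ = ((i : ℝ) / (n - h : ℕ)) ^ m' * ((i : ℝ) / (n - h : ℕ)) := by rw [hm', pow_succ]
    _ ≤ (2 / 3) ^ m' * (4 * i / (3 * n)) := by gcongr
    _ = 2 * i / n * (2 / 3) ^ m := by rw [hm', pow_succ]; field_simp; ring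
    _ ≤ 2 * i / n * (5 / 6) ^ i := by
      gcongr
      calc (2 / 3 : ℝ) ^ m ≤ ((5 / 6) ^ 2) ^ m := by gcongr; norm_num
        _ = (5 / 6) ^ (2 * m) := by rw [pow_mul]
        _ ≤ (5 / 6) ^ i := pow_le_pow_of_le_one (by norm_num) (by norm_num) (by omega)

/-- The summand in the constant `hookConst`. -/
noncomputable def hookTerm (i : ℕ) : ℝ := 2 * i * (i + 1) ^ 2 * (5 / 6) ^ i

theorem hookTerm_nonneg (i : ℕ) : 0 ≤ hookTerm i := by unfold hookTerm; positivity

theorem summable_hookTerm : Summable hookTerm := by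
  have h : ∀ k : ℕ, Summable fun n : ℕ => (n : ℝ) ^ k * (5 / 6 : ℝ) ^ n := fun k =>
    summable_pow_mul_geometric_of_norm_lt_one k (by norm_num)
  have := (((h 3).mul_left 2).add ((h 2).mul_left 4)).add ((h 1).mul_left 2)
  refine this.congr fun n => ?_
  unfold hookTerm
  ring

/-- The constant in the estimate for permutations without fixed points. -/
noncomputable def hookConst : ℝ := 2 * ∑' i, hookTerm i

theorem hookConst_nonneg : 0 ≤ hookConst :=
  mul_nonneg (by norm_num) (tsum_nonneg hookTerm_nonneg)

variable {X Y : Type*} [Fintype X] [Fintype Y]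

theorem factorial_mul_factorial_div {n i : ℕ} (hi : i ≤ n) :
    ((n - i).factorial : ℝ) * ((i + 1).factorial : ℝ) / (n.factorial : ℝ)
      = (i + 1) / (n.choose i : ℝ) := by
  have h1 : (n.choose i : ℝ) * i.factorial * (n - i).factorial = n.factorial := by
    exact_mod_cast Nat.choose_mul_factorial_mul_factorial hi
  have h2 : (n.choose i : ℝ) ≠ 0 := by exact_mod_cast (Nat.choose_pos hi).ne'
  have h3 : (n.factorial : ℝ) ≠ 0 := by positivity
  rw [div_eq_div_iff h3 h2, ← h1, Nat.factorial_succ]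
  push_cast
  ring

/-- The term at `i` is unchanged under i ↦ n - 1 - i, so terms beyond the middle are reflected to
the lower half, where they are bounded by a summable series divided by n. -/
theorem sum_hookCoeff_le [Nonempty X] (b : Equiv.Perm X) (hb : ∀ i, b i ≠ i) :
    ∑ i ∈ Finset.Ico 1 (Fintype.card X - 1), |hookCoeff b i| *
        (((Fintype.card X - i).factorial : ℝ) * ((i + 1).factorial : ℝ)
          / ((Fintype.card X).factorial : ℝ)) ≤ hookConst / Fintype.card X := by
  set n := Fintype.card X with hn
  have hn0 : (0 : ℝ) < n := by exact_mod_cast Fintype.card_pos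
  set t : ℕ → ℝ := fun i => |hookCoeff b i| *
        (((n - i).factorial : ℝ) * ((i + 1).factorial : ℝ) / (n.factorial : ℝ)) with ht
  have hsmall : ∀ i, 1 ≤ i → 2 * i ≤ n → t i ≤ hookTerm i / n := by
    intro i h1 h2
    have hc : (0 : ℝ) < n.choose i := by exact_mod_cast Nat.choose_pos (by omega)
    calc t i = |hookCoeff b i| * ((i + 1) / (n.choose i : ℝ)) := by
          rw [ht]; simp only [factorial_mul_factorial_div (show i ≤ n by omega)]
      _ ≤ ((i + 1) * n.choose (i / 2)) * ((i + 1) / (n.choose i : ℝ)) := by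
          gcongr
          exact abs_hookCoeff_le b hb (by omega)
      _ = (i + 1) ^ 2 * ((n.choose (i / 2) : ℝ) / n.choose i) := by ring
      _ ≤ (i + 1) ^ 2 * (2 * i / n * (5 / 6) ^ i) := by
          gcongr
          exact choose_half_div_choose_le h1 h2
      _ = hookTerm i / n := by unfold hookTerm; ring
  have hsymm : ∀ i, i < n → t (n - 1 - i) = t i := by
    intro i hi
    simp only [ht]
    rw [abs_hookCoeff_symm b hb hi, show n - (n - 1 - i) = i + 1 by omega,
      show n - 1 - i + 1 = n - i by omega, mul_comm ((i + 1).factorial : ℝ)]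
  have hterm : ∀ i ∈ Finset.Ico 1 (n - 1), t i ≤ hookTerm i / n + hookTerm (n - 1 - i) / n := by
    intro i hi
    rw [Finset.mem_Ico] at hi
    rcases le_or_gt (2 * i) n with h | h
    · exact (hsmall i hi.1 h).trans (le_add_of_nonneg_right (by
        have := hookTerm_nonneg (n - 1 - i); positivity))
    · rw [← hsymm i (by omega)]
      exact (hsmall _ (by omega) (by omega)).trans (le_add_of_nonneg_left (by
        have := hookTerm_nonneg i; positivity))
  have hsum : ∀ s : Finset ℕ, ∑ i ∈ s, hookTerm i ≤ ∑' i, hookTerm i := fun s =>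
    summable_hookTerm.sum_le_tsum s fun i _ => hookTerm_nonneg i
  calc ∑ i ∈ Finset.Ico 1 (n - 1), t i
      ≤ ∑ i ∈ Finset.Ico 1 (n - 1), (hookTerm i / n + hookTerm (n - 1 - i) / n) :=
        Finset.sum_le_sum hterm
    _ = (∑ i ∈ Finset.Ico 1 (n - 1), hookTerm i) / n
        + (∑ i ∈ Finset.Ico 1 (n - 1), hookTerm (n - 1 - i)) / n := by
        rw [Finset.sum_add_distrib, Finset.sum_div, Finset.sum_div]
    _ ≤ (∑' i, hookTerm i) / n + (∑' i, hookTerm i) / n := by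
        gcongr
        · exact hsum _
        · rw [← Finset.sum_image (s := Finset.Ico 1 (n - 1)) (g := fun i => n - 1 - i)
            (f := hookTerm)]
          · exact hsum _
          · intro i hi j hj hij
            simp only [Finset.coe_Ico, Set.mem_Ico] at hi hj
            simp only at hij
            omega
    _ = hookConst / n := by unfold hookConst; ring

theorem sum_abs_cycleFreq_sub_le_of_ne [Nonempty X] (b : Equiv.Perm X) (hb : ∀ i, b i ≠ i)
    (N : ℕ) :
    ∑ k ∈ Finset.range N, |cycleFreq b k
        - parityDist (Fintype.card X) ((Equiv.Perm.sign b : ℤ) : ℝ) k|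
      ≤ hookConst / Fintype.card X :=
  (sum_abs_cycleFreq_sub_le b hb N).trans (sum_hookCoeff_le b hb)

theorem sum_range_stirlingFirst (n N : ℕ) :
    ∑ k ∈ Finset.range N, (Nat.stirlingFirst n k : ℝ) ≤ n.factorial := by
  have h := sum_range_coeff_le_eval_one
    (P := ∏ j ∈ Finset.range n, (Polynomial.X + Polynomial.C (j : ℝ)))
    (fun k => by rw [coeff_prod_X_add_C]; positivity) N
  simp only [coeff_prod_X_add_C] at h
  refine h.trans_eq ?_
  rw [Polynomial.eval_prod]
  clear h
  induction n with
  | zero => simp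
  | succ n ih => rw [Finset.prod_range_succ, ih, Nat.factorial_succ]; simp; ring

/-- The recurrence c(n+1,k) = n·c(n,k) + c(n,k-1) makes the difference (c(n,k) - c(n,k-1))/(n+1)!
times the parity weight. That weight depends on `s` and `k` but not on `n`, and is at most 2. -/
theorem parityDist_succ_sub {n : ℕ} (hn : 0 < n) {s : ℝ} (hs : |s| = 1) (N : ℕ) :
    ∑ k ∈ Finset.range N, |parityDist n s k - parityDist (n + 1) s k| ≤ 4 / (n + 1) := by
  have hfac : (0 : ℝ) < n.factorial := by positivity
  have hbound : ∀ k, |parityDist n s k - parityDist (n + 1) s k|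
      ≤ 2 / ((n + 1) * n.factorial) *
        ((Nat.stirlingFirst n k : ℝ) + (if k = 0 then 0 else Nat.stirlingFirst n (k - 1) : ℝ)) := by
    intro k
    have hd : parityDist n s k - parityDist (n + 1) s k
        = 1 / ((n + 1) * n.factorial) * ((Nat.stirlingFirst n k : ℝ)
          - (if k = 0 then 0 else Nat.stirlingFirst n (k - 1) : ℝ)) * (1 - s * (-1) ^ k) := by
      unfold parityDist
      rw [Nat.factorial_succ]
      rcases k with _ | k
      · obtain ⟨m, rfl⟩ : ∃ m, n = m + 1 := ⟨n - 1, by omega⟩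
        simp
      · rw [Nat.stirlingFirst_succ_succ]
        push_cast
        simp
        field_simp
        ring
    have h2 : |1 - s * (-1) ^ k| ≤ 2 := by
      refine (abs_sub _ _).trans ?_
      rw [abs_one, abs_mul, abs_pow, abs_neg, abs_one, one_pow, hs]
      norm_num
    have h3 : |(Nat.stirlingFirst n k : ℝ) - (if k = 0 then 0 else Nat.stirlingFirst n (k - 1) : ℝ)|
        ≤ (Nat.stirlingFirst n k : ℝ) + (if k = 0 then 0 else Nat.stirlingFirst n (k - 1) : ℝ) := by
      refine (abs_sub _ _).trans_eq ?_
      split_ifs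
      · simp
      · rw [Nat.abs_cast, Nat.abs_cast]
    rw [hd, abs_mul, abs_mul, abs_of_nonneg (by positivity : (0:ℝ) ≤ 1 / ((n + 1) * n.factorial))]
    calc _ ≤ 1 / ((n + 1) * n.factorial) * ((Nat.stirlingFirst n k : ℝ)
          + (if k = 0 then 0 else Nat.stirlingFirst n (k - 1) : ℝ)) * 2 := by gcongr
      _ = _ := by ring
  refine (Finset.sum_le_sum fun k _ => hbound k).trans ?_
  rw [← Finset.mul_sum, Finset.sum_add_distrib]
  have h4 : ∑ k ∈ Finset.range N, (if k = 0 then 0 else Nat.stirlingFirst n (k - 1) : ℝ)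
      ≤ n.factorial := by
    rcases N with _ | N
    · simp
    · rw [Finset.sum_range_succ']
      simp only [Nat.succ_ne_zero, if_false, Nat.add_sub_cancel, if_true, add_zero]
      exact sum_range_stirlingFirst n N
  calc _ ≤ 2 / ((n + 1) * n.factorial) * ((n.factorial : ℝ) + n.factorial) := by
        gcongr
        exact sum_range_stirlingFirst n N
    _ = 4 / (n + 1) := by field_simp; ring

end Estimates

/-! ### Permutations with fixed points -/

section FixedPoints

variable {X Y : Type*} [Fintype X] [Fintype Y]

/-- The number of fixed points of a permutation. -/
noncomputable def numFixed (b : Equiv.Perm X) : ℕ := (Finset.univ.filter fun x => b x = x).card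

theorem numFixed_permCongr (e : X ≃ Y) (b : Equiv.Perm X) :
    numFixed (e.permCongr b) = numFixed b := by
  refine Finset.card_nbij' e.symm e ?_ ?_ ?_ ?_
  · intro y hy
    have h := (Finset.mem_filter.1 hy).2
    exact Finset.mem_filter.2 ⟨Finset.mem_univ _, by simpa [Equiv.eq_symm_apply] using h⟩
  · intro x hx
    have h := (Finset.mem_filter.1 hx).2
    exact Finset.mem_filter.2 ⟨Finset.mem_univ _, by simpa using h⟩
  · intro y _; simp
  · intro x _; simp

theorem numFixed_optionCongr (b : Equiv.Perm X) :
    numFixed (Equiv.optionCongr b) = numFixed b + 1 := by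
  rw [numFixed, numFixed, Finset.card_filter, Finset.card_filter, Fintype.sum_option, add_comm]
  simp

theorem cycleFreq_permCongr (e : X ≃ Y) (b : Equiv.Perm X) (k : ℕ) :
    cycleFreq (e.permCongr b) k = cycleFreq b k := by
  rw [cycleFreq, cycleFreq, cycleSum_permCongr, card_fullCycles_congr e]

theorem cycleFreq_optionCongr [Nonempty X] (b : Equiv.Perm X) (k : ℕ) :
    cycleFreq (Equiv.optionCongr b) k = cycleFreq b k := by
  have h1 : (Fintype.card X : ℝ) ≠ 0 := by exact_mod_cast Fintype.card_ne_zero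
  rw [cycleFreq, cycleFreq, cycleSum_optionCongr, card_fullCycles_option, nsmul_eq_mul,
    Nat.cast_mul, mul_comm (((fullCycles X).card : ℕ) : ℝ), mul_div_mul_left _ _ h1]

theorem cycleFreq_nonneg (b : Equiv.Perm X) (k : ℕ) : 0 ≤ cycleFreq b k := by
  refine div_nonneg (Finset.sum_nonneg fun a _ => ?_) (Nat.cast_nonneg _)
  dsimp only
  split_ifs <;> simp

theorem sum_cycleFreq_le_one (b : Equiv.Perm X) (N : ℕ) :
    ∑ k ∈ Finset.range N, cycleFreq b k ≤ 1 := by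
  simp only [cycleFreq]
  rw [← Finset.sum_div]
  refine div_le_one_of_le₀ ?_ (Nat.cast_nonneg _)
  simp only [cycleSum]
  rw [Finset.sum_comm, Finset.card_eq_sum_ones, Nat.cast_sum]
  refine Finset.sum_le_sum fun a _ => ?_
  rw [Finset.sum_ite_eq]
  split_ifs <;> simp

theorem abs_sign_eq_one (b : Equiv.Perm X) : |((Equiv.Perm.sign b : ℤ) : ℝ)| = 1 := by
  rcases Int.units_eq_one_or (Equiv.Perm.sign b) with h | h <;> simp [h]

theorem sum_abs_parityDist_le {n : ℕ} {s : ℝ} (hs : |s| = 1) (N : ℕ) :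
    ∑ k ∈ Finset.range N, |parityDist n s k| ≤ 2 := by
  have hfac : (0 : ℝ) < n.factorial := by positivity
  calc _ ≤ ∑ k ∈ Finset.range N, (Nat.stirlingFirst n k : ℝ) / (n.factorial : ℝ) * 2 := by
        refine Finset.sum_le_sum fun k _ => ?_
        rw [parityDist, abs_mul, abs_of_nonneg (by positivity :
          (0 : ℝ) ≤ (Nat.stirlingFirst n k : ℝ) / (n.factorial : ℝ))]
        gcongr
        refine (abs_sub _ _).trans ?_
        rw [abs_one, abs_mul, abs_pow, abs_neg, abs_one, one_pow, hs]
        norm_num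
    _ = (∑ k ∈ Finset.range N, (Nat.stirlingFirst n k : ℝ)) / (n.factorial : ℝ) * 2 := by
        rw [← Finset.sum_mul, ← Finset.sum_div]
    _ ≤ 1 * 2 := by
        gcongr
        exact div_le_one_of_le₀ (sum_range_stirlingFirst n N) hfac.le
    _ = 2 := by norm_num

/-- Deleting a fixed point of `b` changes neither the sign nor the cycle distribution of the
products, only the size in `parityDist`. Each of the `f` deletions costs at most 4/(n - f). -/
theorem sum_abs_cycleFreq_sub_le_of_numFixed (f : ℕ) : ∀ (X : Type*) [Fintype X]
    (b : Equiv.Perm X), numFixed b = f → f < Fintype.card X → ∀ N : ℕ,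
    ∑ k ∈ Finset.range N, |cycleFreq b k
        - parityDist (Fintype.card X) ((Equiv.Perm.sign b : ℤ) : ℝ) k|
      ≤ (hookConst + 4 * f) / (Fintype.card X - f : ℕ) := by
  induction f with
  | zero =>
    intro X _ b hf hlt N
    have : Nonempty X := Fintype.card_pos_iff.1 hlt
    have hb : ∀ i, b i ≠ i := by
      intro i hi
      rw [numFixed, Finset.card_eq_zero] at hf
      exact Finset.notMem_empty i (hf ▸ Finset.mem_filter.2 ⟨Finset.mem_univ i, hi⟩)
    simpa using sum_abs_cycleFreq_sub_le_of_ne b hb N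
  | succ f ih =>
    intro X _ b hf hlt N
    obtain ⟨x, hx⟩ := Finset.card_pos.1 (by rw [numFixed] at hf; omega :
      0 < (Finset.univ.filter fun x => b x = x).card)
    rw [Finset.mem_filter] at hx
    let e : Option {y // y ≠ x} ≃ X := Equiv.optionSubtypeNe x
    have hcard : Fintype.card {y // y ≠ x} + 1 = Fintype.card X := by
      rw [← Fintype.card_option, Fintype.card_congr e]
    obtain ⟨b', hb'⟩ : ∃ b' : Equiv.Perm {y // y ≠ x}, b = e.permCongr (Equiv.optionCongr b') := by
      have hnone : (e.symm.permCongr b) none = none := by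
        have h1 : e none = x := Equiv.optionSubtypeNe_none x
        simp [h1, hx.2, Equiv.symm_apply_eq]
      rcases perm_option_cases (e.symm.permCongr b) with ⟨b', hb'⟩ | ⟨c, b', hb'⟩
      · exact ⟨b', by rw [← hb']; ext; simp⟩
      · rw [hb'] at hnone
        simp at hnone
    have hne : Nonempty {y // y ≠ x} := Fintype.card_pos_iff.1 (by omega)
    have hfix : numFixed b' = f := by
      rw [hb', numFixed_permCongr, numFixed_optionCongr] at hf
      omega
    have hsign : Equiv.Perm.sign b
        = @Equiv.Perm.sign _ (fun a b => Classical.propDecidable (a = b)) _ b' := by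
      rw [hb', Equiv.Perm.sign_permCongr]
      convert Equiv.optionCongr_sign b'
    have hfreq : ∀ k, cycleFreq b k = cycleFreq b' k := fun k => by
      rw [hb', cycleFreq_permCongr, cycleFreq_optionCongr]
    have h1 := ih _ b' hfix (by omega) N
    have h2 := parityDist_succ_sub (n := Fintype.card {y // y ≠ x}) Fintype.card_pos
      (abs_sign_eq_one b) N
    rw [hcard] at h2
    rw [← hsign] at h1
    have hd : (Fintype.card X - (f + 1) : ℕ) = (Fintype.card {y // y ≠ x} - f : ℕ) := by omega
    have hdpos : (0 : ℝ) < (Fintype.card {y // y ≠ x} - f : ℕ) := by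
      exact_mod_cast (by omega : 0 < Fintype.card {y // y ≠ x} - f)
    have hle : ((Fintype.card {y // y ≠ x} - f : ℕ) : ℝ) ≤ (Fintype.card {y // y ≠ x} : ℝ) + 1 := by
      exact_mod_cast (by omega : Fintype.card {y // y ≠ x} - f ≤ Fintype.card {y // y ≠ x} + 1)
    calc _ ≤ ∑ k ∈ Finset.range N, (|cycleFreq b' k
          - parityDist (Fintype.card {y // y ≠ x}) ((Equiv.Perm.sign b : ℤ) : ℝ) k|
          + |parityDist (Fintype.card {y // y ≠ x}) ((Equiv.Perm.sign b : ℤ) : ℝ) k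
            - parityDist (Fintype.card X) ((Equiv.Perm.sign b : ℤ) : ℝ) k|) := by
          refine Finset.sum_le_sum fun k _ => ?_
          rw [hfreq]
          exact abs_sub_le _ _ _
      _ ≤ (hookConst + 4 * f) / (Fintype.card {y // y ≠ x} - f : ℕ)
          + 4 / (Fintype.card {y // y ≠ x} + 1) := by
          rw [Finset.sum_add_distrib]
          exact add_le_add h1 h2
      _ ≤ (hookConst + 4 * f) / (Fintype.card {y // y ≠ x} - f : ℕ)
          + 4 / (Fintype.card {y // y ≠ x} - f : ℕ) := by gcongr
      _ = _ := by rw [hd]; push_cast; ring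

/-- The number of cycles of the product of a uniformly random full cycle with a permutation that
has few fixed points is nearly distributed as for a random permutation of the right parity. -/
theorem sum_abs_cycleFreq_sub_le_div [Nonempty X] (b : Equiv.Perm X) (N : ℕ) :
    ∑ k ∈ Finset.range N, |cycleFreq b k
        - parityDist (Fintype.card X) ((Equiv.Perm.sign b : ℤ) : ℝ) k|
      ≤ (2 * hookConst + 8 * numFixed b) / Fintype.card X := by
  have hn : (0 : ℝ) < Fintype.card X := by exact_mod_cast Fintype.card_pos
  have hC := hookConst_nonneg
  rcases le_or_gt (2 * numFixed b) (Fintype.card X) with h | h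
  · have hpos := Fintype.card_pos (α := X)
    refine (sum_abs_cycleFreq_sub_le_of_numFixed _ X b rfl (by omega) N).trans ?_
    have h1 : (0 : ℝ) < (Fintype.card X - numFixed b : ℕ) := by
      exact_mod_cast (by omega : 0 < Fintype.card X - numFixed b)
    have h2 : (Fintype.card X : ℝ) ≤ 2 * (Fintype.card X - numFixed b : ℕ) := by
      exact_mod_cast (by omega : Fintype.card X ≤ 2 * (Fintype.card X - numFixed b))
    rw [div_le_div_iff₀ h1 hn]
    have h3 : 0 ≤ hookConst + 4 * numFixed b := by positivity
    nlinarith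
  -- If more than half of the points are fixed, the trivial bound 3 is enough.
  · have h2 : (Fintype.card X : ℝ) ≤ 2 * numFixed b := by exact_mod_cast h.le
    calc _ ≤ ∑ k ∈ Finset.range N, (cycleFreq b k
          + |parityDist (Fintype.card X) ((Equiv.Perm.sign b : ℤ) : ℝ) k|) := by
          refine Finset.sum_le_sum fun k _ => (abs_sub _ _).trans_eq ?_
          rw [abs_of_nonneg (cycleFreq_nonneg b k)]
      _ ≤ 1 + 2 := by
          rw [Finset.sum_add_distrib]
          exact add_le_add (sum_cycleFreq_le_one b N) (sum_abs_parityDist_le (abs_sign_eq_one b) N)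
      _ ≤ _ := by
          rw [le_div_iff₀ hn]
          nlinarith

theorem stirlingDist_eq (n : ℕ) (p : ℝ) (k : ℕ) :
    stirlingDist n p k
      = (Nat.stirlingFirst n k : ℝ) / (n.factorial : ℝ) * (1 + (1 - 2 * p) * (-1) ^ (n + k)) := by
  unfold stirlingDist
  split_ifs with h
  · rw [h.neg_one_pow]; ring
  · rw [(Nat.not_odd_iff_even.1 h).neg_one_pow]; ring

theorem numCycles_eq_one [Nonempty X] {a : Equiv.Perm X} (ha : a ∈ fullCycles X) :
    numCycles a = 1 := by
  rw [mem_fullCycles] at ha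
  rw [numCycles_eq_card_of_surjective a (fun _ => ()) (fun _ => ⟨Classical.arbitrary X, rfl⟩)
    (fun x y => by simp [ha x y])]
  simp

/-- A full cycle has sign (-1)^(n+1), so the sign of `b` determines the parity of the product and
selects p = 0 or p = 1. -/
theorem parityDist_eq_stirlingDist [Nonempty X] {a : Equiv.Perm X} (ha : a ∈ fullCycles X)
    (b : Equiv.Perm X) (k : ℕ) :
    parityDist (Fintype.card X) ((Equiv.Perm.sign b : ℤ) : ℝ) k
      = stirlingDist (Fintype.card X) (if IsOddPerm (a * b) then 1 else 0) k := by
  have h1 : Equiv.Perm.sign (a * b) = (-1) ^ (Fintype.card X + 1) * Equiv.Perm.sign b := by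
    rw [Equiv.Perm.sign_mul, sign_eq_neg_one_pow_numCycles a, numCycles_eq_one ha]
  rw [stirlingDist_eq, parityDist, IsOddPerm, h1]
  congr 1
  rcases Int.units_eq_one_or (Equiv.Perm.sign b) with h | h <;>
    rcases Nat.even_or_odd (Fintype.card X) with hp | hp <;>
      simp [h, pow_add, hp.neg_one_pow] <;> ring

end FixedPoints

/-! ### Random rotations -/

section Rotations

variable {W : Type*} [Fintype W] {α : W → Type*} [∀ w, Fintype (α w)]

/-- Resampling: replacing one coordinate of a uniform family by an independent uniform value leaves
its distribution unchanged. -/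
theorem sum_piFinset_update {T : W → Type*} {M : Type*} [AddCommMonoid M]
    (C : ∀ w, Finset (T w)) (u : W) (F : (∀ w, T w) → M) :
    ∑ f ∈ Fintype.piFinset C, ∑ z ∈ C u, F (Function.update f u z)
      = (C u).card • ∑ f ∈ Fintype.piFinset C, F f := by
  rw [← Finset.sum_product', ← Finset.sum_const, ← Finset.sum_product']
  refine Finset.sum_nbij' (fun p => (p.1 u, Function.update p.1 u p.2))
    (fun p => (Function.update p.2 u p.1, p.2 u)) ?_ ?_ ?_ ?_ ?_
  · intro p hp
    simp only [Finset.mem_product, Fintype.mem_piFinset] at hp ⊢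
    refine ⟨hp.1 u, fun w => ?_⟩
    by_cases h : w = u
    · subst h; simpa using hp.2
    · rw [Function.update_of_ne h]; exact hp.1 w
  · intro p hp
    simp only [Finset.mem_product, Fintype.mem_piFinset] at hp ⊢
    refine ⟨fun w => ?_, hp.2 u⟩
    by_cases h : w = u
    · subst h; simpa using hp.1
    · rw [Function.update_of_ne h]; exact hp.2 w
  · intro p _; simp
  · intro p _; simp
  · intro p _; rfl

/-- The families of full cycles. -/
noncomputable def rotations (α : W → Type*) [∀ w, Fintype (α w)] :
    Finset (∀ w, Equiv.Perm (α w)) := Fintype.piFinset fun w => fullCycles (α w)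

theorem mem_rotations {ζ : ∀ w, Equiv.Perm (α w)} :
    ζ ∈ rotations α ↔ ∀ w, ζ w ∈ fullCycles (α w) := Fintype.mem_piFinset

theorem card_rotations_pos : 0 < (rotations α).card :=
  Finset.card_pos.2 (Fintype.piFinset_nonempty.2 fun w => fullCycles_nonempty (α w))

/-- The permutation of a sigma type that acts on each fibre by the given permutation. -/
abbrev glue (ζ : ∀ w, Equiv.Perm (α w)) : Equiv.Perm (Σ w, α w) :=
  Equiv.Perm.sigmaCongrRight ζ

/-- The fibre of a sigma type, as a finset. -/
noncomputable def fiber (α : W → Type*) [∀ w, Fintype (α w)] (u : W) : Finset (Σ w, α w) :=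
  Finset.univ.filter fun d => d.1 = u

theorem mem_fiber {u : W} {d : Σ w, α w} : d ∈ fiber α u ↔ d.1 = u := by simp [fiber]

/-- A fibre as a subtype. -/
noncomputable def fiberEquiv (α : W → Type*) [∀ w, Fintype (α w)] (u : W) :
    α u ≃ {d // d ∈ fiber α u} :=
  Equiv.ofBijective (fun i => ⟨⟨u, i⟩, mem_fiber.2 rfl⟩) (by
    constructor
    · intro i j h
      simpa using h
    · rintro ⟨⟨w, i⟩, h⟩
      obtain rfl : w = u := mem_fiber.1 h
      exact ⟨i, rfl⟩)

theorem fiberEquiv_apply (u : W) (i : α u) : (fiberEquiv α u i : Σ w, α w) = ⟨u, i⟩ := rfl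

/-- The permutation of a fibre that is induced by `E` and the rotations at the other fibres. -/
noncomputable def outerPerm (E : Equiv.Perm (Σ w, α w)) (ζ : ∀ w, Equiv.Perm (α w)) (u : W) :
    Equiv.Perm (α u) :=
  (fiberEquiv α u).symm.permCongr
    (inducedPerm (E * glue (Function.update ζ u 1)) (fiber α u))

theorem outerPerm_update (E : Equiv.Perm (Σ w, α w)) (ζ : ∀ w, Equiv.Perm (α w)) (u : W)
    (z : Equiv.Perm (α u)) : outerPerm E (Function.update ζ u z) u = outerPerm E ζ u := by
  simp [outerPerm]

theorem glue_update (ζ : ∀ w, Equiv.Perm (α w)) (u : W) (z : Equiv.Perm (α u)) :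
    glue (Function.update ζ u z) = glue (Function.update ζ u 1)
      * Equiv.Perm.ofSubtype ((fiberEquiv α u).permCongr z) := by
  ext1 d
  obtain ⟨w, i⟩ := d
  rw [Equiv.Perm.mul_apply]
  by_cases h : w = u
  · subst h
    have h1 : Equiv.Perm.ofSubtype ((fiberEquiv α w).permCongr z) (⟨w, i⟩ : Σ w, α w)
        = ⟨w, z i⟩ := by
      have := Equiv.Perm.ofSubtype_apply_coe ((fiberEquiv α w).permCongr z) (fiberEquiv α w i)
      rw [fiberEquiv_apply] at this
      rw [this, Equiv.permCongr_apply, Equiv.symm_apply_apply, fiberEquiv_apply]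
    rw [h1]
    simp
  · rw [Equiv.Perm.ofSubtype_apply_of_not_mem _ (fun hm => h (mem_fiber.1 hm))]
    simp [Function.update_of_ne h]

/-- This separates the rotation at `u` from all others: `outerPerm E ρ u` is computed with the
identity at `u`, so it is independent of a random rotation there. -/
theorem inducedPerm_glue_eq (E : Equiv.Perm (Σ w, α w)) (ζ : ∀ w, Equiv.Perm (α w)) (u : W) :
    inducedPerm (E * glue ζ) (fiber α u) = (fiberEquiv α u).permCongr (outerPerm E ζ u * ζ u) := by
  have h := glue_update ζ u (ζ u)
  rw [Function.update_eq_self] at h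
  rw [h, ← mul_assoc, inducedPerm_mul_ofSubtype]
  ext1 x
  simp [outerPerm]

/-- The number of elements of the fibre of `d` in the cycle of `d`. -/
noncomputable def fiberLength (a : Equiv.Perm (Σ w, α w)) (d : Σ w, α w) : ℕ :=
  (Finset.univ.filter fun x => a.SameCycle d x ∧ x.1 = d.1).card

theorem fiberLength_pos (a : Equiv.Perm (Σ w, α w)) (d : Σ w, α w) : 0 < fiberLength a d :=
  Finset.card_pos.2 ⟨d, Finset.mem_filter.2
    ⟨Finset.mem_univ _, Equiv.Perm.SameCycle.refl _ _, rfl⟩⟩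

/-- Conjugation by `outerPerm E ζ u` exchanges the two factors, so that the random full cycle stands
on the left as in `shortCount`. -/
theorem fiberLength_eq (E : Equiv.Perm (Σ w, α w)) (ζ : ∀ w, Equiv.Perm (α w)) (u : W) (i : α u) :
    fiberLength (E * glue ζ) ⟨u, i⟩
      = cycleLength (ζ u * outerPerm E ζ u) ((outerPerm E ζ u).symm i) := by
  have h1 : cycleLength (ζ u * outerPerm E ζ u) ((outerPerm E ζ u).symm i)
      = cycleLength (outerPerm E ζ u * ζ u) i := by
    rw [← cycleLength_permCongr]
    congr 1
    ext1 x
    simp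
  have hsame : ∀ j : α u, (outerPerm E ζ u * ζ u).SameCycle i j ↔
      (E * glue ζ).SameCycle ⟨u, i⟩ ⟨u, j⟩ := by
    intro j
    have := sameCycle_inducedPerm (E * glue ζ) (fiber α u) (fiberEquiv α u i) (fiberEquiv α u j)
    rw [inducedPerm_glue_eq, sameCycle_permCongr, Equiv.symm_apply_apply, Equiv.symm_apply_apply]
      at this
    exact this
  rw [h1, fiberLength, cycleLength]
  symm
  refine Finset.card_nbij (fun j => ⟨u, j⟩) ?_ ?_ ?_
  · intro j hj
    exact Finset.mem_filter.2 ⟨Finset.mem_univ _, (hsame j).1 (Finset.mem_filter.1 hj).2, rfl⟩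
  · intro j _ j' _ h
    simpa using h
  · rintro ⟨w, j⟩ hj
    obtain ⟨h2, h3⟩ := (Finset.mem_filter.1 hj).2
    obtain rfl : w = u := h3
    exact ⟨j, Finset.mem_coe.2 (Finset.mem_filter.2 ⟨Finset.mem_univ _, (hsame j).2 h2⟩), rfl⟩

/-- The probability that a face returns only a few times to the fibre of a given element. -/
theorem sum_fiberLength_le (E : Equiv.Perm (Σ w, α w)) (d : Σ w, α w) (K : ℕ) :
    (∑ ζ ∈ rotations α, if fiberLength (E * glue ζ) d ≤ K then 1 else 0)
      * (Fintype.card (α d.1) - K) ≤ K * (rotations α).card := by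
  obtain ⟨u, i⟩ := d
  have h1 := sum_piFinset_update (fun w => fullCycles (α w)) u
    (fun ζ => if fiberLength (E * glue ζ) ⟨u, i⟩ ≤ K then 1 else 0)
  have h2 : ∀ ζ : ∀ w, Equiv.Perm (α w), (∑ z ∈ fullCycles (α u),
      if fiberLength (E * glue (Function.update ζ u z)) ⟨u, i⟩ ≤ K then 1 else 0)
      = shortCount (outerPerm E ζ u) ((outerPerm E ζ u).symm i) K := by
    intro ζ
    refine Finset.sum_congr rfl fun z _ => ?_
    rw [fiberLength_eq, outerPerm_update, Function.update_self]
  simp only [h2, smul_eq_mul] at h1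
  refine Nat.le_of_mul_le_mul_left ?_ (card_fullCycles_pos (α u))
  rw [← mul_assoc, rotations, ← h1, Finset.sum_mul]
  refine (Finset.sum_le_sum fun ζ _ => shortCount_le _ (α u) rfl _ _ K).trans_eq ?_
  rw [Finset.sum_const, smul_eq_mul]
  ring

end Rotations

/-! ### Long faces -/

section LongFaces

variable {W : Type*} [Fintype W] {α : W → Type*} [∀ w, Fintype (α w)]

theorem cycleLength_eq_of_sameCycle {X : Type*} [Fintype X] {a : Equiv.Perm X} {x y : X}
    (h : a.SameCycle x y) : cycleLength a x = cycleLength a y := by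
  rw [cycleLength, cycleLength]
  congr 1
  ext z
  simp only [Finset.mem_filter, Finset.mem_univ, true_and]
  exact ⟨fun hz => h.symm.trans hz, fun hz => h.trans hz⟩

/-- The set of fibres visited by the cycle of `d`. -/
noncomputable def visited (a : Equiv.Perm (Σ w, α w)) (d : Σ w, α w) : Finset W :=
  (Finset.univ.filter fun x => a.SameCycle d x).image Sigma.fst

theorem card_visited_eq (a : Equiv.Perm (Σ w, α w)) (d : Σ w, α w) :
    ((visited a d).card : ℝ) = ∑ x with a.SameCycle d x, (1 : ℝ) / fiberLength a x := by
  rw [visited, ← Finset.sum_fiberwise_of_maps_to (t := (Finset.univ.filter fun x =>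
    a.SameCycle d x).image Sigma.fst) (g := Sigma.fst)
    (fun x hx => Finset.mem_image_of_mem _ hx), Finset.card_eq_sum_ones, Nat.cast_sum]
  refine Finset.sum_congr rfl fun w hw => ?_
  have hlen : ∀ x ∈ (Finset.univ.filter fun x => a.SameCycle d x).filter (fun x => x.1 = w),
      fiberLength a x
        = ((Finset.univ.filter fun x => a.SameCycle d x).filter (fun x => x.1 = w)).card := by
    intro x hx
    simp only [Finset.mem_filter, Finset.mem_univ, true_and] at hx
    rw [fiberLength]
    congr 1
    ext y
    simp only [Finset.mem_filter, Finset.mem_univ, true_and]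
    rw [hx.2]
    exact ⟨fun h => ⟨hx.1.trans h.1, h.2⟩, fun h => ⟨hx.1.symm.trans h.1, h.2⟩⟩
  rw [Finset.sum_congr rfl fun x hx => by rw [hlen x hx], Finset.sum_const, nsmul_eq_mul]
  obtain ⟨x, hx, hxw⟩ := Finset.mem_image.1 hw
  have hpos : ((((Finset.univ.filter fun x => a.SameCycle d x).filter
      (fun x => x.1 = w)).card : ℕ) : ℝ) ≠ 0 := by
    exact_mod_cast (Finset.card_pos.2 ⟨x, Finset.mem_filter.2 ⟨hx, hxw⟩⟩).ne'
  rw [mul_one_div_cancel hpos]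
  simp

/-- Both sides count the incident pairs of a cycle and a fibre: the weights 1/`cycleLength` sum to 1
over each cycle, and the weights 1/`fiberLength` sum to 1 over each incidence. -/
theorem sum_card_visited_div (a : Equiv.Perm (Σ w, α w)) :
    ∑ d, ((visited a d).card : ℝ) / cycleLength a d = ∑ d, (1 : ℝ) / fiberLength a d := by
  simp only [card_visited_eq, Finset.sum_div, Finset.sum_filter]
  rw [Finset.sum_comm]
  refine Finset.sum_congr rfl fun x _ => ?_
  have h1 : ∀ d, (if a.SameCycle d x then (1 : ℝ) / fiberLength a x else 0) / cycleLength a d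
      = if a.SameCycle x d then (1 : ℝ) / fiberLength a x / cycleLength a x else 0 := by
    intro d
    by_cases h : a.SameCycle d x
    · rw [if_pos h, if_pos h.symm, cycleLength_eq_of_sameCycle h]
    · rw [if_neg h, if_neg fun h' => h h'.symm, zero_div]
  rw [Finset.sum_congr rfl fun d _ => h1 d, ← Finset.sum_filter, Finset.sum_const, nsmul_eq_mul]
  have hlen : (Finset.univ.filter fun d => a.SameCycle x d).card = cycleLength a x := by
    unfold cycleLength
    congr
  rw [hlen]
  have : (cycleLength a x : ℝ) ≠ 0 := by exact_mod_cast (cycleLength_pos a x).ne'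
  field_simp

theorem sum_one_div_fiberLength_le (a : Equiv.Perm (Σ w, α w)) {k : ℕ} (hk : 0 < k) :
    ∑ d, (1 : ℝ) / fiberLength a d
      ≤ (∑ d, if fiberLength a d ≤ k then (1 : ℝ) else 0) + Fintype.card (Σ w, α w) / k := by
  have hk' : (0 : ℝ) < k := by exact_mod_cast hk
  have : (Fintype.card (Σ w, α w) : ℝ) / k = ∑ d : Σ w, α w, (1 : ℝ) / k := by
    rw [Finset.sum_const, nsmul_eq_mul, Finset.card_univ]; ring
  rw [this, ← Finset.sum_add_distrib]
  refine Finset.sum_le_sum fun d _ => ?_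
  have hpos : (1 : ℝ) ≤ fiberLength a d := by exact_mod_cast fiberLength_pos a d
  split_ifs with h
  · have h1 : (1 : ℝ) / fiberLength a d ≤ 1 := div_le_one_of_le₀ hpos (by positivity)
    have h2 : (0 : ℝ) ≤ 1 / k := by positivity
    linarith
  · rw [zero_add]
    gcongr
    omega

/-- By `hE`, different elements of a fibre are matched with elements of different fibres. So each
passage of the cycle through the fibre of `d` continues to another fibre than the other passages do.
-/
theorem fiberLength_le_card_visited (E : Equiv.Perm (Σ w, α w)) (ζ : ∀ w, Equiv.Perm (α w))
    (hE : ∀ d d' : Σ w, α w, d.1 = d'.1 → (E d).1 = (E d').1 → d = d') (d : Σ w, α w) :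
    fiberLength (E * glue ζ) d ≤ (visited (E * glue ζ) d).card := by
  refine Finset.card_le_card_of_injOn (fun x => ((E * glue ζ) x).1) ?_ ?_
  · intro x hx
    have hx' := (Finset.mem_filter.1 hx).2
    exact Finset.mem_image_of_mem _ (Finset.mem_filter.2 ⟨Finset.mem_univ _,
      Equiv.Perm.sameCycle_apply_right.2 hx'.1⟩)
  · intro x hx y hy hxy
    have hx' := (Finset.mem_filter.1 hx).2
    have hy' := (Finset.mem_filter.1 hy).2
    have h1 : glue ζ x = glue ζ y := hE _ _ (hx'.2.trans hy'.2.symm) hxy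
    exact (glue ζ).injective h1

/-- A cycle with more than `K` elements in the fibre of `d` visits more than `K` fibres. There
M/length is at most M/K times the number of visited fibres over the length, which sums to the number
of incidences of cycles and fibres. -/
theorem sum_min_le (E : Equiv.Perm (Σ w, α w)) (ζ : ∀ w, Equiv.Perm (α w))
    (hE : ∀ d d' : Σ w, α w, d.1 = d'.1 → (E d).1 = (E d').1 → d = d') (M : ℕ) {k K : ℕ}
    (hk : 0 < k) (hK : 0 < K) :
    ∑ d, min (1 : ℝ) (M / cycleLength (E * glue ζ) d)
      ≤ (∑ d, if fiberLength (E * glue ζ) d ≤ K then (1 : ℝ) else 0)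
        + M / K * ((∑ d, if fiberLength (E * glue ζ) d ≤ k then (1 : ℝ) else 0)
          + Fintype.card (Σ w, α w) / k) := by
  set a := E * glue ζ with ha
  have hK' : (0 : ℝ) < K := by exact_mod_cast hK
  have h1 := sum_one_div_fiberLength_le a hk
  rw [← sum_card_visited_div] at h1
  calc _ ≤ ∑ d, ((if fiberLength a d ≤ K then (1 : ℝ) else 0)
        + M / K * (((visited a d).card : ℝ) / cycleLength a d)) := by
        refine Finset.sum_le_sum fun d _ => ?_
        have hlen : (0 : ℝ) < cycleLength a d := by exact_mod_cast cycleLength_pos a d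
        split_ifs with h
        · exact (min_le_left _ _).trans (le_add_of_nonneg_right (by positivity))
        · rw [zero_add]
          refine (min_le_right _ _).trans ?_
          have h2 : (K : ℝ) ≤ (visited a d).card := by
            exact_mod_cast (not_le.1 h).le.trans (fiberLength_le_card_visited E ζ hE d)
          calc (M : ℝ) / cycleLength a d = M / K * (K / cycleLength a d) := by field_simp
            _ ≤ _ := by gcongr
    _ = (∑ d, if fiberLength a d ≤ K then (1 : ℝ) else 0)
        + M / K * ∑ d, ((visited a d).card : ℝ) / cycleLength a d := by
        rw [Finset.sum_add_distrib, Finset.mul_sum]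
    _ ≤ _ := by gcongr

theorem sum_rotations_fiberLength_le (E : Equiv.Perm (Σ w, α w)) {M K : ℕ}
    (hM : ∀ w, Fintype.card (α w) = M) (hK : 2 * K ≤ M) (hM0 : 0 < M) :
    ∑ ζ ∈ rotations α, ∑ d, (if fiberLength (E * glue ζ) d ≤ K then (1 : ℝ) else 0)
      ≤ (rotations α).card * Fintype.card (Σ w, α w) * (2 * K / M) := by
  rw [Finset.sum_comm]
  have hM' : (0 : ℝ) < M := by exact_mod_cast hM0
  have h : ∀ d : Σ w, α w,
      ∑ ζ ∈ rotations α, (if fiberLength (E * glue ζ) d ≤ K then (1 : ℝ) else 0)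
        ≤ (rotations α).card * (2 * K / M) := by
    intro d
    have h1 := sum_fiberLength_le E d K
    rw [hM] at h1
    have h2 : (M : ℝ) ≤ 2 * (M - K : ℕ) := by exact_mod_cast (by omega : M ≤ 2 * (M - K))
    have h3 : (∑ ζ ∈ rotations α, (if fiberLength (E * glue ζ) d ≤ K then (1 : ℝ) else 0))
        * (M - K : ℕ) ≤ K * (rotations α).card := by exact_mod_cast h1
    have h4 : 0 ≤ ∑ ζ ∈ rotations α, (if fiberLength (E * glue ζ) d ≤ K then (1 : ℝ) else 0) :=
      Finset.sum_nonneg fun _ _ => by split_ifs <;> simp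
    rw [← mul_div_assoc, le_div_iff₀ hM']
    nlinarith
  refine (Finset.sum_le_sum fun d _ => h d).trans_eq ?_
  rw [Finset.sum_const, nsmul_eq_mul, Finset.card_univ]
  ring

/-- Most elements lie in long faces. -/
theorem sum_rotations_min_le (E : Equiv.Perm (Σ w, α w))
    (hE : ∀ d d' : Σ w, α w, d.1 = d'.1 → (E d).1 = (E d').1 → d = d') {M r : ℕ}
    (hM : ∀ w, Fintype.card (α w) = M) (hr : 2 ≤ r) (hrM : r ^ 4 ≤ M) (hMr : M ≤ 16 * r ^ 4) :
    ∑ ζ ∈ rotations α, ∑ d, min (1 : ℝ) (M / cycleLength (E * glue ζ) d)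
      ≤ (rotations α).card * Fintype.card (Σ w, α w) * (20 / r) := by
  have hr0 : 0 < r := by omega
  have hM0 : 0 < M := lt_of_lt_of_le (by positivity) hrM
  have hr' : (0 : ℝ) < r := by exact_mod_cast hr0
  have hM' : (0 : ℝ) < M := by exact_mod_cast hM0
  have hrM' : (r : ℝ) ^ 4 ≤ M := by exact_mod_cast hrM
  have hMr' : (M : ℝ) ≤ 16 * r ^ 4 := by exact_mod_cast hMr
  have h3 : 2 * r ^ 3 ≤ M := le_trans (by
    calc 2 * r ^ 3 ≤ r * r ^ 3 := Nat.mul_le_mul_right _ hr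
      _ = r ^ 4 := by ring) hrM
  have h2 : 2 * r ^ 2 ≤ M := le_trans (Nat.mul_le_mul_left 2 (Nat.pow_le_pow_right hr0 (by omega))) h3
  have hA := sum_rotations_fiberLength_le E hM h3 hM0
  have hB := sum_rotations_fiberLength_le E hM h2 hM0
  set R : ℝ := ((rotations α).card : ℝ) with hR
  set N : ℝ := (Fintype.card (Σ w, α w) : ℝ) with hN
  have hRN : 0 ≤ R * N := by positivity
  -- With M of order r⁴, the choices r² and r³ make all three error terms of order 1/r.
  refine (Finset.sum_le_sum fun ζ _ => sum_min_le E ζ hE M (k := r ^ 2) (K := r ^ 3)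
    (by positivity) (by positivity)).trans ?_
  rw [Finset.sum_add_distrib, ← Finset.mul_sum, Finset.sum_add_distrib, Finset.sum_const,
    nsmul_eq_mul, ← hR, ← hN]
  push_cast at hA hB ⊢
  calc _ ≤ R * N * (2 * r ^ 3 / M) + M / r ^ 3 * (R * N * (2 * r ^ 2 / M) + R * (N / r ^ 2)) := by
        gcongr
    _ = R * N * (2 * r ^ 3 / M + 2 / r + M / r ^ 5) := by field_simp; ring
    _ ≤ R * N * (2 / r + 2 / r + 16 / r) := by
        have e1 : 2 * (r : ℝ) ^ 3 / M ≤ 2 / r := by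
          rw [div_le_div_iff₀ hM' hr']; nlinarith
        have e2 : (M : ℝ) / r ^ 5 ≤ 16 / r := by
          rw [div_le_div_iff₀ (by positivity) hr']
          calc (M : ℝ) * r ≤ 16 * r ^ 4 * r := by gcongr
            _ = 16 * r ^ 5 := by ring
        gcongr
    _ = R * N * (20 / r) := by ring

end LongFaces

/-! ### Random transversals -/

section Transversals

variable {W : Type*} [Fintype W] {α : W → Type*} [∀ w, Fintype (α w)]

theorem sum_card_sameCycle (a : Equiv.Perm (Σ w, α w)) (d : Σ w, α w) :
    ∑ w, (Finset.univ.filter fun i : α w => a.SameCycle d ⟨w, i⟩).card = cycleLength a d := by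
  rw [cycleLength, Finset.card_filter, Fintype.sum_sigma]
  refine Finset.sum_congr rfl fun w _ => ?_
  rw [Finset.card_filter]
  refine Finset.sum_congr rfl fun i _ => ?_
  congr

/-- Combine 1 - c ≤ exp(-c) with exp(S) ≥ 1 + S. -/
theorem prod_one_sub_le {ι : Type*} (s : Finset ι) (c : ι → ℝ) (h0 : ∀ i ∈ s, 0 ≤ c i)
    (h1 : ∀ i ∈ s, c i ≤ 1) : ∏ i ∈ s, (1 - c i) ≤ 1 / (1 + ∑ i ∈ s, c i) := by
  have hS : 0 ≤ ∑ i ∈ s, c i := Finset.sum_nonneg h0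
  calc ∏ i ∈ s, (1 - c i) ≤ ∏ i ∈ s, Real.exp (-c i) := by
        refine Finset.prod_le_prod (fun i hi => by linarith [h1 i hi]) fun i hi => ?_
        linarith [Real.add_one_le_exp (-c i)]
    _ = (Real.exp (∑ i ∈ s, c i))⁻¹ := by
        rw [← Real.exp_sum, Finset.sum_neg_distrib, Real.exp_neg]
    _ ≤ _ := by
        rw [one_div]
        gcongr
        linarith [Real.add_one_le_exp (∑ i ∈ s, c i)]

/-- The choices of one element in each fibre. -/
noncomputable def transversals (α : W → Type*) [∀ w, Fintype (α w)] : Finset (∀ w, α w) :=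
  Finset.univ

theorem mem_transversals (x : ∀ w, α w) : x ∈ transversals α := Finset.mem_univ x

/-- The number of transversals through a given element that avoid a given cycle elsewhere. -/
theorem card_transversals_le (a : Equiv.Perm (Σ w, α w)) (d : Σ w, α w) (i : α d.1) {M : ℕ}
    (hM : ∀ w, Fintype.card (α w) = M) :
    (((transversals α).filter fun x =>
      x d.1 = i ∧ ∀ w, w ≠ d.1 → ¬ a.SameCycle d ⟨w, x w⟩).card : ℝ) * M
      ≤ (transversals α).card * min 1 ((M : ℝ) / cycleLength a d) := by
  obtain ⟨u, y⟩ := d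
  have hM0 : 0 < M := by rw [← hM u]; exact Fintype.card_pos_iff.2 ⟨y⟩
  have hM' : (0 : ℝ) < M := by exact_mod_cast hM0
  set f : W → ℕ := fun w => (Finset.univ.filter fun i : α w => a.SameCycle ⟨u, y⟩ ⟨w, i⟩).card
    with hf
  have hfM : ∀ w, (f w : ℝ) ≤ M := fun w => by
    exact_mod_cast (Finset.card_le_univ _).trans_eq (hM w)
  set t : ∀ w, Finset (α w) := Function.update
    (fun w => Finset.univ.filter fun i : α w => ¬ a.SameCycle ⟨u, y⟩ ⟨w, i⟩) u {i} with ht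
  have h1 : ((transversals α).filter fun x =>
      x u = i ∧ ∀ w, w ≠ u → ¬ a.SameCycle ⟨u, y⟩ ⟨w, x w⟩) = Fintype.piFinset t := by
    ext x
    simp only [Finset.mem_filter, mem_transversals, true_and, Fintype.mem_piFinset]
    constructor
    · rintro ⟨h1, h2⟩ w
      by_cases hw : w = u
      · subst hw; simp [ht, h1]
      · rw [ht, Function.update_of_ne hw]
        exact Finset.mem_filter.2 ⟨Finset.mem_univ _, h2 w hw⟩
    · intro h
      refine ⟨by simpa [ht] using h u, fun w hw => ?_⟩
      have := h w
      rw [ht, Function.update_of_ne hw] at this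
      exact (Finset.mem_filter.1 this).2
  have h2 : ((Fintype.piFinset t).card : ℝ) * M
      = (transversals α).card * ∏ w ∈ Finset.univ.erase u, (1 - (f w : ℝ) / M) := by
    rw [transversals, Finset.card_univ, Fintype.card_piFinset, Fintype.card_pi,
      ← Finset.mul_prod_erase _ _ (Finset.mem_univ u),
      ← Finset.mul_prod_erase _ (fun w => Fintype.card (α w)) (Finset.mem_univ u)]
    push_cast
    rw [mul_assoc (Fintype.card (α u) : ℝ), ← Finset.prod_mul_distrib, hM u,
      Finset.prod_congr rfl (g := fun w => (Fintype.card (α w) : ℝ) * (1 - (f w : ℝ) / M))]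
    · simp [ht]
      ring
    · intro w hw
      have h3 := Finset.card_filter_add_card_filter_not (s := (Finset.univ : Finset (α w)))
        (fun i : α w => a.SameCycle ⟨u, y⟩ ⟨w, i⟩)
      rw [Finset.card_univ, hM w] at h3
      rw [ht, Function.update_of_ne (Finset.ne_of_mem_erase hw), hM w, mul_sub, mul_one,
        mul_div_cancel₀ _ hM'.ne', eq_sub_iff_add_eq']
      exact_mod_cast h3
  rw [h1, h2]
  refine mul_le_mul_of_nonneg_left (le_min ?_ ?_) (by positivity)
  · refine Finset.prod_le_one (fun w _ => ?_) fun w _ => ?_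
    · rw [sub_nonneg]; exact div_le_one_of_le₀ (hfM w) hM'.le
    · rw [sub_le_self_iff]; positivity
  -- The fibre `u` has been left out of the product, but it contributes at most `M` to the cycle
  -- length, which the summand 1 compensates.
  · refine (prod_one_sub_le _ _ (fun w _ => by positivity)
      fun w _ => div_le_one_of_le₀ (hfM w) hM'.le).trans ?_
    have hlen : (0 : ℝ) < cycleLength a ⟨u, y⟩ := by exact_mod_cast cycleLength_pos a ⟨u, y⟩
    have h4 : (cycleLength a ⟨u, y⟩ : ℝ) = f u + ∑ w ∈ Finset.univ.erase u, (f w : ℝ) := by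
      rw [← sum_card_sameCycle a, Nat.cast_sum]
      exact (Finset.add_sum_erase Finset.univ (fun w => (f w : ℝ)) (Finset.mem_univ u)).symm
    have hS : (0 : ℝ) ≤ ∑ w ∈ Finset.univ.erase u, (f w : ℝ) :=
      Finset.sum_nonneg fun w _ => Nat.cast_nonneg _
    have hpos : 0 < 1 + (∑ w ∈ Finset.univ.erase u, (f w : ℝ)) / M :=
      add_pos_of_pos_of_nonneg one_pos (div_nonneg hS hM'.le)
    rw [← Finset.sum_div, div_le_div_iff₀ hpos hlen, one_mul, mul_add,
      mul_div_cancel₀ _ hM'.ne', mul_one, h4]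
    linarith [hfM u]

/-- The elements whose cycle avoids a transversal. -/
noncomputable def avoiding (a : Equiv.Perm (Σ w, α w)) (x : ∀ w, α w) : Finset (Σ w, α w) :=
  Finset.univ.filter fun d => ∀ w, ¬ a.SameCycle d ⟨w, x w⟩

theorem mem_avoiding {a : Equiv.Perm (Σ w, α w)} {x : ∀ w, α w} {d : Σ w, α w} :
    d ∈ avoiding a x ↔ ∀ w, ¬ a.SameCycle d ⟨w, x w⟩ := by simp [avoiding]

/-- The indices of the elements of a transversal that are alone on their cycle. -/
noncomputable def isolated (a : Equiv.Perm (Σ w, α w)) (x : ∀ w, α w) : Finset W :=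
  Finset.univ.filter fun u => ∀ w, w ≠ u → ¬ a.SameCycle ⟨u, x u⟩ ⟨w, x w⟩

theorem mem_isolated {a : Equiv.Perm (Σ w, α w)} {x : ∀ w, α w} {u : W} :
    u ∈ isolated a x ↔ ∀ w, w ≠ u → ¬ a.SameCycle ⟨u, x u⟩ ⟨w, x w⟩ := by simp [isolated]

/-- The expected number of elements whose cycle avoids a random transversal. -/
theorem sum_card_avoiding_le (a : Equiv.Perm (Σ w, α w)) {M : ℕ}
    (hM : ∀ w, Fintype.card (α w) = M) :
    (∑ x ∈ transversals α, (avoiding a x).card : ℝ)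
      ≤ (transversals α).card * ∑ d, min 1 ((M : ℝ) / cycleLength a d) := by
  simp only [avoiding, Finset.card_filter, Nat.cast_sum]
  rw [Finset.sum_comm, Finset.mul_sum]
  refine Finset.sum_le_sum fun d _ => ?_
  have hM0 : 0 < M := by rw [← hM d.1]; exact Fintype.card_pos_iff.2 ⟨d.2⟩
  have hM' : (0 : ℝ) < M := by exact_mod_cast hM0
  rw [← mul_le_mul_iff_left₀ hM']
  -- Summing over the value `i` of the transversal in the fibre of `d` removes the condition on that
  -- fibre.
  have h1 := Finset.sum_le_sum fun i (_ : i ∈ Finset.univ) => card_transversals_le a d i hM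
  rw [Finset.sum_const, Finset.card_univ, hM, nsmul_eq_mul, ← Finset.sum_mul, mul_comm (M : ℝ)]
    at h1
  refine le_trans (mul_le_mul_of_nonneg_right ?_ hM'.le) h1
  simp only [Finset.card_filter, Nat.cast_sum]
  rw [Finset.sum_comm]
  refine Finset.sum_le_sum fun x _ => ?_
  rw [Finset.sum_eq_single_of_mem (x d.1) (Finset.mem_univ _)
    (fun i _ hi => by rw [if_neg fun h => hi h.1.symm, Nat.cast_zero])]
  split_ifs with h1 h2 <;> simp
  exact (h2 ⟨rfl, fun w _ => h1 w⟩).elim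

/-- The expected number of elements of a random transversal that are alone on their cycle. -/
theorem sum_card_isolated_le (a : Equiv.Perm (Σ w, α w)) {M : ℕ}
    (hM : ∀ w, Fintype.card (α w) = M) :
    (∑ x ∈ transversals α, (isolated a x).card : ℝ) * M
      ≤ (transversals α).card * ∑ d, min 1 ((M : ℝ) / cycleLength a d) := by
  simp only [isolated, Finset.card_filter, Nat.cast_sum]
  rw [Finset.sum_comm, Fintype.sum_sigma, Finset.mul_sum, Finset.sum_mul]
  refine Finset.sum_le_sum fun u _ => ?_
  rw [Finset.mul_sum]
  refine le_trans ?_ (Finset.sum_le_sum fun i (_ : i ∈ Finset.univ) =>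
    card_transversals_le a ⟨u, i⟩ i hM)
  rw [← Finset.sum_mul]
  refine mul_le_mul_of_nonneg_right ?_ (by positivity)
  simp only [Finset.card_filter, Nat.cast_sum]
  rw [Finset.sum_comm]
  refine Finset.sum_le_sum fun x _ => ?_
  rw [Finset.sum_eq_single_of_mem (x u) (Finset.mem_univ _)
    (fun i _ hi => by rw [if_neg fun h => hi h.1.symm, Nat.cast_zero])]
  split_ifs with h1 h2 <;> simp
  exact (h2 ⟨rfl, fun w hw => h1 w hw⟩).elim

end Transversals

/-! ### Insertion of a vertex -/

section Insertion

variable {V : Type*} [Fintype V] {κ : V → Type*} [∀ u, Fintype (κ u)]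

theorem sum_rotations_bijOn {W : Type*} [Fintype W] {T A B : W → Type*}
    [∀ w, Fintype (T w)] [∀ w, Fintype (A w)] [∀ w, Fintype (B w)] {M : Type*} [AddCommMonoid M]
    (g : ∀ w, Equiv.Perm (A w) → B w → Equiv.Perm (T w))
    (hg : ∀ w, Set.BijOn (fun p : Equiv.Perm (A w) × B w => g w p.1 p.2)
      {p | p.1 ∈ fullCycles (A w)} (fullCycles (T w)))
    (F : (∀ w, Equiv.Perm (T w)) → M) :
    ∑ f ∈ rotations T, F f
      = ∑ s ∈ rotations A, ∑ x ∈ transversals B, F fun w => g w (s w) (x w) := by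
  rw [← Finset.sum_product']
  symm
  refine Finset.sum_nbij (fun p w => g w (p.1 w) (p.2 w)) ?_ ?_ ?_ (fun _ _ => rfl)
  · intro p hp
    have := mem_rotations.1 (Finset.mem_product.1 hp).1
    exact mem_rotations.2 fun w => (hg w).mapsTo (x := (p.1 w, p.2 w)) (this w)
  · intro p hp q hq h
    have hp' := mem_rotations.1 (Finset.mem_product.1 (Finset.mem_coe.1 hp)).1
    have hq' := mem_rotations.1 (Finset.mem_product.1 (Finset.mem_coe.1 hq)).1
    have key : ∀ w, (p.1 w, p.2 w) = (q.1 w, q.2 w) := fun w =>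
      (hg w).injOn (hp' w) (hq' w) (congrFun h w)
    exact Prod.ext (funext fun w => congrArg Prod.fst (key w))
      (funext fun w => congrArg Prod.snd (key w))
  · intro f hf
    have hf' := mem_rotations.1 (Finset.mem_coe.1 hf)
    choose p hp hpf using fun w => (hg w).surjOn (hf' w)
    refine ⟨(fun w => (p w).1, fun w => (p w).2), Finset.mem_coe.2 (Finset.mem_product.2
      ⟨mem_rotations.2 hp, mem_transversals _⟩), funext hpf⟩

/-- Insert the element `e` into a permutation of the other elements, after the element `x`. -/
noncomputable def insertAt {X : Type*} (e : X) (z : Equiv.Perm {i // i ≠ e}) (x : {i // i ≠ e}) :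
    Equiv.Perm X :=
  (Equiv.optionSubtypeNe e).permCongr (insertAfter z x)

section InsertAt

variable {X : Type*} {e : X} (z : Equiv.Perm {i // i ≠ e}) (x : {i // i ≠ e})

theorem insertAt_self : insertAt e z x e = z x := by
  rw [insertAt, Equiv.permCongr_apply, Equiv.optionSubtypeNe_symm_self, insertAfter_none]
  simp

theorem insertAt_coe_self : insertAt e z x x = e := by
  rw [insertAt, Equiv.permCongr_apply, Equiv.optionSubtypeNe_symm_of_ne x.2,
    insertAfter_some_self]
  simp

theorem insertAt_coe_of_ne {y : {i // i ≠ e}} (h : y ≠ x) : insertAt e z x y = z y := by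
  rw [insertAt, Equiv.permCongr_apply, Equiv.optionSubtypeNe_symm_of_ne y.2,
    insertAfter_some_of_ne _ h]
  simp

end InsertAt

theorem bijOn_insertAt {X : Type*} [Fintype X] (e : X) [Nonempty {i // i ≠ e}] :
    Set.BijOn (fun p : Equiv.Perm {i // i ≠ e} × {i // i ≠ e} => insertAt e p.1 p.2)
      {p | p.1 ∈ fullCycles {i // i ≠ e}} (fullCycles X) := by
  refine ⟨?_, ?_, ?_⟩
  · intro p hp
    exact Finset.mem_coe.2 ((permCongr_mem_fullCycles _).2 (insertAfter_mem_fullCycles.2 hp))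
  · intro p _ q _ h
    have := insertAfter_injective ((Equiv.optionSubtypeNe e).permCongr.injective h)
    exact Prod.ext this.1 this.2
  · intro f hf
    obtain ⟨b, hb⟩ := (Equiv.optionSubtypeNe e).permCongr.surjective f
    subst hb
    have hb' := (permCongr_mem_fullCycles _).1 (Finset.mem_coe.1 hf)
    obtain ⟨a, x, rfl⟩ := exists_insertAfter_eq hb'
    exact ⟨(a, x), insertAfter_mem_fullCycles.1 hb', rfl⟩

end Insertion

/-! ### Faces at an inserted vertex -/

section InsertVertex

variable {V : Type*} [Fintype V] {κ : V → Type*} [∀ u, Fintype (κ u)]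

theorem Equiv.Perm.SameCycle.mem_of_forward_invariant {X : Type*} [Finite X] {a : Equiv.Perm X}
    {C : Set X} (hC : ∀ x ∈ C, a x ∈ C) {x y : X} (h : a.SameCycle x y) (hx : x ∈ C) : y ∈ C := by
  obtain ⟨k, rfl⟩ := h.exists_nat_pow_eq
  clear h
  induction k with
  | zero => exact hx
  | succ k ih => rw [pow_succ', Equiv.Perm.mul_apply]; exact hC _ ih

/-- The elements whose cycle meets the fibre over `v`. -/
noncomputable def cyclesThrough (a : Equiv.Perm (Σ u, κ u)) (v : V) : Finset (Σ u, κ u) :=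
  Finset.univ.filter fun d => ∃ y ∈ fiber κ v, a.SameCycle y d

theorem mem_cyclesThrough {a : Equiv.Perm (Σ u, κ u)} {v : V} {d : Σ u, κ u} :
    d ∈ cyclesThrough a v ↔ ∃ i : κ v, a.SameCycle ⟨v, i⟩ d := by
  simp only [cyclesThrough, Finset.mem_filter, Finset.mem_univ, true_and]
  constructor
  · rintro ⟨⟨u, i⟩, h1, h2⟩
    obtain rfl : u = v := mem_fiber.1 h1
    exact ⟨i, h2⟩
  · rintro ⟨i, h⟩
    exact ⟨⟨v, i⟩, mem_fiber.2 rfl, h⟩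

variable {v : V}

/-- The inclusion of the darts that remain when the vertex `v` is deleted. -/
def inclDart (e : ∀ w : {u // u ≠ v}, κ w) (d : Σ w : {u // u ≠ v}, {i : κ w // i ≠ e w}) :
    Σ u, κ u := ⟨d.1.1, d.2.1⟩

omit [Fintype V] [∀ u, Fintype (κ u)] in
theorem inclDart_injective (e : ∀ w : {u // u ≠ v}, κ w) : Function.Injective (inclDart e) := by
  rintro ⟨⟨w, hw⟩, i, hi⟩ ⟨⟨w', hw'⟩, j, hj⟩ h
  simp only [inclDart, Sigma.mk.injEq] at h
  obtain ⟨rfl, h⟩ := h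
  obtain rfl := eq_of_heq h
  rfl

/-- The rotations of all vertices, obtained from a rotation of `v` and the rotations of the
remaining darts by inserting the dart `e w` after the dart `x w`. -/
noncomputable def insertRotation (e : ∀ w : {u // u ≠ v}, κ w) (z : Equiv.Perm (κ v))
    (ζ : ∀ w : {u // u ≠ v}, Equiv.Perm {i : κ w // i ≠ e w})
    (x : ∀ w : {u // u ≠ v}, {i : κ w // i ≠ e w}) :
    ∀ u, Equiv.Perm (κ u) :=
  (Equiv.piSplitAt v fun u => Equiv.Perm (κ u)).symm (z, fun w => insertAt (e w) (ζ w) (x w))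

section

variable (e : ∀ w : {u // u ≠ v}, κ w) (z : Equiv.Perm (κ v))
  (ζ : ∀ w : {u // u ≠ v}, Equiv.Perm {i : κ w // i ≠ e w})
    (x : ∀ w : {u // u ≠ v}, {i : κ w // i ≠ e w})

omit [Fintype V] [∀ u, Fintype (κ u)] in
theorem insertRotation_self : insertRotation e z ζ x v = z := by
  simp [insertRotation, Equiv.piSplitAt]

omit [Fintype V] [∀ u, Fintype (κ u)] in
theorem insertRotation_coe (w : {u // u ≠ v}) :
    insertRotation e z ζ x w = insertAt (e w) (ζ w) (x w) := by
  simp [insertRotation, Equiv.piSplitAt, w.2]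

omit [Fintype V] [∀ u, Fintype (κ u)] in
theorem update_insertRotation (z' : Equiv.Perm (κ v)) :
    Function.update (insertRotation e z ζ x) v z' = insertRotation e z' ζ x := by
  ext1 u
  by_cases hu : u = v
  · subst hu
    rw [Function.update_self, insertRotation_self]
  · rw [Function.update_of_ne hu, insertRotation_coe _ _ _ _ ⟨u, hu⟩,
      insertRotation_coe _ _ _ _ ⟨u, hu⟩]

/-- In probabilistic terms, a uniform rotation system amounts to independent uniform choices of the
rotation `z` at `v`, the rotations `ζ` of the smaller map, and the insertion places `x`. -/
theorem sum_rotations_insertRotation [∀ w : {u // u ≠ v}, Nonempty {i : κ w // i ≠ e w}] {M : Type*}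
    [AddCommMonoid M] (F : (∀ u, Equiv.Perm (κ u)) → M) :
    ∑ ρ ∈ rotations κ, F ρ = ∑ z ∈ fullCycles (κ v),
      ∑ ζ ∈ rotations fun w : {u // u ≠ v} => {i : κ w // i ≠ e w},
        ∑ x ∈ transversals fun w : {u // u ≠ v} => {i : κ w // i ≠ e w},
        F (insertRotation e z ζ x) := by
  have h1 : ∑ ρ ∈ rotations κ, F ρ = ∑ z ∈ fullCycles (κ v),
      ∑ ζ ∈ rotations fun w : {u // u ≠ v} => κ w,
        F ((Equiv.piSplitAt v fun u => Equiv.Perm (κ u)).symm (z, ζ)) := by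
    rw [← Finset.sum_product']
    symm
    refine Finset.sum_nbij' (fun p => (Equiv.piSplitAt v fun u => Equiv.Perm (κ u)).symm p)
      (fun ρ => Equiv.piSplitAt v (fun u => Equiv.Perm (κ u)) ρ) ?_ ?_ ?_ ?_ ?_
    · intro p hp
      obtain ⟨h1, h2⟩ := Finset.mem_product.1 hp
      rw [mem_rotations] at h2
      refine mem_rotations.2 fun u => ?_
      by_cases hu : u = v
      · subst hu; simpa [Equiv.piSplitAt] using h1
      · simpa [Equiv.piSplitAt, hu] using h2 ⟨u, hu⟩
    · intro ρ hρ
      rw [mem_rotations] at hρ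
      exact Finset.mem_product.2 ⟨hρ v, mem_rotations.2 fun w => hρ w⟩
    · intro p _; simp
    · intro ρ _; exact Equiv.symm_apply_apply _ _
    · intro p _; rfl
  rw [h1]
  refine Finset.sum_congr rfl fun z _ => ?_
  exact sum_rotations_bijOn (fun w => insertAt (e w)) (fun w => bijOn_insertAt (e w))
    (fun ζ => F ((Equiv.piSplitAt v fun u => Equiv.Perm (κ u)).symm (z, ζ)))

omit [Fintype V] [∀ u, Fintype (κ u)] in
theorem glue_insertRotation_incl {d : Σ w : {u // u ≠ v}, {i : κ w // i ≠ e w}}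
    (hd : d.2 ≠ x d.1) :
    glue (insertRotation e z ζ x) (inclDart e d) = inclDart e (glue ζ d) := by
  obtain ⟨w, i⟩ := d
  change (⟨w, insertRotation e z ζ x w i⟩ : Σ u, κ u) = ⟨w, ζ w i⟩
  rw [insertRotation_coe, insertAt_coe_of_ne _ _ hd]

omit [Fintype V] [∀ u, Fintype (κ u)] in
theorem glue_insertRotation_coe_self (w : {u // u ≠ v}) :
    glue (insertRotation e z ζ x) (inclDart e ⟨w, x w⟩) = ⟨w, e w⟩ := by
  change (⟨w, insertRotation e z ζ x w (x w)⟩ : Σ u, κ u) = ⟨w, e w⟩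
  rw [insertRotation_coe, insertAt_coe_self]

omit [Fintype V] [∀ u, Fintype (κ u)] in
theorem glue_insertRotation_self (w : {u // u ≠ v}) :
    glue (insertRotation e z ζ x) ⟨w, e w⟩ = inclDart e (glue ζ ⟨w, x w⟩) := by
  change (⟨w, insertRotation e z ζ x w (e w)⟩ : Σ u, κ u) = ⟨w, ζ w (x w)⟩
  rw [insertRotation_coe, insertAt_self]

variable {E : Equiv.Perm (Σ u, κ u)}

omit [Fintype V] [∀ u, Fintype (κ u)] in
-- The only dart at `w` leading to `v` is `e w`, so `E` preserves the set of darts that are neither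
-- at `v` nor lead to `v`.
theorem exists_restrict_involution (hinv : ∀ d, E (E d) = d)
    (hE : ∀ d d' : Σ u, κ u, d.1 = d'.1 → (E d).1 = (E d').1 → d = d')
    (he : ∀ w : {u // u ≠ v}, (E ⟨w, e w⟩).1 = v) :
    ∃ E₀ : Equiv.Perm (Σ w : {u // u ≠ v}, {i : κ w // i ≠ e w}),
      ∀ d, inclDart e (E₀ d) = E (inclDart e d) := by
  have hv : ∀ d, (E (inclDart e d)).1 ≠ v := by
    rintro ⟨w, i, hi⟩ h
    have := hE (⟨w, i⟩ : Σ u, κ u) ⟨w, e w⟩ rfl (h.trans (he w).symm)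
    exact hi (by simpa using this)
  have hne : ∀ d, (E (inclDart e d)).2 ≠ e ⟨(E (inclDart e d)).1, hv d⟩ := by
    intro d h
    have h1 : E (inclDart e d) = ⟨(E (inclDart e d)).1, e ⟨(E (inclDart e d)).1, hv d⟩⟩ := by
      rw [← h]
    have h2 := congrArg E h1
    rw [hinv] at h2
    have h3 := he ⟨(E (inclDart e d)).1, hv d⟩
    rw [← h2] at h3
    exact d.1.2 h3
  have hf : ∃ f : (Σ w : {u // u ≠ v}, {i : κ w // i ≠ e w}) →
      Σ w : {u // u ≠ v}, {i : κ w // i ≠ e w}, ∀ d, inclDart e (f d) = E (inclDart e d) :=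
    ⟨fun d => ⟨⟨_, hv d⟩, ⟨_, hne d⟩⟩, fun d => rfl⟩
  obtain ⟨f, hf⟩ := hf
  refine ⟨Function.Involutive.toPerm f fun d => inclDart_injective e ?_, hf⟩
  rw [hf, hf, hinv]

variable {E₀ : Equiv.Perm (Σ w : {u // u ≠ v}, {i : κ w // i ≠ e w})}

/-- The dart `e w` is the image of a dart at `v`, and `x w` is mapped to a dart at `v`. A face that
misses `v` therefore contains no `e w` and no `x w`, and it is unchanged by the deletion of `v`. -/
theorem exists_incl_of_notMem_cyclesThrough (hinv : ∀ d, E (E d) = d)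
    (he : ∀ w : {u // u ≠ v}, (E ⟨w, e w⟩).1 = v)
    (hE₀ : ∀ d, inclDart e (E₀ d) = E (inclDart e d)) {d : Σ u, κ u}
    (hd : d ∉ cyclesThrough (E * glue (insertRotation e z ζ x)) v) :
    ∃ d₀, inclDart e d₀ = d ∧ ∀ w, ¬ (E₀ * glue ζ).SameCycle d₀ ⟨w, x w⟩ := by
  set a := E * glue (insertRotation e z ζ x) with ha
  have hbase : ∀ d : Σ u, κ u, d.1 = v → d ∈ cyclesThrough a v := by
    rintro ⟨u, i⟩ h
    obtain rfl : u = v := h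
    exact mem_cyclesThrough.2 ⟨i, Equiv.Perm.SameCycle.refl _ _⟩
  have hstep : ∀ d, a d ∈ cyclesThrough a v ↔ d ∈ cyclesThrough a v := by
    intro d
    simp only [mem_cyclesThrough, Equiv.Perm.sameCycle_apply_right]
  have he' : ∀ w : {u // u ≠ v}, (⟨w, e w⟩ : Σ u, κ u) ∈ cyclesThrough a v := by
    intro w
    have h1 : (⟨w, e w⟩ : Σ u, κ u) = a ((glue (insertRotation e z ζ x)).symm (E ⟨w, e w⟩)) := by
      rw [ha, Equiv.Perm.mul_apply, Equiv.apply_symm_apply, hinv]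
    rw [h1, hstep]
    refine hbase _ ?_
    have h2 : ∀ d : Σ u, κ u, ((glue (insertRotation e z ζ x)).symm d).1 = d.1 := fun d => rfl
    rw [h2, he]
  obtain ⟨u, i⟩ := d
  have hu : u ≠ v := fun h => hd (hbase _ h)
  have hi : i ≠ e ⟨u, hu⟩ := fun h => hd (h ▸ he' ⟨u, hu⟩)
  refine ⟨⟨⟨u, hu⟩, ⟨i, hi⟩⟩, rfl, fun w hw => ?_⟩
  have hx : ∀ w, inclDart e ⟨w, x w⟩ ∈ cyclesThrough a v := by
    intro w
    rw [← hstep, ha, Equiv.Perm.mul_apply, glue_insertRotation_coe_self]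
    exact hbase _ (he w)
  refine hw.mem_of_forward_invariant (C := {d₀ | inclDart e d₀ ∉ cyclesThrough a v}) ?_ hd (hx w)
  intro d₀ hd₀
  have h3 : d₀.2 ≠ x d₀.1 := by
    intro h
    refine hd₀ ?_
    rw [show d₀ = ⟨d₀.1, x d₀.1⟩ by rw [← h]]
    exact hx _
  rw [Set.mem_ofPred_eq, Equiv.Perm.mul_apply, hE₀, ← glue_insertRotation_incl e z ζ x h3,
    ← Equiv.Perm.mul_apply, ← ha, hstep]
  exact hd₀

/-- With the identity at `v`, the face leaves `v` at `i` through `e u` and follows the face of the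
smaller map after `x u`. On meeting any `x w` it goes to the dart at `v` matched with `e w`. If `i`
is fixed, the only such return is to `i` itself, which forces `w = u`. -/
theorem alone_of_outerPerm_fixed (hinv : ∀ d, E (E d) = d)
    (hE : ∀ d d' : Σ u, κ u, d.1 = d'.1 → (E d).1 = (E d').1 → d = d')
    (he : ∀ w : {u // u ≠ v}, (E ⟨w, e w⟩).1 = v)
    (hE₀ : ∀ d, inclDart e (E₀ d) = E (inclDart e d)) {i : κ v} {u : {u // u ≠ v}}
    (hu : (E ⟨v, i⟩).1 = u) (hi : outerPerm E (insertRotation e z ζ x) v i = i) :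
    ∀ w, w ≠ u → ¬ (E₀ * glue ζ).SameCycle ⟨u, x u⟩ ⟨w, x w⟩ := by
  set b := E * glue (insertRotation e 1 ζ x) with hb
  have hfix : ∀ y : Σ u, κ u, y.1 = v → b.SameCycle ⟨v, i⟩ y → y = ⟨v, i⟩ := by
    intro y hy h
    have h1 : inducedPerm b (fiber κ v) (fiberEquiv κ v i) = fiberEquiv κ v i := by
      rw [outerPerm, update_insertRotation, ← hb, Equiv.permCongr_apply, Equiv.symm_symm,
        Equiv.symm_apply_eq] at hi
      exact hi
    have h2 := (sameCycle_inducedPerm b (fiber κ v) (fiberEquiv κ v i) ⟨y, mem_fiber.2 hy⟩).2 h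
    have h3 := h2.eq_of_left h1
    exact (congrArg Subtype.val h3).symm
  have hui : E ⟨v, i⟩ = ⟨u, e u⟩ := by
    refine hE _ _ hu ?_
    rw [hinv, he]
  have hb1 : b ⟨v, i⟩ = ⟨u, e u⟩ := by
    rw [hb, Equiv.Perm.mul_apply, ← hui]
    simp [insertRotation_self]
  have hb2 : b ⟨u, e u⟩ = inclDart e ((E₀ * glue ζ) ⟨u, x u⟩) := by
    rw [hb, Equiv.Perm.mul_apply, glue_insertRotation_self, Equiv.Perm.mul_apply, hE₀]
  have hmem : b.SameCycle ⟨v, i⟩ (inclDart e ((E₀ * glue ζ) ⟨u, x u⟩)) := by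
    rw [← hb2, ← hb1, Equiv.Perm.sameCycle_apply_right, Equiv.Perm.sameCycle_apply_right]
  have hxw : ∀ w, b.SameCycle ⟨v, i⟩ (inclDart e ⟨w, x w⟩) → w = u := by
    intro w hw
    have h1 : b (inclDart e ⟨w, x w⟩) = E ⟨w, e w⟩ := by
      rw [hb, Equiv.Perm.mul_apply, glue_insertRotation_coe_self]
    rw [← Equiv.Perm.sameCycle_apply_right, h1] at hw
    have h2 := hfix _ (he w) hw
    have h3 := congrArg E h2
    rw [hinv, hui] at h3
    exact Subtype.ext (congrArg Sigma.fst h3)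
  intro w hw hsc
  refine hw (hxw w ?_)
  refine (Equiv.Perm.sameCycle_apply_left.2 hsc).mem_of_forward_invariant
    (C := {d₀ | b.SameCycle ⟨v, i⟩ (inclDart e d₀)}) ?_ hmem
  intro d₀ hd₀
  by_cases h : d₀.2 = x d₀.1
  · have h0 : d₀ = ⟨d₀.1, x d₀.1⟩ := by rw [← h]
    rw [h0] at hd₀ ⊢
    rw [hxw _ hd₀]
    exact hmem
  · rw [Set.mem_ofPred_eq, Equiv.Perm.mul_apply, hE₀, ← glue_insertRotation_incl e 1 ζ x h,
      ← Equiv.Perm.mul_apply, ← hb, Equiv.Perm.sameCycle_apply_right]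
    exact hd₀

/-- It suffices to average over the insertion places for fixed `z` and `ζ`; the average over `ζ` is
then the estimate for long faces in the smaller map. -/
theorem sum_rotations_le_of_forall_insertRotation
    (hE : ∀ d d' : Σ u, κ u, d.1 = d'.1 → (E d).1 = (E d').1 → d = d')
    (hE₀ : ∀ d, inclDart e (E₀ d) = E (inclDart e d)) {M r : ℕ}
    (hM : ∀ w : {u // u ≠ v}, Fintype.card {i : κ w // i ≠ e w} = M)
    (hr : 2 ≤ r) (hrM : r ^ 4 ≤ M) (hMr : M ≤ 16 * r ^ 4) (G : (∀ u, Equiv.Perm (κ u)) → ℝ)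
    (hG : ∀ z ζ, ∑ x ∈ transversals fun w : {u // u ≠ v} => {i : κ w // i ≠ e w},
        G (insertRotation e z ζ x)
      ≤ (transversals fun w : {u // u ≠ v} => {i : κ w // i ≠ e w}).card
        * ∑ d, min 1 ((M : ℝ) / cycleLength (E₀ * glue ζ) d)) :
    ∑ ρ ∈ rotations κ, G ρ ≤ (rotations κ).card
      * Fintype.card (Σ w : {u // u ≠ v}, {i : κ w // i ≠ e w}) * (20 / r) := by
  have hM0 : 0 < M := lt_of_lt_of_le (by positivity) hrM
  have hne : ∀ w : {u // u ≠ v}, Nonempty {i : κ w // i ≠ e w} := fun w =>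
    Fintype.card_pos_iff.1 (by rw [hM]; exact hM0)
  have hE₀' : ∀ d d' : Σ w : {u // u ≠ v}, {i : κ w // i ≠ e w},
      d.1 = d'.1 → (E₀ d).1 = (E₀ d').1 → d = d' := by
    intro d d' h1 h2
    refine inclDart_injective e (hE _ _ (congrArg Subtype.val h1) ?_)
    rw [← hE₀, ← hE₀]
    exact congrArg Subtype.val h2
  have hcard := sum_rotations_insertRotation e (fun _ => (1 : ℝ))
  simp only [Finset.sum_const, nsmul_eq_mul, mul_one] at hcard
  rw [sum_rotations_insertRotation e, hcard]
  calc _ ≤ ∑ z ∈ fullCycles (κ v), ∑ ζ ∈ rotations fun w : {u // u ≠ v} => {i : κ w // i ≠ e w},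
        ((transversals fun w : {u // u ≠ v} => {i : κ w // i ≠ e w}).card : ℝ)
          * ∑ d, min 1 ((M : ℝ) / cycleLength (E₀ * glue ζ) d) :=
        Finset.sum_le_sum fun z _ => Finset.sum_le_sum fun ζ _ => hG z ζ
    _ = (fullCycles (κ v)).card * (transversals fun w : {u // u ≠ v} => {i : κ w // i ≠ e w}).card
        * ∑ ζ ∈ rotations fun w : {u // u ≠ v} => {i : κ w // i ≠ e w},
          ∑ d, min 1 ((M : ℝ) / cycleLength (E₀ * glue ζ) d) := by
        rw [Finset.sum_const, nsmul_eq_mul, ← Finset.mul_sum, mul_assoc]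
    _ ≤ _ := mul_le_mul_of_nonneg_left (sum_rotations_min_le E₀ hE₀' hM hr hrM hMr)
        (by positivity)
    _ = _ := by ring

end

omit [Fintype V] [∀ u, Fintype (κ u)] in
theorem exists_darts_towards {E : Equiv.Perm (Σ u, κ u)}
    (hex : ∀ u, u ≠ v → ∃ d : Σ u, κ u, d.1 = u ∧ (E d).1 = v) :
    ∃ e : ∀ w : {u // u ≠ v}, κ w, ∀ w : {u // u ≠ v}, (E ⟨w, e w⟩).1 = v := by
  have : ∀ w : {u // u ≠ v}, ∃ i : κ w, (E ⟨w, i⟩).1 = v := by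
    rintro ⟨w, hw⟩
    obtain ⟨⟨u, i⟩, rfl, h⟩ := hex w hw
    exact ⟨i, h⟩
  choose e he using this
  exact ⟨e, he⟩

theorem card_subtype_ne_eq {X : Type*} [Fintype X] (e : X) {M : ℕ}
    (hM : Fintype.card X = M + 1) : Fintype.card {i // i ≠ e} = M := by
  rw [Fintype.card_subtype_compl, Fintype.card_subtype_eq, hM, Nat.add_sub_cancel]

variable {E : Equiv.Perm (Σ u, κ u)} {M r : ℕ}

/-- Only few darts lie outside the faces at a given vertex. -/
theorem sum_rotations_card_compl_cyclesThrough_le (hinv : ∀ d, E (E d) = d)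
    (hE : ∀ d d' : Σ u, κ u, d.1 = d'.1 → (E d).1 = (E d').1 → d = d')
    (hex : ∀ u, u ≠ v → ∃ d : Σ u, κ u, d.1 = u ∧ (E d).1 = v)
    (hM : ∀ u, Fintype.card (κ u) = M + 1)
    (hr : 2 ≤ r) (hrM : r ^ 4 ≤ M) (hMr : M ≤ 16 * r ^ 4) :
    ∑ ρ ∈ rotations κ, ((Fintype.card (Σ u, κ u) : ℝ) - (cyclesThrough (E * glue ρ) v).card)
      ≤ (rotations κ).card * Fintype.card (Σ u, κ u) * (20 / r) := by
  obtain ⟨e, he⟩ := exists_darts_towards hex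
  obtain ⟨E₀, hE₀⟩ := exists_restrict_involution e hinv hE he
  have hM' : ∀ w : {u // u ≠ v}, Fintype.card {i : κ w // i ≠ e w} = M := fun w =>
    card_subtype_ne_eq (e w) (hM w)
  refine (sum_rotations_le_of_forall_insertRotation e hE hE₀ hM' hr hrM hMr _ fun z ζ => ?_).trans
    ?_
  · refine le_trans (Finset.sum_le_sum fun x _ => ?_) (sum_card_avoiding_le (E₀ * glue ζ) hM')
    rw [← Nat.cast_sub (Finset.card_le_univ _), ← Finset.card_compl]
    refine Nat.cast_le.2 (le_trans (Finset.card_le_card (t := (avoiding (E₀ * glue ζ) x).image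
      (inclDart e)) ?_) Finset.card_image_le)
    intro d hd
    obtain ⟨d₀, rfl, h⟩ := exists_incl_of_notMem_cyclesThrough e z ζ x hinv he hE₀
      (Finset.mem_compl.1 hd)
    exact Finset.mem_image_of_mem _ (mem_avoiding.2 h)
  · gcongr
    exact Fintype.card_le_of_injective _ (inclDart_injective e)

/-- The permutation of the darts at a vertex that comes from the rest of the graph has few fixed
points. -/
theorem sum_rotations_numFixed_outerPerm_le (hinv : ∀ d, E (E d) = d)
    (hE : ∀ d d' : Σ u, κ u, d.1 = d'.1 → (E d).1 = (E d').1 → d = d')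
    (hloop : ∀ d, (E d).1 ≠ d.1)
    (hex : ∀ u, u ≠ v → ∃ d : Σ u, κ u, d.1 = u ∧ (E d).1 = v)
    (hM : ∀ u, Fintype.card (κ u) = M + 1)
    (hr : 2 ≤ r) (hrM : r ^ 4 ≤ M) (hMr : M ≤ 16 * r ^ 4) :
    ∑ ρ ∈ rotations κ, (numFixed (outerPerm E ρ v) : ℝ)
      ≤ (rotations κ).card * (Fintype.card V - 1 : ℕ) * (20 / r) := by
  obtain ⟨e, he⟩ := exists_darts_towards hex
  obtain ⟨E₀, hE₀⟩ := exists_restrict_involution e hinv hE he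
  have hM' : ∀ w : {u // u ≠ v}, Fintype.card {i : κ w // i ≠ e w} = M := fun w =>
    card_subtype_ne_eq (e w) (hM w)
  have hM0 : (0 : ℝ) < M := by exact_mod_cast lt_of_lt_of_le (by positivity) hrM
  have hcard : Fintype.card (Σ w : {u // u ≠ v}, {i : κ w // i ≠ e w})
      = (Fintype.card V - 1) * M := by
    rw [Fintype.card_sigma, Finset.sum_congr rfl fun w _ => hM' w, Finset.sum_const,
      Finset.card_univ, smul_eq_mul, Fintype.card_subtype_compl, Fintype.card_subtype_eq]
  have key := sum_rotations_le_of_forall_insertRotation e hE hE₀ hM' hr hrM hMr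
    (fun ρ => (numFixed (outerPerm E ρ v) : ℝ) * M) fun z ζ => ?_
  · rw [← Finset.sum_mul, hcard, Nat.cast_mul] at key
    refine le_of_mul_le_mul_right (key.trans_eq ?_) hM0
    ring
  · rw [← Finset.sum_mul]
    refine le_trans (mul_le_mul_of_nonneg_right (Finset.sum_le_sum fun x _ => ?_) hM0.le)
      (sum_card_isolated_le (E₀ * glue ζ) hM')
    -- A fixed dart is sent to the vertex it leads to, which is injective because a vertex has at
    -- most one dart towards each neighbour.
    refine Nat.cast_le.2 (Finset.card_le_card_of_injOn (fun i => ⟨(E ⟨v, i⟩).1, hloop _⟩) ?_ ?_)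
    · intro i hi
      exact Finset.mem_coe.2 (mem_isolated.2 (alone_of_outerPerm_fixed e z ζ x hinv hE he hE₀
        rfl (Finset.mem_filter.1 hi).2))
    · intro i _ j _ h
      have h1 := hE ⟨v, i⟩ ⟨v, j⟩ rfl (congrArg Subtype.val h)
      simpa using h1

end InsertVertex

/-! ### Embeddings of complete graphs -/

section Embeddings

variable {V : Type*} [Fintype V]

omit [Fintype V] in
theorem glue_zpow {κ : V → Type*} (ρ : ∀ u, Equiv.Perm (κ u)) (k : ℤ) :
    glue ρ ^ k = glue (ρ ^ k) := (map_zpow (Equiv.Perm.sigmaCongrRightHom κ) ρ k).symm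

omit [Fintype V] in
theorem sameCycle_glue {κ : V → Type*} (ρ : ∀ u, Equiv.Perm (κ u)) (u : V) (i j : κ u) :
    (glue ρ).SameCycle ⟨u, i⟩ ⟨u, j⟩ ↔ (ρ u).SameCycle i j := by
  refine exists_congr fun k => ?_
  rw [glue_zpow]
  change (⟨u, (ρ u ^ k) i⟩ : Σ u, κ u) = ⟨u, j⟩ ↔ _
  simp

omit [Fintype V] in
theorem exists_glue_eq {κ : V → Type*} [∀ u, Fintype (κ u)] (R : Equiv.Perm (Σ u, κ u))
    (hR : ∀ d, (R d).1 = d.1) : ∃ ρ : ∀ u, Equiv.Perm (κ u), glue ρ = R := by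
  have h : ∀ u (i : κ u), ∃ j : κ u, R ⟨u, i⟩ = ⟨u, j⟩ := by
    intro u i
    have := hR ⟨u, i⟩
    rcases h : R ⟨u, i⟩ with ⟨w, j⟩
    rw [h] at this
    obtain rfl : w = u := this
    exact ⟨j, rfl⟩
  choose f hf using h
  have hinj : ∀ u, Function.Injective (f u) := by
    intro u i j hij
    have := R.injective ((hf u i).trans (hij ▸ (hf u j).symm))
    simpa using this
  refine ⟨fun u => Equiv.ofBijective (f u) (Finite.injective_iff_bijective.1 (hinj u)), ?_⟩
  ext1 ⟨u, i⟩
  exact (hf u i).symm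

variable (G : SimpleGraph V)

theorem mem_dartsAt {u : V} {d : DartSet G} : d ∈ dartsAt G u ↔ d.1 = u := by simp [dartsAt]

theorem dartsAt_eq_fiber (u : V) : dartsAt G u = fiber (fun u => Fin (G.degree u)) u := by
  ext d
  rw [mem_dartsAt, mem_fiber]

theorem isLocalRotation_iff (R : Equiv.Perm (DartSet G)) :
    IsLocalRotation G R ↔ ∃ ρ ∈ rotations fun u => Fin (G.degree u), glue ρ = R := by
  constructor
  · intro h
    have h1 : ∀ d, (R d).1 = d.1 := fun d => (mem_dartsAt G).1
      ((h d.1).1.mapsTo (Finset.mem_coe.2 ((mem_dartsAt G).2 rfl)))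
    obtain ⟨ρ, rfl⟩ := exists_glue_eq R h1
    refine ⟨ρ, mem_rotations.2 fun u => mem_fullCycles.2 fun i j => ?_, rfl⟩
    rw [← sameCycle_glue]
    exact (h u).2 (Finset.mem_coe.2 ((mem_dartsAt G).2 rfl))
      (Finset.mem_coe.2 ((mem_dartsAt G).2 rfl))
  · rintro ⟨ρ, hρ, rfl⟩ u
    constructor
    · refine Equiv.bijOn' _ (fun d hd => ?_) fun d hd => ?_
      · have h1 : d.1 = u := (mem_dartsAt G).1 (Finset.mem_coe.1 hd)
        exact Finset.mem_coe.2 ((mem_dartsAt G).2 h1)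
      · have h1 : d.1 = u := (mem_dartsAt G).1 (Finset.mem_coe.1 hd)
        exact Finset.mem_coe.2 ((mem_dartsAt G).2 h1)
    · rintro ⟨w, i⟩ hi ⟨w', j⟩ hj
      obtain rfl : w = u := (mem_dartsAt G).1 hi
      obtain rfl : w' = w := (mem_dartsAt G).1 hj
      rw [sameCycle_glue]
      exact mem_fullCycles.1 (mem_rotations.1 hρ _) i j

/-- The edge schemes, as a finset. -/
noncomputable def edgeSchemes : Finset (Equiv.Perm (DartSet G)) :=
  Finset.univ.filter fun E => IsEdgeScheme G E

theorem mem_edgeSchemes {E : Equiv.Perm (DartSet G)} : E ∈ edgeSchemes G ↔ IsEdgeScheme G E := by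
  simp [edgeSchemes]

/-- A uniform embedding consists of a uniform edge scheme and independent uniform full cycles at the
vertices. -/
theorem sum_embeddings {M : Type*} [AddCommMonoid M]
    (F : Equiv.Perm (DartSet G) × Equiv.Perm (DartSet G) → M) :
    ∑ m ∈ embeddings G, F m
      = ∑ E ∈ edgeSchemes G, ∑ ρ ∈ rotations fun u => Fin (G.degree u), F (glue ρ, E) := by
  rw [← Finset.sum_product']
  symm
  refine Finset.sum_nbij (fun p => (glue p.2, p.1)) ?_ ?_ ?_ (fun _ _ => rfl)
  · intro p hp
    obtain ⟨h1, h2⟩ := Finset.mem_product.1 hp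
    exact Finset.mem_filter.2 ⟨Finset.mem_univ _, (isLocalRotation_iff G _).2 ⟨p.2, h2, rfl⟩,
      (mem_edgeSchemes G).1 h1⟩
  · intro p _ q _ h
    obtain ⟨h1, h2⟩ := Prod.mk.inj h
    refine Prod.ext h2 (Equiv.Perm.sigmaCongrRightHom_injective h1)
  · rintro ⟨R, E⟩ h
    obtain ⟨h1, h2⟩ := (Finset.mem_filter.1 (Finset.mem_coe.1 h)).2
    obtain ⟨ρ, hρ, h3⟩ := (isLocalRotation_iff G _).1 h1
    exact ⟨(E, ρ), Finset.mem_coe.2 (Finset.mem_product.2 ⟨(mem_edgeSchemes G).2 h2, hρ⟩),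
      Prod.ext h3 rfl⟩

theorem card_embeddings : (embeddings G).card
    = (edgeSchemes G).card * (rotations fun u => Fin (G.degree u)).card := by
  rw [Finset.card_eq_sum_ones, sum_embeddings]
  simp

end Embeddings

/-! ### Edge schemes of complete graphs -/

section Complete

variable {V : Type*} [Fintype V] {G : SimpleGraph V} (hG : G = ⊤)
include hG

theorem degree_of_eq_top (u : V) : G.degree u = Fintype.card V - 1 := by
  subst hG
  convert SimpleGraph.complete_graph_degree u

theorem card_dartSet_of_eq_top :
    Fintype.card (DartSet G) = Fintype.card V * (Fintype.card V - 1) := by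
  rw [Fintype.card_sigma, Finset.sum_congr rfl fun u _ => by
    rw [Fintype.card_fin, degree_of_eq_top hG]]
  simp

variable {E : Equiv.Perm (DartSet G)} (hE : IsEdgeScheme G E)
include hE

theorem IsEdgeScheme.exists_dart {u w : V} (h : u ≠ w) :
    ∃ d : DartSet G, d.1 = u ∧ (E d).1 = w :=
  (hE.2.2 u w (by rw [hG]; exact h)).exists

/-- Pigeonhole: the n - 1 darts at a vertex are used up by the n - 1 other vertices, so none is left
for a loop. -/
theorem IsEdgeScheme.fst_apply_ne (d : DartSet G) : (E d).1 ≠ d.1 := by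
  obtain ⟨u, i⟩ := d
  have h : ∀ w : {w // w ≠ u}, ∃ j : Fin (G.degree u), (E ⟨u, j⟩).1 = w := by
    rintro ⟨w, hw⟩
    obtain ⟨⟨u', j⟩, rfl, h⟩ := hE.exists_dart hG hw.symm
    exact ⟨j, h⟩
  choose f hf using h
  have hinj : Function.Injective f := by
    intro w w' hw
    refine Subtype.ext ?_
    rw [← hf, ← hf, hw]
  have hcard : Fintype.card {w // w ≠ u} = Fintype.card (Fin (G.degree u)) := by
    rw [Fintype.card_subtype_compl, Fintype.card_subtype_eq, Fintype.card_fin,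
      degree_of_eq_top hG]
  obtain ⟨w, rfl⟩ := ((Fintype.bijective_iff_injective_and_card f).2 ⟨hinj, hcard⟩).2 i
  rw [hf]
  exact w.2

theorem IsEdgeScheme.eq_of_fst_eq {d d' : DartSet G} (h : d.1 = d'.1) (h' : (E d).1 = (E d').1) :
    d = d' := by
  have hadj : ∀ u w, u ≠ w → G.Adj u w := fun u w h => by rw [hG]; exact h
  exact (hE.2.2 d.1 (E d).1 (hadj _ _ (hE.fst_apply_ne hG d).symm)).unique ⟨rfl, rfl⟩ ⟨h.symm, h'.symm⟩

omit hE in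
-- Label the darts at each `u` by the other vertices and match the dart at `u` labelled `w` with the
-- dart at `w` labelled `u`.
theorem edgeSchemes_nonempty : (edgeSchemes G).Nonempty := by
  have hcard : ∀ u, Fintype.card (Fin (G.degree u)) = Fintype.card {w // w ≠ u} := fun u => by
    rw [Fintype.card_subtype_compl, Fintype.card_subtype_eq, Fintype.card_fin,
      degree_of_eq_top hG]
  have e : ∀ u, Fin (G.degree u) ≃ {w // w ≠ u} := fun u => Fintype.equivOfCardEq (hcard u)
  set f : DartSet G → DartSet G := fun d =>
    ⟨(e d.1 d.2).1, (e _).symm ⟨d.1, (e d.1 d.2).2.symm⟩⟩ with hf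
  have hinv : Function.Involutive f := by
    have key : ∀ u w (h : w ≠ u), f ⟨u, (e u).symm ⟨w, h⟩⟩ = ⟨w, (e w).symm ⟨u, h.symm⟩⟩ := by
      intro u w h
      have h1 : e u ((e u).symm ⟨w, h⟩) = ⟨w, h⟩ := Equiv.apply_symm_apply _ _
      simp only [hf]
      generalize e u ((e u).symm ⟨w, h⟩) = q at h1
      subst h1
      rfl
    rintro ⟨u, i⟩
    obtain ⟨⟨w, h⟩, rfl⟩ := (e u).symm.surjective i
    exact (congrArg f (key u w h)).trans (key w u h.symm)
  refine ⟨hinv.toPerm f, (mem_edgeSchemes G).2 ⟨fun d h => ?_, hinv, fun u w h => ?_⟩⟩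
  · exact (e d.1 d.2).2 (congrArg Sigma.fst h)
  · rw [hG] at h
    refine ⟨⟨u, (e u).symm ⟨w, Ne.symm h⟩⟩, ⟨rfl, ?_⟩, ?_⟩
    · change (e u ((e u).symm _)).1 = w
      rw [Equiv.apply_symm_apply]
    · rintro ⟨u', i⟩ ⟨rfl, h2⟩
      congr 1
      rw [Equiv.eq_symm_apply]
      exact Subtype.ext h2

end Complete

/-! ### Parity correction -/

section Parity

variable {X : Type*} [Fintype X]

theorem isOddPerm_iff (a : Equiv.Perm X) :
    IsOddPerm a ↔ Odd (Fintype.card X + numCycles a) := by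
  rw [IsOddPerm, sign_eq_neg_one_pow_numCycles, neg_one_pow_eq_neg_one_iff_odd (by decide)]

/-- Up to one element, a set can be chosen such that the induced permutation has a given parity. -/
theorem exists_subset_isOddPerm_iff [DecidableEq X] (a : Equiv.Perm X) {Y Z : Finset X}
    (hYZ : Y ⊆ Z)
    (hZ : ∀ z ∈ Z, ∃ y ∈ Y, a.SameCycle y z) :
    ∃ Y', Y ⊆ Y' ∧ Y' ⊆ Z ∧ (Z \ Y').card ≤ 1 ∧
      (IsOddPerm (inducedPerm a Y') ↔ IsOddPerm (inducedPerm a Y)) := by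
  -- The number of cycles is the same for `Y` and `Y'`, so the parities agree exactly when the sizes
  -- have the same parity.
  have key : ∀ Y', Y ⊆ Y' → Y' ⊆ Z → Even (Y'.card + Y.card) →
      (IsOddPerm (inducedPerm a Y') ↔ IsOddPerm (inducedPerm a Y)) := by
    intro Y' h1 h2 h3
    rw [isOddPerm_iff, isOddPerm_iff, numCycles_inducedPerm_eq a Y Y' h1 fun z hz => hZ z (h2 hz),
      Fintype.card_coe, Fintype.card_coe]
    grind
  by_cases h : Even (Z.card + Y.card)
  · exact ⟨Z, hYZ, subset_rfl, by simp, key Z hYZ subset_rfl h⟩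
  · obtain ⟨d, hd⟩ : (Z \ Y).Nonempty := by
      rw [Finset.sdiff_nonempty]
      intro h1
      rw [Finset.Subset.antisymm h1 hYZ] at h
      exact h ⟨_, rfl⟩
    obtain ⟨hdZ, hdY⟩ := Finset.mem_sdiff.1 hd
    have hsub : Y ⊆ Z.erase d := fun y hy =>
      Finset.mem_erase.2 ⟨fun h => hdY (h ▸ hy), hYZ hy⟩
    refine ⟨Z.erase d, hsub, Finset.erase_subset _ _, ?_, key _ hsub (Finset.erase_subset _ _) ?_⟩
    · rw [Finset.sdiff_erase_self hdZ, Finset.card_singleton]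
    · have := Finset.card_erase_add_one hdZ
      grind

end Parity

/-! ### The sign as a real number -/

section RealSign

variable {X : Type*} [Fintype X]

/-- The sign of a permutation as a real number. -/
noncomputable def realSign (b : Equiv.Perm X) : ℝ := ((Equiv.Perm.sign b : ℤ) : ℝ)

theorem sum_abs_cycleFreq_sub_realSign_le [Nonempty X] (b : Equiv.Perm X) (N : ℕ) :
    ∑ k ∈ Finset.range N, |cycleFreq b k - parityDist (Fintype.card X) (realSign b) k|
      ≤ (2 * hookConst + 8 * numFixed b) / Fintype.card X :=
  sum_abs_cycleFreq_sub_le_div b N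

theorem stirlingDist_eq_parityDist [Nonempty X] {a : Equiv.Perm X} (ha : a ∈ fullCycles X)
    (b : Equiv.Perm X) (k : ℕ) :
    stirlingDist (Fintype.card X) (if IsOddPerm (a * b) then 1 else 0) k
      = parityDist (Fintype.card X) (realSign b) k :=
  (parityDist_eq_stirlingDist ha b k).symm

end RealSign

/-! ### Averages over embeddings -/

section Averages

variable {V : Type*} [Fintype V] {G : SimpleGraph V}

theorem dartsOfFacesAt_eq (v : V) (ρ : ∀ u, Equiv.Perm (Fin (G.degree u)))
    (E : Equiv.Perm (DartSet G)) :
    dartsOfFacesAt v (glue ρ, E) = cyclesThrough (E * glue ρ) v := by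
  ext d
  simp only [dartsOfFacesAt, cyclesThrough, Finset.mem_filter, Finset.mem_univ, true_and,
    dartsAt_eq_fiber]
  rfl

theorem dartsAt_subset_dartsOfFacesAt (v : V)
    (m : Equiv.Perm (DartSet G) × Equiv.Perm (DartSet G)) :
    dartsAt G v ⊆ dartsOfFacesAt v m := fun d hd =>
  Finset.mem_filter.2 ⟨Finset.mem_univ _, d, hd, Equiv.Perm.SameCycle.refl _ _⟩

theorem exists_sameCycle_of_mem_dartsOfFacesAt {v : V}
    {m : Equiv.Perm (DartSet G) × Equiv.Perm (DartSet G)} {d : DartSet G}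
    (hd : d ∈ dartsOfFacesAt v m) : ∃ y ∈ dartsAt G v, (facePerm m).SameCycle y d :=
  (Finset.mem_filter.1 hd).2

theorem numCycles_localFacePerm (v : V) (ρ : ∀ u, Equiv.Perm (Fin (G.degree u)))
    (E : Equiv.Perm (DartSet G)) :
    numCycles (localFacePerm v (glue ρ, E)) = numCycles (outerPerm E ρ v * ρ v) := by
  rw [localFacePerm, facePerm, dartsAt_eq_fiber, inducedPerm_glue_eq, numCycles_permCongr]

theorem card_subtype_mem_dartsAt (v : V) :
    Fintype.card {d // d ∈ dartsAt G v} = G.degree v := by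
  rw [Fintype.card_congr (Equiv.subtypeEquivRight fun d => by rw [dartsAt_eq_fiber]),
    ← Fintype.card_congr (fiberEquiv (fun u => Fin (G.degree u)) v), Fintype.card_fin]

theorem isOddPerm_localFacePerm (v : V) (ρ : ∀ u, Equiv.Perm (Fin (G.degree u)))
    (E : Equiv.Perm (DartSet G)) :
    IsOddPerm (localFacePerm v (glue ρ, E)) ↔ IsOddPerm (ρ v * outerPerm E ρ v) := by
  rw [isOddPerm_iff, isOddPerm_iff, numCycles_localFacePerm, numCycles_mul_comm,
    card_subtype_mem_dartsAt, Fintype.card_fin]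

theorem embProb_eq (A : Equiv.Perm (DartSet G) × Equiv.Perm (DartSet G) → Prop) :
    embProb G A = (∑ m ∈ embeddings G, if A m then (1 : ℝ) else 0) / (embeddings G).card := by
  rw [embProb, Finset.card_filter]
  push_cast
  rfl

/-- The distribution is affine in `p`. Hence averaging the laws for the parities 0 and 1 gives the
law whose `p` is the probability of being odd. -/
theorem stirlingDist_average {ι : Type*} {s : Finset ι} (hs : s.Nonempty) (f : ι → ℝ) (n k : ℕ) :
    stirlingDist n ((∑ i ∈ s, f i) / s.card) k = (∑ i ∈ s, stirlingDist n (f i) k) / s.card := by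
  have h : (s.card : ℝ) ≠ 0 := by exact_mod_cast hs.card_pos.ne'
  simp only [stirlingDist]
  split_ifs
  · rw [← Finset.sum_mul]; ring
  · rw [← Finset.sum_mul, Finset.sum_sub_distrib, Finset.sum_const, nsmul_eq_mul, mul_one,
      sub_div' h]
    simp only [one_mul]
    ring

/-- Resample the rotation at `u`: the outer permutation stays fixed while the full cycle multiplying
it is uniform. -/
theorem sum_rotations_indicator_numCycles {W : Type*} [Fintype W] {α : W → Type*}
    [∀ w, Fintype (α w)] (E : Equiv.Perm (Σ w, α w)) (u : W) (k : ℕ) :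
    (∑ ρ ∈ rotations α, if numCycles (outerPerm E ρ u * ρ u) = k then (1 : ℝ) else 0)
      = ∑ ρ ∈ rotations α, cycleFreq (outerPerm E ρ u) k := by
  have hC : ((fullCycles (α u)).card : ℝ) ≠ 0 := by
    exact_mod_cast (card_fullCycles_pos (α u)).ne'
  have h := sum_piFinset_update (fun w => fullCycles (α w)) u
    (fun ρ => if numCycles (outerPerm E ρ u * ρ u) = k then (1 : ℝ) else 0)
  simp only [outerPerm_update, Function.update_self, nsmul_eq_mul] at h
  rw [rotations, ← mul_right_inj' hC, ← h, Finset.mul_sum]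
  refine Finset.sum_congr rfl fun ρ _ => ?_
  rw [cycleFreq, mul_div_cancel₀ _ hC, cycleSum]
  refine Finset.sum_congr rfl fun z _ => ?_
  rw [numCycles_mul_comm]

theorem embeddings_nonempty (hG : G = ⊤) : (embeddings G).Nonempty := by
  rw [← Finset.card_pos, card_embeddings]
  exact Nat.mul_pos (edgeSchemes_nonempty hG).card_pos card_rotations_pos

variable {n r : ℕ} (hG : G = ⊤) (hV : Fintype.card V = n + 1) (hr : 2 ≤ r) (hrn : r ^ 4 ≤ n - 1)
  (hnr : n - 1 ≤ 16 * r ^ 4) (v : V)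
include hG hV hr hrn hnr

theorem embExp_sub_card_dartsOfFacesAt_le :
    embExp G (fun m => (Fintype.card (DartSet G) : ℝ) - (dartsOfFacesAt v m).card)
      ≤ Fintype.card (DartSet G) * (20 / r) := by
  have hn : 1 ≤ n := by
    have : 0 < r ^ 4 := by positivity
    omega
  rw [embExp, div_le_iff₀ (by exact_mod_cast (embeddings_nonempty hG).card_pos), sum_embeddings,
    card_embeddings]
  simp only [dartsOfFacesAt_eq]
  refine (Finset.sum_le_sum fun E hE =>
    sum_rotations_card_compl_cyclesThrough_le (v := v) (M := n - 1) (r := r) ?_ ?_ ?_ ?_ hr hrn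
      hnr).trans_eq ?_
  · exact ((mem_edgeSchemes G).1 hE).2.1
  · exact fun d d' => ((mem_edgeSchemes G).1 hE).eq_of_fst_eq hG
  · exact fun u hu => ((mem_edgeSchemes G).1 hE).exists_dart hG hu
  · intro u
    rw [Fintype.card_fin, degree_of_eq_top hG, hV]
    omega
  · rw [Finset.sum_const, nsmul_eq_mul]
    push_cast
    ring

theorem sum_numFixed_outerPerm_le :
    ∑ E ∈ edgeSchemes G, ∑ ρ ∈ rotations (fun u => Fin (G.degree u)),
      (numFixed (outerPerm E ρ v) : ℝ) ≤ (embeddings G).card * n * (20 / r) := by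
  have hn : 1 ≤ n := by
    have : 0 < r ^ 4 := by positivity
    omega
  rw [card_embeddings]
  refine (Finset.sum_le_sum fun E hE =>
    sum_rotations_numFixed_outerPerm_le (v := v) (M := n - 1) (r := r) ?_ ?_ ?_ ?_ ?_ hr hrn
      hnr).trans_eq ?_
  · exact ((mem_edgeSchemes G).1 hE).2.1
  · exact fun d d' => ((mem_edgeSchemes G).1 hE).eq_of_fst_eq hG
  · exact ((mem_edgeSchemes G).1 hE).fst_apply_ne hG
  · exact fun u hu => ((mem_edgeSchemes G).1 hE).exists_dart hG hu
  · intro u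
    rw [Fintype.card_fin, degree_of_eq_top hG, hV]
    omega
  · rw [Finset.sum_const, nsmul_eq_mul, hV, Nat.add_sub_cancel]
    push_cast
    ring

/-- The number of cycles of the local face permutation is close in distribution to the number of
cycles of a random permutation with the same parity bias. -/
theorem sum_abs_embProb_numCycles_sub_le :
    ∑ k ∈ Finset.Icc 1 n, |embProb G (fun m => numCycles (localFacePerm v m) = k)
        - stirlingDist n (embProb G fun m => IsOddPerm (localFacePerm v m)) k|
      ≤ 2 * hookConst / n + 160 / r := by
  have hn : 1 ≤ n := by
    have : 0 < r ^ 4 := by positivity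
    omega
  have hn' : (0 : ℝ) < n := by exact_mod_cast hn
  have hdeg : Fintype.card (Fin (G.degree v)) = n := by
    rw [Fintype.card_fin, degree_of_eq_top hG, hV, Nat.add_sub_cancel]
  have hne : Nonempty (Fin (G.degree v)) := Fintype.card_pos_iff.1 (by omega)
  have hN : (0 : ℝ) < (embeddings G).card := by exact_mod_cast (embeddings_nonempty hG).card_pos
  have h1 : ∀ k, embProb G (fun m => numCycles (localFacePerm v m) = k)
      = (∑ E ∈ edgeSchemes G, ∑ ρ ∈ rotations (fun u => Fin (G.degree u)),
        cycleFreq (outerPerm E ρ v) k) / (embeddings G).card := by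
    intro k
    rw [embProb_eq, sum_embeddings]
    simp only [numCycles_localFacePerm, sum_rotations_indicator_numCycles]
  have h2 : ∀ k, stirlingDist n (embProb G fun m => IsOddPerm (localFacePerm v m)) k
      = (∑ E ∈ edgeSchemes G, ∑ ρ ∈ rotations (fun u => Fin (G.degree u)),
        parityDist n (realSign (outerPerm E ρ v)) k) / (embeddings G).card := by
    intro k
    rw [embProb_eq, stirlingDist_average (embeddings_nonempty hG), sum_embeddings]
    congr 1
    refine Finset.sum_congr rfl fun E _ => Finset.sum_congr rfl fun ρ hρ => ?_
    have h3 := stirlingDist_eq_parityDist (mem_rotations.1 hρ v) (outerPerm E ρ v) k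
    rw [hdeg] at h3
    simp only [isOddPerm_localFacePerm]
    exact h3
  calc _ ≤ ∑ k ∈ Finset.range (n + 1), (∑ E ∈ edgeSchemes G,
        ∑ ρ ∈ rotations (fun u => Fin (G.degree u)), |cycleFreq (outerPerm E ρ v) k
          - parityDist n (realSign (outerPerm E ρ v)) k|)
            / (embeddings G).card := by
        refine (Finset.sum_le_sum_of_subset_of_nonneg (t := Finset.range (n + 1)) (fun k hk => ?_)
          fun _ _ _ => abs_nonneg _).trans (Finset.sum_le_sum fun k _ => ?_)
        · have := Finset.mem_Icc.1 hk
          exact Finset.mem_range.2 (by omega)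
        · rw [h1, h2, ← sub_div, abs_div, abs_of_pos hN, ← Finset.sum_sub_distrib]
          gcongr
          refine (Finset.abs_sum_le_sum_abs _ _).trans (Finset.sum_le_sum fun E _ => ?_)
          rw [← Finset.sum_sub_distrib]
          exact Finset.abs_sum_le_sum_abs _ _
    _ = (∑ E ∈ edgeSchemes G, ∑ ρ ∈ rotations (fun u => Fin (G.degree u)),
          ∑ k ∈ Finset.range (n + 1), |cycleFreq (outerPerm E ρ v) k
            - parityDist n (realSign (outerPerm E ρ v)) k|)
            / (embeddings G).card := by
        rw [← Finset.sum_div, Finset.sum_comm]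
        congr 1
        exact Finset.sum_congr rfl fun E _ => Finset.sum_comm
    _ ≤ (∑ E ∈ edgeSchemes G, ∑ ρ ∈ rotations (fun u => Fin (G.degree u)),
          (2 * hookConst / n + 8 / n * numFixed (outerPerm E ρ v))) / (embeddings G).card := by
        gcongr with E _ ρ _
        have h3 := sum_abs_cycleFreq_sub_realSign_le (outerPerm E ρ v) (n + 1)
        rw [hdeg] at h3
        refine h3.trans_eq ?_
        ring
    _ = 2 * hookConst / n + 8 / n * (∑ E ∈ edgeSchemes G,
          ∑ ρ ∈ rotations (fun u => Fin (G.degree u)), (numFixed (outerPerm E ρ v) : ℝ))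
            / (embeddings G).card := by
        simp only [Finset.sum_add_distrib, Finset.sum_const, nsmul_eq_mul, ← Finset.mul_sum]
        rw [add_div, ← mul_assoc, ← Nat.cast_mul, ← card_embeddings, mul_div_cancel_left₀ _ hN.ne']
    _ ≤ 2 * hookConst / n + 8 / n * ((embeddings G).card * n * (20 / r))
            / (embeddings G).card := by
        gcongr
        exact sum_numFixed_outerPerm_le hG hV hr hrn hnr v
    _ = _ := by
        field_simp
        ring

end Averages

/-! ### Limits -/

/-- The integral fourth root. -/
def fourthRoot (n : ℕ) : ℕ := Nat.sqrt (Nat.sqrt n)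

theorem fourthRoot_pow_le (n : ℕ) : fourthRoot n ^ 4 ≤ n := by
  calc fourthRoot n ^ 4 = (fourthRoot n ^ 2) ^ 2 := by ring
    _ ≤ Nat.sqrt n ^ 2 := Nat.pow_le_pow_left (Nat.sqrt_le' _) 2
    _ ≤ n := Nat.sqrt_le' n

theorem lt_fourthRoot_succ_pow (n : ℕ) : n < (fourthRoot n + 1) ^ 4 := by
  calc n < (Nat.sqrt n + 1) ^ 2 := Nat.lt_succ_sqrt' n
    _ ≤ ((fourthRoot n + 1) ^ 2) ^ 2 := Nat.pow_le_pow_left (Nat.lt_succ_sqrt' (Nat.sqrt n)) 2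
    _ = _ := by ring

theorem tendsto_sqrt_atTop : Tendsto Nat.sqrt atTop atTop := by
  refine tendsto_atTop.2 fun b => ?_
  filter_upwards [eventually_ge_atTop (b ^ 2)] with n hn
  exact Nat.le_sqrt'.2 hn

theorem tendsto_fourthRoot : Tendsto fourthRoot atTop atTop :=
  tendsto_sqrt_atTop.comp tendsto_sqrt_atTop

theorem tendsto_fourthRoot_pred : Tendsto (fun n => fourthRoot (n - 1)) atTop atTop :=
  tendsto_fourthRoot.comp (tendsto_sub_atTop_nat 1)

theorem eventually_fourthRoot_pred : ∀ᶠ n : ℕ in atTop, 2 ≤ fourthRoot (n - 1) ∧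
    fourthRoot (n - 1) ^ 4 ≤ n - 1 ∧ n - 1 ≤ 16 * fourthRoot (n - 1) ^ 4 := by
  filter_upwards [tendsto_fourthRoot_pred.eventually_ge_atTop 2] with n hn
  refine ⟨hn, fourthRoot_pow_le _, ?_⟩
  calc n - 1 ≤ (fourthRoot (n - 1) + 1) ^ 4 := (lt_fourthRoot_succ_pow _).le
    _ ≤ (2 * fourthRoot (n - 1)) ^ 4 := Nat.pow_le_pow_left (by omega) 4
    _ = _ := by ring

/-- The assertions about the faces at a vertex, for every set that contains the darts at the vertex
and misses at most one dart of the faces at the vertex. -/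
theorem faces_at_vertex_of_subset (v : ∀ n : ℕ, Fin (n + 1))
    (D' : ∀ n : ℕ, KMap (n + 1) → Finset (DartSet (K (n + 1))))
    (h1 : ∀ n m, dartsAt (K (n + 1)) (v n) ⊆ D' n m)
    (h2 : ∀ n m, D' n m ⊆ dartsOfFacesAt (v n) m)
    (h3 : ∀ n m, (dartsOfFacesAt (v n) m \ D' n m).card ≤ 1) :
    (∀ n, 1 ≤ n → ∀ m ∈ embeddings (K (n + 1)),
      numCycles (inducedPerm (facePerm m) (D' n m)) ∈ Finset.Icc 1 n) ∧
    Tendsto (fun n : ℕ => embExp (K (n + 1)) (fun m => ((D' n m).card : ℝ)) /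
      (Fintype.card (DartSet (K (n + 1))) : ℝ)) atTop (𝓝 1) ∧
    Tendsto (fun n : ℕ => tvDist n (cycleDist (n + 1) (D' n))
      (stirlingDist n (embProb (K (n + 1)) fun m => IsOddPerm (localFacePerm (v n) m))))
      atTop (𝓝 0) := by
  have hcyc : ∀ n m, numCycles (inducedPerm (facePerm m) (D' n m))
      = numCycles (localFacePerm (v n) m) := fun n m =>
    numCycles_inducedPerm_eq _ _ _ (h1 n m)
      fun z hz => exists_sameCycle_of_mem_dartsOfFacesAt (h2 n m hz)
  have hdarts : ∀ n, Fintype.card {d // d ∈ dartsAt (K (n + 1)) (v n)} = n := by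
    intro n
    rw [card_subtype_mem_dartsAt, degree_of_eq_top rfl, Fintype.card_fin, Nat.add_sub_cancel]
  have hr0 : Tendsto (fun n : ℕ => 1 / (fourthRoot (n - 1) : ℝ)) atTop (𝓝 0) :=
    tendsto_one_div_atTop_nhds_zero_nat.comp tendsto_fourthRoot_pred
  refine ⟨fun n hn m _ => ?_, ?_, ?_⟩
  · have : Nonempty {d // d ∈ dartsAt (K (n + 1)) (v n)} :=
      Fintype.card_pos_iff.1 (by rw [hdarts]; exact hn)
    rw [hcyc, Finset.mem_Icc]
    exact ⟨numCycles_pos _, (numCycles_le_card _).trans_eq (hdarts n)⟩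
  · have hlim : Tendsto (fun n : ℕ => 1 - (20 * (1 / (fourthRoot (n - 1) : ℝ)) + 1 / (n : ℝ)))
        atTop (𝓝 1) := by
      have := ((hr0.const_mul 20).add tendsto_one_div_atTop_nhds_zero_nat).const_sub 1
      simpa using this
    refine tendsto_of_tendsto_of_tendsto_of_le_of_le' hlim tendsto_const_nhds ?_ ?_
    · filter_upwards [eventually_fourthRoot_pred, eventually_ge_atTop 1] with n hr hn
      obtain ⟨hr, hrn, hnr⟩ := hr
      set N : ℝ := (Fintype.card (DartSet (K (n + 1))) : ℝ) with hN
      have hn' : (0 : ℝ) < n := by exact_mod_cast hn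
      have hNn : (n : ℝ) ≤ N := by
        rw [hN, card_dartSet_of_eq_top rfl, Fintype.card_fin, Nat.add_sub_cancel]
        exact_mod_cast Nat.le_mul_of_pos_left n (Nat.succ_pos n)
      have hN0 : 0 < N := hn'.trans_le hNn
      have hE : (0 : ℝ) < (embeddings (K (n + 1))).card := by
        exact_mod_cast (embeddings_nonempty rfl).card_pos
      have h4 := embExp_sub_card_dartsOfFacesAt_le rfl (by simp) hr hrn hnr (v n)
      rw [← hN, embExp, div_le_iff₀ hE, Finset.sum_sub_distrib, Finset.sum_const, nsmul_eq_mul]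
        at h4
      have h5 : ∑ m ∈ embeddings (K (n + 1)), ((dartsOfFacesAt (v n) m).card : ℝ)
          ≤ ∑ m ∈ embeddings (K (n + 1)), ((D' n m).card : ℝ)
            + (embeddings (K (n + 1))).card := by
        rw [Finset.card_eq_sum_ones, Nat.cast_sum, ← Finset.sum_add_distrib]
        refine Finset.sum_le_sum fun m _ => ?_
        have := Finset.card_sdiff_add_card_eq_card (h2 n m)
        have := h3 n m
        exact_mod_cast (by omega :
          (dartsOfFacesAt (v n) m).card ≤ (D' n m).card + 1)
      rw [embExp, le_div_iff₀ hN0, le_div_iff₀ hE]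
      -- There are at least n darts, so the one dart that may be missing costs a proportion of at
      -- most 1/n.
      have h6 : 1 ≤ 1 / (n : ℝ) * N := by rw [one_div_mul_eq_div, le_div_iff₀ hn']; linarith
      have h7 : (embeddings (K (n + 1))).card * 1
          ≤ (embeddings (K (n + 1))).card * (1 / (n : ℝ) * N) :=
        mul_le_mul_of_nonneg_left h6 hE.le
      have h8 : (20 : ℝ) / fourthRoot (n - 1) = 20 * (1 / fourthRoot (n - 1)) := by ring
      rw [h8] at h4
      linarith
    · refine Eventually.of_forall fun n => ?_
      rw [embExp]
      refine div_le_one_of_le₀ (div_le_of_le_mul₀ (Nat.cast_nonneg _) (Nat.cast_nonneg _) ?_)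
        (Nat.cast_nonneg _)
      refine (Finset.sum_le_sum fun m _ => Nat.cast_le.2 (Finset.card_le_univ _)).trans_eq ?_
      rw [Finset.sum_const, nsmul_eq_mul, mul_comm]
  · have hlim : Tendsto (fun n : ℕ => (1 / 2 : ℝ) * (2 * hookConst / n
        + 160 * (1 / (fourthRoot (n - 1) : ℝ)))) atTop (𝓝 0) := by
      have := ((tendsto_const_div_atTop_nhds_zero_nat (2 * hookConst)).add
        (hr0.const_mul 160)).const_mul (1 / 2)
      simpa using this
    refine tendsto_of_tendsto_of_tendsto_of_le_of_le' tendsto_const_nhds hlim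
      (Eventually.of_forall fun n => ?_) ?_
    · exact mul_nonneg (by norm_num) (Finset.sum_nonneg fun _ _ => abs_nonneg _)
    · filter_upwards [eventually_fourthRoot_pred] with n hr
      obtain ⟨hr, hrn, hnr⟩ := hr
      have h4 := sum_abs_embProb_numCycles_sub_le rfl (by simp) hr hrn hnr (v n)
      rw [mul_one_div]
      simp only [tvDist, cycleDist, hcyc]
      exact mul_le_mul_of_nonneg_left h4 (by norm_num)

theorem theorem3 (v : ∀ n : ℕ, Fin (n + 1)) :
    -- the set of all darts in faces incident with the vertex
    (∀ n, 1 ≤ n → ∀ m ∈ embeddings (K (n + 1)),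
      numCycles (inducedPerm (facePerm m) (dartsOfFacesAt (v n) m)) ∈ Finset.Icc 1 n) ∧
    Tendsto (fun n : ℕ =>
        embExp (K (n + 1)) (fun m => ((dartsOfFacesAt (v n) m).card : ℝ)) /
          (Fintype.card (DartSet (K (n + 1))) : ℝ)) atTop (𝓝 1) ∧
    Tendsto (fun n : ℕ =>
        tvDist n (cycleDist (n + 1) (dartsOfFacesAt (v n)))
          (stirlingDist n (embProb (K (n + 1)) fun m => IsOddPerm (localFacePerm (v n) m))))
      atTop (𝓝 0) ∧
    -- the same set up to at most one dart, with the parity of the induced permutation itself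
    ∃ D' : ∀ n : ℕ, KMap (n + 1) → Finset (DartSet (K (n + 1))),
      (∀ n, ∀ m ∈ embeddings (K (n + 1)),
        dartsAt (K (n + 1)) (v n) ⊆ D' n m ∧
        D' n m ⊆ dartsOfFacesAt (v n) m ∧
        (dartsOfFacesAt (v n) m \ D' n m).card ≤ 1 ∧
        (IsOddPerm (inducedPerm (facePerm m) (D' n m)) ↔ IsOddPerm (localFacePerm (v n) m))) ∧
      (∀ n, 1 ≤ n → ∀ m ∈ embeddings (K (n + 1)),
        numCycles (inducedPerm (facePerm m) (D' n m)) ∈ Finset.Icc 1 n) ∧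
      Tendsto (fun n : ℕ =>
          embExp (K (n + 1)) (fun m => ((D' n m).card : ℝ)) /
            (Fintype.card (DartSet (K (n + 1))) : ℝ)) atTop (𝓝 1) ∧
      Tendsto (fun n : ℕ =>
          tvDist n (cycleDist (n + 1) (D' n))
            (stirlingDist n (embProb (K (n + 1)) fun m =>
              IsOddPerm (inducedPerm (facePerm m) (D' n m)))))
        atTop (𝓝 0) := by
  have hsub : ∀ n m, dartsAt (K (n + 1)) (v n) ⊆ dartsOfFacesAt (v n) m := fun n m =>
    dartsAt_subset_dartsOfFacesAt (v n) m
  obtain ⟨hF1, hF2, hF3⟩ := faces_at_vertex_of_subset v (fun n => dartsOfFacesAt (v n)) hsub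
    (fun n m => subset_rfl) (fun n m => by simp)
  choose D' hD1 hD2 hD3 hD4 using fun n (m : KMap (n + 1)) =>
    exists_subset_isOddPerm_iff (facePerm m) (hsub n m)
      fun z hz => exists_sameCycle_of_mem_dartsOfFacesAt hz
  obtain ⟨h1, h2, h3⟩ := faces_at_vertex_of_subset v D' hD1 hD2 hD3
  refine ⟨hF1, hF2, hF3, D', fun n m _ => ⟨hD1 n m, hD2 n m, hD3 n m, hD4 n m⟩, h1, h2, ?_⟩
  -- The two parities agree, so `p` is the same number for α and for ω_v.
  simp only [hD4]
  exact h3
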